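/- Let $K'=\mathbb{C}(q,v)$ and let $\Lambda=K'[x_1,x_2,\dots]^{\mathfrak{S}_\infty}$ be the ring of symmetric functions over $K'$, i.e. the projective limit, in the category of graded rings, of the rings $\Lambda^m=K'[x_1,\dots,x_m]^{\mathfrak{S}_m}$ along the specializations $x_{m+1}=0$. Let $m_\lambda$ and $p_r$ denote the monomial symmetric functions and the power sums, write $m_r=m_{(r)}$ (with $m_0=1$), and let $<$ be the strict dominance order on partitions of a given integer. Let $\Delta:\Lambda\to\Lambda\otimes_{K'}\Lambda$ be the $K'$-algebra morphism with $\Delta(p_r)=p_r\otimes 1+1\otimes p_r$ for $r\ge 1$. *Macdonald polynomials.* For $m\ge 1$ let $$D_m=\sum_{i=1}^m\Big(\prod_{j\ne i}\frac{vx_i-v^{-1}x_j}{x_i-x_j}\Big)\partial_i,\qquad E_m=v^{1-m}\big(D_m-[m]\big),\qquad [m]=\frac{v^m-v^{-m}}{v-v^{-1}},$$ where $\partial_i$ is the substitution $x_i\mapsto qx_i$, and let $E$ be the operator on $\Lambda$ which is the limit of the $E_m$, i.e. $(Ef)(x_1,\dots,x_m)=E_m\big(f(x_1,\dots,x_m)\big)$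 for all $m\ge1$. For a partition $\lambda$, the Macdonald polynomial $P_\lambda=P_\lambda(q,v^2)$ is the unique eigenvector of $E$ with eigenvalue $\alpha_\lambda=\sum_{i\ge1}(q^{\lambda_i}-1)v^{-2(i-1)}$ such that $P_\lambda\in m_\lambda+\bigoplus_{\mu<\lambda}K'm_\mu$. The skew Macdonald polynomials $P_{\lambda/\mu}=P_{\lambda/\mu}(q,v^2)$, for partitions $\mu\subset\lambda$ (equality allowed), are determined by $\Delta(P_\lambda)=\sum_{\mu\subset\lambda}P_\mu\otimes P_{\lambda/\mu}$ for all $\lambda$. *Strips.* For $\mu\subset\lambda$ put $|\lambda/\mu|=|\lambda|-|\mu|$, and let $\lambda',\mu'$ be the conjugate partitions. Then $\lambda/\mu$ is a horizontal strip if $\lambda'_i-\mu'_i\le 1$ for all $i$, and in that case $$\psi_{\lambda/\mu}(q,v^2)=\prod\frac{(1-v^{2(\mu'_i-\mu'_j)}q^{j-i-1})(1-v^{2(\mu'_i-\mu'_j-1)}q^{j-i+1})}{(1-v^{2(\mu'_i-\mu'_j)}q^{j-i})(1-v^{2(\mu'_i-\mu'_j-1)}q^{j-i})},$$ the product being over all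 pairs $i<j$ with $\mu'_i=\lambda'_i$ and $\mu'_j=\lambda'_j-1$. **Proposition.** The morphism $\Delta$, the polynomials $P_\lambda$ and the family $(P_{\lambda/\mu})_{\mu\subset\lambda}$ exist and are uniquely determined by the properties above. Moreover, a family $(Q_{\lambda/\mu})_{\mu\subset\lambda}$ of elements of $\Lambda$, indexed by all pairs of partitions $\mu\subset\lambda$, satisfies the following four conditions for all $\mu\subset\lambda$, with $r=|\lambda/\mu|$, if and only if $Q_{\lambda/\mu}=P_{\lambda/\mu}(q,v^2)$ for all $\mu\subset\lambda$: 1. $Q_{\lambda/\mu}$ is homogeneous of degree $r$; 2. $\Delta(Q_{\lambda/\mu})=\sum_{\mu\subseteq\nu\subseteq\lambda}Q_{\nu/\mu}\otimes Q_{\lambda/\nu}$; 3. if $\lambda/\mu$ is not a horizontal strip, then $Q_{\lambda/\mu}\in\bigoplus_{\nu<(r)}K'm_\nu$; 4. if $\lambda/\mu$ is a horizontal strip, then $Q_{\lambda/\mu}\in\psi_{\lambda/\mu}(q,v^2)\,m_r+\bigoplus_{\nu<(r)}K'm_\nu$. -/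

import Mathlib

open scoped TensorProduct

namespace SkewMacdonald

/-! ### The ground field -/

/-- The field `K' = ℂ(q, v)` of rational functions in two independent variables. -/
abbrev K : Type := FractionRing (MvPolynomial (Fin 2) ℂ)

/-- The variable `q`. -/
noncomputable def q : K := algebraMap (MvPolynomial (Fin 2) ℂ) K (MvPolynomial.X 0)

/-- The variable `v`. -/
noncomputable def v : K := algebraMap (MvPolynomial (Fin 2) ℂ) K (MvPolynomial.X 1)

/-! ### The ring of symmetric functions -/

/-- The specialization `x_{m+1} = 0` from `m + 1` variables to `m` variables. -/
noncomputable def theta (m : ℕ) :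
    MvPolynomial (Fin (m + 1)) K →ₐ[K] MvPolynomial (Fin m) K :=
  MvPolynomial.aeval (Fin.lastCases 0 MvPolynomial.X)

/-- The ring of symmetric functions `K'[x₁, x₂, …]^{S_∞}`: the projective limit, in the category of
graded rings, of the rings of symmetric polynomials in `m` variables along the specializations
`x_{m+1} = 0`. An element is a compatible family of symmetric polynomials of bounded degree. -/
noncomputable def symmetricFunctions : Subalgebra K (∀ m : ℕ, MvPolynomial (Fin m) K) where
  carrier := {f | (∀ m, (f m).IsSymmetric) ∧ (∀ m, theta m (f (m + 1)) = f m) ∧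
    ∃ d, ∀ m, (f m).totalDegree ≤ d}
  mul_mem' := by
    rintro f g ⟨hf, hf', d, hd⟩ ⟨hg, hg', e, he⟩
    refine ⟨fun m => (hf m).mul (hg m), fun m => ?_, d + e, fun m => ?_⟩
    · simp [hf', hg']
    · exact (MvPolynomial.totalDegree_mul _ _).trans (add_le_add (hd m) (he m))
  add_mem' := by
    rintro f g ⟨hf, hf', d, hd⟩ ⟨hg, hg', e, he⟩
    refine ⟨fun m => (hf m).add (hg m), fun m => ?_, max d e, fun m => ?_⟩
    · simp [hf', hg']
    · exact (MvPolynomial.totalDegree_add _ _).trans (max_le_max (hd m) (he m))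
  algebraMap_mem' := by
    intro c
    refine ⟨fun m => MvPolynomial.IsSymmetric.C c, fun m => ?_, 0, fun m => ?_⟩
    · exact (theta m).commutes c
    · exact (MvPolynomial.totalDegree_C c).le

/-- The ring of symmetric functions, as a type. -/
abbrev SymFun : Type := symmetricFunctions

/-- The image of a symmetric function in the ring of polynomials in `x₁, …, x_m`. -/
noncomputable def restrict (m : ℕ) (f : SymFun) : MvPolynomial (Fin m) K := f.1 m

/-- `f` is homogeneous of degree `d`. -/
def IsHomogeneous (f : SymFun) (d : ℕ) : Prop := ∀ m, (restrict m f).IsHomogeneous d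

/-- The power sum `p_r = x₁ ^ r + x₂ ^ r + ⋯`, for `r = s + 1 ≥ 1`. -/
noncomputable def powerSum (s : ℕ) : SymFun :=
  ⟨fun m => MvPolynomial.psum (Fin m) K (s + 1), by
    refine ⟨fun m => MvPolynomial.psum_isSymmetric _ _ _, fun m => ?_, s + 1, fun m => ?_⟩
    · simp [MvPolynomial.psum, theta, Fin.sum_univ_castSucc]
    · unfold MvPolynomial.psum
      refine MvPolynomial.totalDegree_finsetSum_le fun i _ => ?_
      simp⟩

/-! ### Partitions

A partition `λ` is given by its Young diagram; with indices starting at `0` the part `λ_{i+1}` is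
`λ.rowLen i`, the part `λ'_{j+1}` of the conjugate partition is `λ.colLen j`, the size `|λ|` is
`λ.card`, and the inclusion `μ ⊂ λ` (not necessarily strict) is `μ ≤ λ`. -/

/-- The multiset of the nonzero parts of `μ`, as a partition of an integer (the size of `μ`). -/
def toPartition (μ : YoungDiagram) : Nat.Partition μ.rowLens.sum where
  parts := μ.rowLens
  parts_pos := fun {i} hi => μ.pos_of_mem_rowLens i (by simpa using hi)
  parts_sum := by simp

/-- The partition `(r)` with a single row of length `r` (the empty partition if `r = 0`). -/
def rowShape (r : ℕ) : YoungDiagram :=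
  YoungDiagram.ofRowLens [r] (List.pairwise_singleton _ r).sortedGE

/-- The strict dominance order on partitions of the same size. -/
def DominanceLT (μ lam : YoungDiagram) : Prop :=
  μ ≠ lam ∧ μ.card = lam.card ∧
    ∀ k, ∑ i ∈ Finset.range k, μ.rowLen i ≤ ∑ i ∈ Finset.range k, lam.rowLen i

/-- A partition contains only finitely many partitions. -/
theorem finite_Iic (lam : YoungDiagram) : (Set.Iic lam).Finite := by
  refine Set.Finite.of_finite_image (f := YoungDiagram.cells)
    ((Finset.finite_toSet lam.cells.powerset).subset ?_) ?_
  · rintro _ ⟨μ, hμ, rfl⟩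
    simpa using YoungDiagram.cells_subset_iff.2 hμ
  · intro a _ b _ h
    exact YoungDiagram.ext h

noncomputable instance fintypeIic (lam : YoungDiagram) : Fintype (Set.Iic lam) :=
  (finite_Iic lam).fintype

noncomputable instance fintypeIcc (μ lam : YoungDiagram) : Fintype (Set.Icc μ lam) :=
  ((finite_Iic lam).subset fun _ h => h.2).fintype

/-! ### Monomial symmetric functions -/

theorem ofSym_map_castSucc {m n : ℕ} (a : _root_.Sym (Fin m) n) :
    Nat.Partition.ofSym (a.map Fin.castSucc) = Nat.Partition.ofSym a := by
  have hinj : Function.Injective (Fin.castSucc : Fin m → Fin (m + 1)) :=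
    Fin.castSucc_injective m
  ext1
  simp only [Nat.Partition.ofSym, _root_.Sym.val_eq_coe, _root_.Sym.coe_map]
  rw [Multiset.dedup_map_of_injective hinj, Multiset.map_map]
  refine Multiset.map_congr rfl fun x _ => ?_
  exact Multiset.count_map_eq_count' _ _ hinj x

theorem theta_msymm (m n : ℕ) (μ : n.Partition) :
    theta m (MvPolynomial.msymm (Fin (m + 1)) K μ) = MvPolynomial.msymm (Fin m) K μ := by
  have hinj : Function.Injective (Fin.castSucc : Fin m → Fin (m + 1)) :=
    Fin.castSucc_injective m
  rw [MvPolynomial.msymm, MvPolynomial.msymm, map_sum]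
  symm
  refine Finset.sum_of_injOn
    (fun a => ⟨a.1.map Fin.castSucc, (ofSym_map_castSucc a.1).trans a.2⟩) ?_ ?_ ?_ ?_
  · intro a _ b _ h
    exact Subtype.ext (_root_.Sym.map_injective hinj n (congrArg Subtype.val h))
  · intro a _
    simp
  · rintro ⟨a, ha⟩ _ hna
    by_cases hl : Fin.last m ∈ a.1
    · rw [← Multiset.prod_hom, Multiset.map_map]
      refine Multiset.prod_eq_zero (Multiset.mem_map.2 ⟨_, hl, ?_⟩)
      simp [theta]
    · exfalso
      apply hna
      have : CanLift (Fin (m + 1)) (Fin m) Fin.castSucc (· ≠ Fin.last m) :=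
        ⟨fun x hx => Fin.exists_castSucc_eq.2 hx⟩
      obtain ⟨s, hs⟩ := a
      lift s to Multiset (Fin m) using fun x hx h => hl (h ▸ hx)
      have hs' : s.card = n := by simpa using hs
      have hmap : (⟨s.map Fin.castSucc, hs⟩ : _root_.Sym (Fin (m + 1)) n) =
          _root_.Sym.map Fin.castSucc ⟨s, hs'⟩ := rfl
      refine ⟨⟨⟨s, hs'⟩, ?_⟩, by simp, Subtype.ext hmap.symm⟩
      exact (ofSym_map_castSucc (⟨s, hs'⟩ : _root_.Sym (Fin m) n)).symm.trans (hmap ▸ ha)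
  · rintro ⟨a, ha⟩ _
    rw [← Multiset.prod_hom]
    simp [theta, Multiset.map_map]

theorem totalDegree_msymm_le (m n : ℕ) (μ : n.Partition) :
    (MvPolynomial.msymm (Fin m) K μ).totalDegree ≤ n := by
  refine MvPolynomial.totalDegree_finsetSum_le fun a _ => ?_
  refine (MvPolynomial.totalDegree_multiset_prod _).trans ?_
  simp [Multiset.map_map]

/-- The monomial symmetric function `m_μ`. -/
noncomputable def monomialSymm (μ : YoungDiagram) : SymFun :=
  ⟨fun m => MvPolynomial.msymm (Fin m) K (toPartition μ),
    fun m => MvPolynomial.msymm_isSymmetric (Fin m) K _, fun m => theta_msymm m _ _,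
    μ.rowLens.sum, fun m => totalDegree_msymm_le m _ _⟩

/-- The span `⨁_{ν < λ} K' m_ν` of the monomial symmetric functions `m_ν`, for `ν` strictly below
`λ` in the dominance order. -/
noncomputable def lowerSpan (lam : YoungDiagram) : Submodule K SymFun :=
  Submodule.span K (monomialSymm '' {ν | DominanceLT ν lam})

/-! ### The coproduct -/

/-- `D` is the coproduct: the algebra morphism for which all the power sums are primitive. -/
def IsCoproduct (D : SymFun →ₐ[K] SymFun ⊗[K] SymFun) : Prop :=
  ∀ s, D (powerSum s) = powerSum s ⊗ₜ[K] 1 + 1 ⊗ₜ[K] powerSum s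

instance nonemptyAlgHom : Nonempty (SymFun →ₐ[K] SymFun ⊗[K] SymFun) := ⟨Algebra.TensorProduct.includeLeft⟩

/-- The coproduct `Δ : Λ → Λ ⊗ Λ`, the algebra morphism with `Δ(p_r) = p_r ⊗ 1 + 1 ⊗ p_r` for all
`r ≥ 1`. -/
noncomputable def coproduct : SymFun →ₐ[K] SymFun ⊗[K] SymFun := Classical.epsilon IsCoproduct

/-! ### Macdonald's operator and Macdonald polynomials -/

/-- The `q`-shift `∂_i : x_i ↦ q x_i`, `x_j ↦ x_j` for `j ≠ i`. -/
noncomputable def qShift {m : ℕ} (i : Fin m) : MvPolynomial (Fin m) K →ₐ[K] MvPolynomial (Fin m) K :=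
  MvPolynomial.aeval fun j => if j = i then q • MvPolynomial.X j else MvPolynomial.X j

/-- The field of rational functions `K'(x₁, …, x_m)`. -/
abbrev RatFun (m : ℕ) : Type := FractionRing (MvPolynomial (Fin m) K)

/-- The inclusion of polynomials into rational functions. -/
noncomputable def toRat (m : ℕ) : MvPolynomial (Fin m) K →ₐ[K] RatFun m :=
  IsScalarTower.toAlgHom K (MvPolynomial (Fin m) K) (RatFun m)

/-- The variable `x_i` as a rational function. -/
noncomputable def ratX {m : ℕ} (i : Fin m) : RatFun m := toRat m (MvPolynomial.X i)

/-- Macdonald's operator `D_m = ∑_i (∏_{j ≠ i} (v x_i - v⁻¹ x_j) / (x_i - x_j)) ∂_i`. -/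
noncomputable def opD (m : ℕ) (f : MvPolynomial (Fin m) K) : RatFun m :=
  ∑ i, (∏ j ∈ Finset.univ.erase i, (v • ratX i - v⁻¹ • ratX j) / (ratX i - ratX j)) *
    toRat m (qShift i f)

/-- The `v`-integer `[m] = (v ^ m - v ^ (-m)) / (v - v⁻¹)`. -/
noncomputable def vInt (m : ℕ) : K := (v ^ m - v⁻¹ ^ m) / (v - v⁻¹)

/-- The renormalized operator `E_m = v ^ (1 - m) (D_m - [m])`. -/
noncomputable def opE (m : ℕ) (f : MvPolynomial (Fin m) K) : RatFun m :=
  v ^ (1 - (m : ℤ)) • (opD m f - vInt m • toRat m f)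

/-- The relation `E f = g`, where the operator `E` on symmetric functions is the stable limit of
the operators `E_m`, that is, `(E f)(x₁, …, x_m) = E_m (f(x₁, …, x_m))` for all `m ≥ 1`.
The symmetric function `g` is uniquely determined by these equations. -/
def StableE (f g : SymFun) : Prop := ∀ m ≥ 1, opE m (restrict m f) = toRat m (restrict m g)

/-- The eigenvalue `α_λ = ∑_{i ≥ 1} (q ^ λ_i - 1) v ^ (-2 (i - 1))`. -/
noncomputable def eigenvalue (lam : YoungDiagram) : K :=
  ∑ i ∈ Finset.range (lam.colLen 0), (q ^ lam.rowLen i - 1) * v⁻¹ ^ (2 * i)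

/-- `f` is an eigenvector of `E` with eigenvalue `α_λ` which lies in `m_λ + ⨁_{μ < λ} K' m_μ`. -/
def IsMacdonald (lam : YoungDiagram) (f : SymFun) : Prop :=
  StableE f (eigenvalue lam • f) ∧ f - monomialSymm lam ∈ lowerSpan lam

/-- The Macdonald polynomial `P_λ(q, v²)`. -/
noncomputable def macdonaldP (lam : YoungDiagram) : SymFun := Classical.epsilon (IsMacdonald lam)

/-! ### Skew Macdonald polynomials -/

/-- Families of symmetric functions `Q_{λ/μ}` indexed by the pairs of partitions `μ ⊂ λ`; the
value at `λ/μ` is `Q μ λ h`. -/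
abbrev SkewFamily : Type := ∀ μ lam : YoungDiagram, μ ≤ lam → SymFun

/-- The defining property of skew Macdonald polynomials:
`Δ(P_λ) = ∑_{μ ⊂ λ} P_μ ⊗ P_{λ/μ}` for all `λ`. -/
def IsSkewMacdonald (S : SkewFamily) : Prop :=
  ∀ lam, coproduct (macdonaldP lam) =
    ∑ μ : Set.Iic lam, macdonaldP μ.1 ⊗ₜ[K] S μ.1 lam μ.2

/-- The family of skew Macdonald polynomials `P_{λ/μ}(q, v²)`. -/
noncomputable def skewMacdonaldP : SkewFamily := Classical.epsilon IsSkewMacdonald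

/-- `λ/μ` has at most one box in each row. -/
def IsVerticalStrip (μ lam : YoungDiagram) : Prop := ∀ i, lam.rowLen i ≤ μ.rowLen i + 1

/-- The conjugate of `λ/μ` is a vertical strip. -/
def IsHorizontalStrip (μ lam : YoungDiagram) : Prop :=
  IsVerticalStrip μ.transpose lam.transpose

/-- The coefficient `ψ_{λ/μ}(q, v²)`: a product over the pairs of columns `i < j` such that
`μ'_i = λ'_i` and `μ'_j = λ'_j - 1`. -/
noncomputable def psi (μ lam : YoungDiagram) : K :=
  ∏ p ∈ (Finset.range (lam.rowLen 0) ×ˢ Finset.range (lam.rowLen 0)).filter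
      (fun p => p.1 < p.2 ∧ μ.colLen p.1 = lam.colLen p.1 ∧ μ.colLen p.2 + 1 = lam.colLen p.2),
    let a : ℤ := (μ.colLen p.1 : ℤ) - μ.colLen p.2
    let d : ℤ := (p.2 : ℤ) - p.1
    ((1 - v ^ (2 * a) * q ^ (d - 1)) * (1 - v ^ (2 * (a - 1)) * q ^ (d + 1))) /
      ((1 - v ^ (2 * a) * q ^ d) * (1 - v ^ (2 * (a - 1)) * q ^ d))

/-- The size `|λ/μ| = |λ| - |μ|` of a skew partition (used for `μ ⊂ λ` only). -/
def skewSize (μ lam : YoungDiagram) : ℕ := lam.card - μ.card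

/-- `Q_{λ/μ}` is homogeneous of degree `|λ/μ|`. -/
def HomogeneousFamily (Q : SkewFamily) : Prop :=
  ∀ μ lam (h : μ ≤ lam), IsHomogeneous (Q μ lam h) (skewSize μ lam)

/-- `Δ(Q_{λ/μ}) = ∑_{μ ⊂ ν ⊂ λ} Q_{ν/μ} ⊗ Q_{λ/ν}`. -/
def CoproductFormula (Q : SkewFamily) : Prop :=
  ∀ μ lam (h : μ ≤ lam), coproduct (Q μ lam h) =
    ∑ ν : Set.Icc μ lam, Q μ ν.1 ν.2.1 ⊗ₜ[K] Q ν.1 lam ν.2.2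

/-- If `λ/μ` is not a horizontal strip then `Q_{λ/μ} ∈ ⨁_{ν < (r)} K' m_ν`, `r = |λ/μ|`. -/
def VanishingCoefficient (Q : SkewFamily) : Prop :=
  ∀ μ lam (h : μ ≤ lam), ¬ IsHorizontalStrip μ lam →
    Q μ lam h ∈ lowerSpan (rowShape (skewSize μ lam))

/-- If `λ/μ` is a horizontal strip then `Q_{λ/μ} ∈ ψ_{λ/μ} m_r + ⨁_{ν < (r)} K' m_ν`,
`r = |λ/μ|`. -/
def StripCoefficient (Q : SkewFamily) : Prop :=
  ∀ μ lam (h : μ ≤ lam), IsHorizontalStrip μ lam →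
    Q μ lam h - psi μ lam • monomialSymm (rowShape (skewSize μ lam)) ∈
      lowerSpan (rowShape (skewSize μ lam))

end SkewMacdonald

/-!
The polynomials `P_λ` are built explicitly, one variable at a time, from the branching
coefficients `ψ_{λ/μ}`, and then recognized as Macdonald polynomials; the same construction started
from a partition `μ` instead of the empty one gives the skew polynomials (`skewSym`).

Write `u_c = t ^ μ'_c q ^ (-c)` with `t = v²`, so that `ψ_{λ/μ}` is a product of values
`w(u_i / u_j)` of one rational function `w`, over pairs of columns. Expansion in partial fractions
gives two identities for sums of products of `w` (`sum_prod_factor`, `sum_inv_mul_prod_factor`).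
On the vector space with a basis of partitions, consider the operators `removeStrip k`, which
remove a horizontal strip of size `k` with weight `ψ`, and the diagonal operator of the eigenvalues
`α_λ`. The two identities express the commutators of `removeStrip 1` with `removeStrip k`
(they vanish) and of `removeStrip (k + 1)` with the diagonal operator (`removeStrip_recursion`).
Since the `α_λ` are distinct, all the operators `removeStrip k` commute (`removeStrip_comm`), which
is exactly the symmetry of the polynomials `skewPoly`.

On the side of symmetric functions, `Λ` is a polynomial ring in the power sums (`powerSumEquiv`),
hence morphisms out of `Λ` can be prescribed and compared on power sums. The operator
`extract k` is the coefficient of `y ^ k` after the addition of a variable `y`; it sends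
`P_{λ/μ}` to `∑_ν ψ_{λ/ν} P_{ν/μ}`, the sum over the horizontal strips `λ/ν` of size `k`, and a
symmetric function is determined by its constant term and by its images under `extract k`, `k ≥ 1`
(`ext_of_extract`). Macdonald's operator `E` is given on `Λ` by a vertex operator (`macdonaldE`,
`stableE_iff`), and it satisfies with the `extract k` the same commutation relation as the diagonal
operator with the `removeStrip k` (`extract_macdonaldE`). An induction on the size of `λ` then
gives `E P_λ = α_λ P_λ` (`macdonaldE_skewSym`). Together with triangularity
(`skewSym_sub_mem_lowerSpan`) and the distinctness of the eigenvalues this gives the existence and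
uniqueness of Macdonald polynomials.

Finally `extract k` is the contraction of the coproduct with the coefficient of the one-row
monomial function `m_k` (`lTensor_rowCoeff_coproduct`). For a family `Q` with the four properties,
these coefficients are the `ψ`, so that all `extract k` of `Q_{λ/μ}` with `k ≥ 1` are known by
induction and `Q` is unique; the same principle, applied in the second factor of `Λ ⊗ Λ`, gives the
coproduct of the skew polynomials (`coproduct_skewSym`).
-/

namespace SkewMacdonald

/-! ### Partial fractions -/

section PartialFractions

open Polynomial

variable {F ι : Type*} [Field F] [DecidableEq ι]

/-- Partial fractions for `∏ (X - b i) / ∏ (X - a i)`, with denominators cleared. -/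
theorem prod_sub_eq_add_sum (S : Finset ι) (a b : ι → F) (ha : Set.InjOn a S) :
    ∏ i ∈ S, (X - C (b i)) = ∏ i ∈ S, (X - C (a i)) +
      ∑ i ∈ S, C ((∏ j ∈ S, (a i - b j)) / ∏ j ∈ S.erase i, (a i - a j)) *
        ∏ j ∈ S.erase i, (X - C (a j)) := by
  rcases S.eq_empty_or_nonempty with rfl | hS
  · simp
  refine Polynomial.eq_of_degree_sub_lt_of_eval_index_eq S ha ?_ ?_
  · rw [← sub_sub]
    refine lt_of_le_of_lt (degree_sub_le _ _) (max_lt ?_ ?_)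
    · have hm : ∀ c : ι → F, (∏ i ∈ S, (X - C (c i))).Monic := fun c =>
        monic_prod_of_monic _ _ fun i _ => monic_X_sub_C _
      have hd : ∀ c : ι → F, (∏ i ∈ S, (X - C (c i))).degree = (S.card : WithBot ℕ) := fun c => by
        rw [degree_prod]; simp
      refine (degree_sub_lt_left ?_ (hm b).ne_zero ?_).trans_eq (hd b)
      · rw [hd, hd]
      · rw [(hm b).leadingCoeff, (hm a).leadingCoeff]
    · refine lt_of_le_of_lt (degree_sum_le _ _) ?_
      rw [Finset.sup_lt_iff (by simp [bot_lt_iff_ne_bot])]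
      intro i hi
      refine lt_of_le_of_lt (degree_mul_le _ _) ?_
      refine lt_of_le_of_lt (add_le_add_left degree_C_le _) ?_
      rw [degree_prod]
      simp only [degree_X_sub_C, Finset.sum_const, Finset.card_erase_of_mem hi, zero_add,
        nsmul_eq_mul, mul_one]
      have := Finset.card_pos.2 hS
      exact_mod_cast Nat.sub_lt this one_pos
  · intro i hi
    have h0 : ∏ j ∈ S, (a i - a j) = 0 := Finset.prod_eq_zero hi (sub_self _)
    have hne : ∏ j ∈ S.erase i, (a i - a j) ≠ 0 := by
      refine Finset.prod_ne_zero_iff.2 fun j hj => sub_ne_zero.2 fun h => ?_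
      exact (Finset.ne_of_mem_erase hj) (ha (Finset.mem_of_mem_erase hj) hi h.symm)
    simp only [eval_add, eval_prod, eval_sub, eval_X, eval_C, eval_finsetSum, eval_mul, h0, zero_add]
    rw [Finset.sum_eq_single i]
    · field_simp
    · intro k hk hki
      have h1 : ∏ j ∈ S.erase k, (a i - a j) = 0 :=
        Finset.prod_eq_zero (Finset.mem_erase.2 ⟨hki.symm, hi⟩) (sub_self (a i))
      rw [h1, mul_zero]
    · exact fun h => absurd hi h

/-- The residue at the node `a i` of `∏ (z - b j) / ∏ (z - a j)`. -/
noncomputable def residue (S : Finset ι) (a b : ι → F) (i : ι) : F :=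
  (∏ j ∈ S, (a i - b j)) / ∏ j ∈ S.erase i, (a i - a j)

/-- The sum of the residues of `∏ (z - b_i) / ∏ (z - a_i) · dz / z` at the points `a_i`: those at `0`
and `∞` cancel when `∏ b_i = ∏ a_i`. It is the value at `0` of the partial fractions. -/
theorem sum_residue_div (S : Finset ι) (a b : ι → F) (ha : Set.InjOn a S)
    (ha0 : ∀ i ∈ S, a i ≠ 0) (hab : ∏ i ∈ S, b i = ∏ i ∈ S, a i) :
    ∑ i ∈ S, residue S a b i / a i = 0 := by
  have h := congrArg (eval 0) (prod_sub_eq_add_sum S a b ha)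
  simp only [eval_add, eval_prod, eval_sub, eval_X, eval_C, eval_finsetSum, eval_mul, zero_sub,
    Finset.prod_neg, hab, left_eq_add] at h
  have hP : (∏ i ∈ S, a i) ≠ 0 := Finset.prod_ne_zero_iff.2 ha0
  have : (-1) ^ (S.card + 1) * (∏ i ∈ S, a i) * ∑ i ∈ S, residue S a b i / a i = 0 := by
    rw [← h, Finset.mul_sum]
    refine Finset.sum_congr rfl fun i hi => ?_
    rw [← Finset.mul_prod_erase S a hi, Finset.card_erase_of_mem hi, residue]
    obtain ⟨n, hn⟩ := Nat.exists_eq_succ_of_ne_zero (Finset.card_ne_zero_of_mem hi)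
    rw [hn]
    have := ha0 i hi
    simp only [Nat.succ_eq_add_one, Nat.add_sub_cancel, pow_succ]
    field_simp
  simpa [hP] using this

/-- The sum of the residues of `∏ (z - b_i) / ∏ (z - a_i) · dz / z ^ 2` at the points `a_i`, which is
minus the logarithmic derivative at `0` when `∏ b_i = ∏ a_i`. -/
theorem sum_residue_div_sq (S : Finset ι) (a b : ι → F) (ha : Set.InjOn a S)
    (ha0 : ∀ i ∈ S, a i ≠ 0) (hb0 : ∀ i ∈ S, b i ≠ 0) (hab : ∏ i ∈ S, b i = ∏ i ∈ S, a i) :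
    ∑ i ∈ S, residue S a b i / a i ^ 2 = ∑ i ∈ S, ((b i)⁻¹ - (a i)⁻¹) := by
  have hP : (∏ i ∈ S, (-a i)) ≠ 0 :=
    Finset.prod_ne_zero_iff.2 fun i hi => neg_ne_zero.2 (ha0 i hi)
  have key : ∀ (T : Finset ι) (c : ι → F), (∀ i ∈ T, c i ≠ 0) →
      eval 0 (derivative (∏ i ∈ T, (X - C (c i)))) =
        -(∏ i ∈ T, (-c i)) * ∑ i ∈ T, (c i)⁻¹ := by
    intro T c hc
    rw [derivative_prod_finset, eval_finsetSum, Finset.mul_sum]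
    refine Finset.sum_congr rfl fun i hi => ?_
    rw [← Finset.mul_prod_erase T _ hi]
    have := hc i hi
    simp only [derivative_sub, derivative_X, derivative_C, sub_zero, mul_one, eval_prod, eval_sub,
      eval_X, eval_C, zero_sub]
    field_simp
  have hab' : ∏ i ∈ S, (-b i) = ∏ i ∈ S, (-a i) := by simp [Finset.prod_neg, hab]
  have h := congrArg (fun p => eval 0 (derivative p)) (prod_sub_eq_add_sum S a b ha)
  simp only [derivative_add, derivative_sum, derivative_C_mul, eval_add, eval_finsetSum, eval_mul,
    eval_C] at h
  rw [key S b hb0, key S a ha0, hab'] at h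
  have h2 : ∀ i ∈ S, (∏ j ∈ S, (a i - b j)) / (∏ j ∈ S.erase i, (a i - a j)) *
      eval 0 (derivative (∏ j ∈ S.erase i, (X - C (a j)))) =
      (∏ i ∈ S, (-a i)) * ((∑ j ∈ S, (a j)⁻¹) * (residue S a b i / a i) -
        residue S a b i / a i ^ 2) := by
    intro i hi
    rw [key _ _ fun j hj => ha0 j (Finset.mem_of_mem_erase hj),
      ← Finset.mul_prod_erase S (fun j => -a j) hi, ← Finset.add_sum_erase S _ hi, residue]
    have := ha0 i hi
    field_simp
    ring
  rw [Finset.sum_congr rfl h2, ← Finset.mul_sum, Finset.sum_sub_distrib, ← Finset.mul_sum,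
    sum_residue_div S a b ha ha0 hab] at h
  rw [Finset.sum_sub_distrib]
  refine mul_left_cancel₀ hP ?_
  linear_combination h

/-- The elementary factor `(x - q y)(x - t q⁻¹ y) / ((x - y)(x - t y))` of the branching
coefficients. -/
noncomputable def factor (q t x y : F) : F :=
  ((x - q * y) * (x - t / q * y)) / ((x - y) * (x - t * y))

theorem factor_mul_mul (q t c x y : F) (hc : c ≠ 0) :
    factor q t (c * x) (c * y) = factor q t x y := by
  unfold factor
  rw [show ((c * x - q * (c * y)) * (c * x - t / q * (c * y))) =
      (c * c) * ((x - q * y) * (x - t / q * y)) by ring,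
    show ((c * x - c * y) * (c * x - t * (c * y))) = (c * c) * ((x - y) * (x - t * y)) by ring,
    mul_div_mul_left _ _ (mul_ne_zero hc hc)]

/-- The symmetry `w(t / z) = w(z)` of the rational function `w`. -/
theorem factor_mul_left (q t x y : F) (hq : q ≠ 0) (ht : t ≠ 0) :
    factor q t (t * y) x = factor q t x y := by
  unfold factor
  rw [show ((t * y - q * x) * (t * y - t / q * x)) = t * ((x - q * y) * (x - t / q * y)) by
      field_simp; ring,
    show ((t * y - x) * (t * y - t * x)) = t * ((x - y) * (x - t * y)) by ring,
    mul_div_mul_left _ _ ht]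

section Strip

variable (q t : F) (S : Finset ι) (u : ι → F)

theorem disjSum_erase_inl (c : ι) :
    (S.disjSum S).erase (Sum.inl c) = (S.erase c).disjSum S := by
  ext (x | x) <;> simp

theorem disjSum_erase_inr (c : ι) :
    (S.disjSum S).erase (Sum.inr c) = S.disjSum (S.erase c) := by
  ext (x | x) <;> simp

variable (hq : q ≠ 0) (ht : t ≠ 0) (ht1 : t ≠ 1) (hu0 : ∀ i ∈ S, u i ≠ 0)

include hq ht ht1 hu0

omit ht in
/-- The residue at the first kind of nodes, the points `u_c`. -/
theorem residue_inl {c : ι} (hc : c ∈ S) :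
    residue (S.disjSum S) (Sum.elim u fun i => t * u i)
      (Sum.elim (fun i => q * u i) fun i => t / q * u i) (Sum.inl c) =
      (1 - q) * (1 - t / q) / (1 - t) * (u c * ∏ j ∈ S.erase c, factor q t (u c) (u j)) := by
  have h1 : 1 - t ≠ 0 := sub_ne_zero.2 ht1.symm
  have hc0 := hu0 c hc
  unfold residue
  rw [disjSum_erase_inl, Finset.prod_disjSum, Finset.prod_disjSum]
  simp only [Sum.elim_inl, Sum.elim_inr, factor, Finset.prod_div_distrib, Finset.prod_mul_distrib]
  rw [← Finset.mul_prod_erase S (fun x => u c - q * u x) hc,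
    ← Finset.mul_prod_erase S (fun x => u c - t / q * u x) hc,
    ← Finset.mul_prod_erase S (fun x => u c - t * u x) hc]
  rw [show u c - q * u c = u c * (1 - q) by ring, show u c - t / q * u c = u c * (1 - t / q) by ring,
    show u c - t * u c = u c * (1 - t) by ring]
  generalize ∏ x ∈ S.erase c, (u c - q * u x) = A
  generalize ∏ x ∈ S.erase c, (u c - t / q * u x) = B
  generalize ∏ x ∈ S.erase c, (u c - u x) = D
  generalize ∏ x ∈ S.erase c, (u c - t * u x) = E
  simp only [div_eq_mul_inv, mul_inv]
  field_simp

/-- The residue at the second kind of nodes, the points `t u_c`. -/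
theorem residue_inr {c : ι} (hc : c ∈ S) :
    residue (S.disjSum S) (Sum.elim u fun i => t * u i)
      (Sum.elim (fun i => q * u i) fun i => t / q * u i) (Sum.inr c) =
      -((1 - q) * (1 - t / q) / (1 - t)) *
        (t * u c * ∏ j ∈ S.erase c, factor q t (u j) (u c)) := by
  have h1 : 1 - t ≠ 0 := sub_ne_zero.2 ht1.symm
  have hc0 := hu0 c hc
  unfold residue
  rw [disjSum_erase_inr, Finset.prod_disjSum, Finset.prod_disjSum,
    Finset.prod_congr rfl fun j _ => (factor_mul_left q t (u j) (u c) hq ht).symm]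
  simp only [Sum.elim_inl, Sum.elim_inr, factor, Finset.prod_div_distrib, Finset.prod_mul_distrib]
  rw [← Finset.mul_prod_erase S (fun x => t * u c - q * u x) hc,
    ← Finset.mul_prod_erase S (fun x => t * u c - t / q * u x) hc,
    ← Finset.mul_prod_erase S (fun x => t * u c - u x) hc]
  rw [show t * u c - q * u c = -(q * u c * (1 - t / q)) by field_simp; ring,
    show t * u c - t / q * u c = -(t / q * u c * (1 - q)) by field_simp; ring,
    show t * u c - u c = -(u c * (1 - t)) by ring]
  generalize ∏ x ∈ S.erase c, (t * u c - q * u x) = A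
  generalize ∏ x ∈ S.erase c, (t * u c - t / q * u x) = B
  generalize ∏ x ∈ S.erase c, (t * u c - u x) = D
  generalize ∏ x ∈ S.erase c, (t * u c - t * u x) = E
  simp only [div_eq_mul_inv, mul_inv, inv_neg]
  field_simp

variable (hu : Set.InjOn u S) (htu : ∀ i ∈ S, ∀ j ∈ S, u i ≠ t * u j)

include hu htu

omit [DecidableEq ι] hq ht1 hu0 in
theorem injOn_nodes : Set.InjOn (Sum.elim u fun i => t * u i) (S.disjSum S : Set (ι ⊕ ι)) := by
  rintro (i | i) hi (j | j) hj h <;>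
    simp only [Finset.mem_coe, Finset.inl_mem_disjSum, Finset.inr_mem_disjSum, Sum.elim_inl,
      Sum.elim_inr] at hi hj h
  · rw [hu hi hj h]
  · exact absurd h (htu i hi j hj)
  · exact absurd h.symm (htu j hj i hi)
  · rw [hu hi hj (mul_left_cancel₀ ht h)]

variable (hq1 : q ≠ 1) (hqt : q ≠ t)

include hq1 hqt

/-- The sum of the residues of `∏ⱼ w(z / uⱼ) dz / z` vanishes, where `w(x / y) = factor q t x y`. -/
theorem sum_prod_factor :
    ∑ c ∈ S, ∏ j ∈ S.erase c, factor q t (u c) (u j) =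
      ∑ c ∈ S, ∏ j ∈ S.erase c, factor q t (u j) (u c) := by
  have h := sum_residue_div (S.disjSum S) (Sum.elim u fun i => t * u i)
    (Sum.elim (fun i => q * u i) fun i => t / q * u i) (injOn_nodes t S u ht hu htu)
    (by rintro (i | i) hi <;> simp at hi <;> simp [hu0 i hi, ht])
    (by
      simp only [Finset.prod_disjSum, Sum.elim_inl, Sum.elim_inr, ← Finset.prod_mul_distrib]
      refine Finset.prod_congr rfl fun i _ => ?_
      field_simp)
  have hk : (1 - q) * (1 - t / q) / (1 - t) ≠ 0 := by
    refine div_ne_zero (mul_ne_zero (sub_ne_zero.2 hq1.symm) (sub_ne_zero.2 fun h => hqt ?_))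
      (sub_ne_zero.2 ht1.symm)
    field_simp at h
    exact h
  have hl : ∀ c ∈ S, residue (S.disjSum S) (Sum.elim u fun i => t * u i)
      (Sum.elim (fun i => q * u i) fun i => t / q * u i) (Sum.inl c) / u c =
      (1 - q) * (1 - t / q) / (1 - t) * ∏ j ∈ S.erase c, factor q t (u c) (u j) := fun c hc => by
    rw [residue_inl q t S u hq ht1 hu0 hc, mul_div_assoc, mul_div_cancel_left₀ _ (hu0 c hc)]
  have hr : ∀ c ∈ S, residue (S.disjSum S) (Sum.elim u fun i => t * u i)
      (Sum.elim (fun i => q * u i) fun i => t / q * u i) (Sum.inr c) / (t * u c) =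
      -((1 - q) * (1 - t / q) / (1 - t)) * ∏ j ∈ S.erase c, factor q t (u j) (u c) :=
    fun c hc => by
      rw [residue_inr q t S u hq ht ht1 hu0 hc, mul_div_assoc,
        mul_div_cancel_left₀ _ (mul_ne_zero ht (hu0 c hc))]
  simp only [Finset.sum_disjSum, Sum.elim_inl, Sum.elim_inr] at h
  rw [Finset.sum_congr rfl hl, Finset.sum_congr rfl hr, ← Finset.mul_sum, ← Finset.mul_sum] at h
  refine mul_left_cancel₀ hk ?_
  linear_combination h

/-- The sum of the residues of `∏ⱼ w(z / uⱼ) dz / z²` vanishes, where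
`w(x / y) = factor q t x y`. -/
theorem sum_inv_mul_prod_factor :
    ∑ c ∈ S, (u c)⁻¹ * ∏ j ∈ S.erase c, factor q t (u c) (u j) -
      t⁻¹ * ∑ c ∈ S, (u c)⁻¹ * ∏ j ∈ S.erase c, factor q t (u j) (u c) =
      (1 - t⁻¹) * ∑ c ∈ S, (u c)⁻¹ := by
  have h := sum_residue_div_sq (S.disjSum S) (Sum.elim u fun i => t * u i)
    (Sum.elim (fun i => q * u i) fun i => t / q * u i) (injOn_nodes t S u ht hu htu)
    (by rintro (i | i) hi <;> simp at hi <;> simp [hu0 i hi, ht])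
    (by rintro (i | i) hi <;> simp at hi <;> simp [hu0 i hi, ht, hq])
    (by
      simp only [Finset.prod_disjSum, Sum.elim_inl, Sum.elim_inr, ← Finset.prod_mul_distrib]
      refine Finset.prod_congr rfl fun i _ => ?_
      field_simp)
  have hk : (1 - q) * (1 - t / q) / (1 - t) ≠ 0 := by
    refine div_ne_zero (mul_ne_zero (sub_ne_zero.2 hq1.symm) (sub_ne_zero.2 fun h => hqt ?_))
      (sub_ne_zero.2 ht1.symm)
    field_simp at h
    exact h
  have hl : ∀ c ∈ S, residue (S.disjSum S) (Sum.elim u fun i => t * u i)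
      (Sum.elim (fun i => q * u i) fun i => t / q * u i) (Sum.inl c) / u c ^ 2 =
      (1 - q) * (1 - t / q) / (1 - t) *
        ((u c)⁻¹ * ∏ j ∈ S.erase c, factor q t (u c) (u j)) := fun c hc => by
    rw [residue_inl q t S u hq ht1 hu0 hc]
    have := hu0 c hc
    field_simp
  have hr : ∀ c ∈ S, residue (S.disjSum S) (Sum.elim u fun i => t * u i)
      (Sum.elim (fun i => q * u i) fun i => t / q * u i) (Sum.inr c) / (t * u c) ^ 2 =
      -((1 - q) * (1 - t / q) / (1 - t)) *
        (t⁻¹ * ((u c)⁻¹ * ∏ j ∈ S.erase c, factor q t (u j) (u c))) := fun c hc => by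
    rw [residue_inr q t S u hq ht ht1 hu0 hc]
    have := hu0 c hc
    field_simp
  have hs : ∀ c ∈ S, (q * u c)⁻¹ - (u c)⁻¹ + ((t / q * u c)⁻¹ - (t * u c)⁻¹) =
      ((1 - q) * (1 - t / q) / (1 - t) * (1 - t⁻¹)) * (u c)⁻¹ := fun c hc => by
    have := hu0 c hc
    have h1 : 1 - t ≠ 0 := sub_ne_zero.2 ht1.symm
    field_simp
    ring
  simp only [Finset.sum_disjSum, Sum.elim_inl, Sum.elim_inr] at h
  rw [Finset.sum_congr rfl hl, Finset.sum_congr rfl hr, ← Finset.sum_add_distrib (s := S)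
    (f := fun c => (q * u c)⁻¹ - (u c)⁻¹), Finset.sum_congr rfl hs, ← Finset.mul_sum, ← Finset.mul_sum, ← Finset.mul_sum,
    ← Finset.mul_sum] at h
  refine mul_left_cancel₀ hk ?_
  linear_combination h

end Strip

end PartialFractions

/-! ### The parameters -/

/-- Macdonald's second parameter `t = v²`. -/
noncomputable def t : K := v ^ 2

theorem monomial_ne {a b c d : ℕ} (h : q ^ a * v ^ b = q ^ c * v ^ d) : a = c ∧ b = d := by
  unfold q v at h
  rw [← map_pow, ← map_pow, ← map_pow, ← map_pow, ← map_mul, ← map_mul] at h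
  have h' := IsFractionRing.injective (MvPolynomial (Fin 2) ℂ) K h
  have e : ∀ m n : ℕ, (MvPolynomial.X 0 ^ m * MvPolynomial.X 1 ^ n : MvPolynomial (Fin 2) ℂ) =
      MvPolynomial.monomial (Finsupp.single 0 m + Finsupp.single 1 n) 1 := fun m n => by
    rw [MvPolynomial.X_pow_eq_monomial, MvPolynomial.X_pow_eq_monomial,
      MvPolynomial.monomial_mul, one_mul]
  rw [e, e] at h'
  have h2 := MvPolynomial.monomial_left_injective (R := ℂ) one_ne_zero h'
  constructor
  · simpa using DFunLike.congr_fun h2 0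
  · simpa using DFunLike.congr_fun h2 1

theorem q_ne_zero : q ≠ 0 := by
  unfold q
  exact (map_ne_zero_iff _ (IsFractionRing.injective (MvPolynomial (Fin 2) ℂ) K)).2
    (MvPolynomial.X_ne_zero 0)

theorem v_ne_zero : v ≠ 0 := by
  unfold v
  exact (map_ne_zero_iff _ (IsFractionRing.injective (MvPolynomial (Fin 2) ℂ) K)).2
    (MvPolynomial.X_ne_zero 1)

theorem t_ne_zero : t ≠ 0 := pow_ne_zero 2 v_ne_zero

theorem t_ne_one : t ≠ 1 := fun h => by
  have := (monomial_ne (a := 0) (b := 2) (c := 0) (d := 0) (by simpa [t] using h)).2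
  omega

theorem q_ne_one : q ≠ 1 := fun h => by
  have := (monomial_ne (a := 1) (b := 0) (c := 0) (d := 0) (by simpa using h)).1
  omega

theorem q_ne_t : q ≠ t := fun h => by
  have := (monomial_ne (a := 1) (b := 0) (c := 0) (d := 2) (by simpa [t] using h)).1
  omega

theorem q_pow_injective : Function.Injective fun n : ℕ => q ^ n := fun m n h =>
  (monomial_ne (a := m) (b := 0) (c := n) (d := 0) (by simpa using h)).1

/-! ### Branching coefficients for column lengths -/

/-- The content variable `t ^ (a c) q ^ (-c)` of the first empty box of column `c`, where `a` is
the sequence of column lengths. -/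
noncomputable def colVar (a : ℕ →₀ ℕ) (c : ℕ) : K := t ^ a c * (q ^ c)⁻¹

theorem colVar_ne_zero (a : ℕ →₀ ℕ) (c : ℕ) : colVar a c ≠ 0 :=
  mul_ne_zero (pow_ne_zero _ t_ne_zero) (inv_ne_zero (pow_ne_zero _ q_ne_zero))

theorem pow_mul_colVar_eq {a b : ℕ →₀ ℕ} {c d m n : ℕ}
    (h : t ^ m * colVar a c = t ^ n * colVar b d) : c = d ∧ m + a c = n + b d := by
  unfold colVar at h
  have hc := pow_ne_zero c q_ne_zero
  have hd := pow_ne_zero d q_ne_zero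
  have h' : q ^ d * v ^ (2 * (m + a c)) = q ^ c * v ^ (2 * (n + b d)) := by
    rw [pow_mul, pow_mul, ← t, pow_add, pow_add]
    field_simp at h
    linear_combination h
  have := monomial_ne h'
  omega

theorem colVar_injective (a : ℕ →₀ ℕ) : Function.Injective (colVar a) := fun c d h =>
  (pow_mul_colVar_eq (m := 0) (n := 0) (a := a) (b := a) (by simpa using h)).1

theorem colVar_ne_t_mul (a : ℕ →₀ ℕ) (c d : ℕ) : colVar a c ≠ t * colVar a d := fun h => by
  have := pow_mul_colVar_eq (m := 0) (n := 1) (a := a) (b := a) (by simpa using h)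
  obtain ⟨rfl, h⟩ := this
  omega

theorem colVar_add_single (a : ℕ →₀ ℕ) (c i : ℕ) :
    colVar (a + Finsupp.single c 1) i = if i = c then t * colVar a i else colVar a i := by
  unfold colVar
  split_ifs with h
  · subst h
    simp only [Finsupp.coe_add, Pi.add_apply, Finsupp.single_eq_same]
    ring
  · simp [Ne.symm h]

/-- The product of the factors attached to the pairs of columns `i < j` with `i ∉ S` and
`j ∈ S`. -/
noncomputable def branch (S : Finset ℕ) (u : ℕ → K) : K :=
  ∏ j ∈ S, ∏ i ∈ Finset.range j \ S, factor q t (u i) (u j)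

theorem branch_singleton (c : ℕ) (u : ℕ → K) :
    branch {c} u = ∏ i ∈ Finset.range c, factor q t (u i) (u c) := by
  rw [branch, Finset.prod_singleton, Finset.sdiff_singleton_eq_erase,
    Finset.erase_eq_of_notMem (by simp)]

theorem prod_range_eq (S : Finset ℕ) (c : ℕ) (f : ℕ → K) :
    ∏ i ∈ Finset.range c, f i =
      (∏ i ∈ Finset.range c \ S, f i) * ∏ i ∈ S.erase c, if i < c then f i else 1 := by
  rw [← Finset.prod_filter, ← Finset.prod_sdiff (Finset.inter_subset_left (s₁ := Finset.range c) (s₂ := S)),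
    Finset.sdiff_inter_self_left]
  congr 1
  refine Finset.prod_congr ?_ fun _ _ => rfl
  ext i
  simp only [Finset.mem_inter, Finset.mem_range, Finset.mem_filter, Finset.mem_erase]
  grind

/-- Removing the box of column `c` last. -/
theorem branch_remove_last {S : Finset ℕ} {c : ℕ} (hc : c ∈ S) (u u' : ℕ → K)
    (h1 : ∀ i ∈ S.erase c, u' i = t * u i) (h2 : ∀ i ∉ S.erase c, u' i = u i) :
    branch {c} u' * branch (S.erase c) u =
      branch S u * ∏ j ∈ S.erase c, factor q t (u c) (u j) := by
  have e1 : branch {c} u' = (∏ i ∈ Finset.range c \ S, factor q t (u i) (u c)) *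
      ∏ i ∈ S.erase c, if i < c then factor q t (u c) (u i) else 1 := by
    rw [branch_singleton, prod_range_eq S c]
    congr 1
    · refine Finset.prod_congr rfl fun i hi => ?_
      rw [h2 i (by grind), h2 c (by grind)]
    · refine Finset.prod_congr rfl fun i hi => ?_
      rw [h1 i hi, h2 c (by grind), factor_mul_left _ _ _ _ q_ne_zero t_ne_zero]
  have e2 : branch (S.erase c) u = (∏ j ∈ S.erase c, ∏ i ∈ Finset.range j \ S,
      factor q t (u i) (u j)) * ∏ j ∈ S.erase c, if c < j then factor q t (u c) (u j) else 1 := by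
    rw [branch, ← Finset.prod_mul_distrib]
    refine Finset.prod_congr rfl fun j hj => ?_
    split_ifs with h
    · rw [show Finset.range j \ S.erase c = insert c (Finset.range j \ S) by
          ext i; simp only [Finset.mem_sdiff, Finset.mem_range, Finset.mem_erase,
            Finset.mem_insert]; grind,
        Finset.prod_insert (by simp [hc]), mul_comm]
    · rw [show Finset.range j \ S.erase c = Finset.range j \ S by
          ext i; simp only [Finset.mem_sdiff, Finset.mem_range, Finset.mem_erase]; grind, mul_one]
  have e3 : (∏ i ∈ S.erase c, if i < c then factor q t (u c) (u i) else 1) *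
      (∏ j ∈ S.erase c, if c < j then factor q t (u c) (u j) else 1) =
      ∏ j ∈ S.erase c, factor q t (u c) (u j) := by
    rw [← Finset.prod_mul_distrib]
    refine Finset.prod_congr rfl fun j hj => ?_
    have := Finset.ne_of_mem_erase hj
    rcases lt_or_gt_of_ne this with h | h
    · simp [h, h.not_gt]
    · simp [h, h.not_gt]
  rw [e1, e2, ← e3, branch, ← Finset.mul_prod_erase S _ hc]
  ring

/-- Adding the box of column `c` first. -/
theorem branch_add_first {S : Finset ℕ} {c : ℕ} (hc : c ∈ S) (u u' : ℕ → K)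
    (h1 : u' c = t * u c) (h2 : ∀ i, i ≠ c → u' i = u i) :
    branch {c} u * branch (S.erase c) u' =
      branch S u * ∏ j ∈ S.erase c, factor q t (u j) (u c) := by
  have e1 : branch {c} u = (∏ i ∈ Finset.range c \ S, factor q t (u i) (u c)) *
      ∏ i ∈ S.erase c, if i < c then factor q t (u i) (u c) else 1 := by
    rw [branch_singleton, prod_range_eq S c]
  have e2 : branch (S.erase c) u' = (∏ j ∈ S.erase c, ∏ i ∈ Finset.range j \ S,
      factor q t (u i) (u j)) * ∏ j ∈ S.erase c, if c < j then factor q t (u j) (u c) else 1 := by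
    rw [branch, ← Finset.prod_mul_distrib]
    refine Finset.prod_congr rfl fun j hj => ?_
    have hjc := Finset.ne_of_mem_erase hj
    have e4 : ∏ i ∈ Finset.range j \ S, factor q t (u' i) (u' j) =
        ∏ i ∈ Finset.range j \ S, factor q t (u i) (u j) := by
      refine Finset.prod_congr rfl fun i hi => ?_
      rw [h2 i (by rintro rfl; simp [hc] at hi), h2 j hjc]
    split_ifs with h
    · rw [show Finset.range j \ S.erase c = insert c (Finset.range j \ S) by
          ext i; simp only [Finset.mem_sdiff, Finset.mem_range, Finset.mem_erase,
            Finset.mem_insert]; grind,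
        Finset.prod_insert (by simp [hc]), mul_comm, e4, h1, h2 j hjc,
        factor_mul_left _ _ _ _ q_ne_zero t_ne_zero]
    · rw [show Finset.range j \ S.erase c = Finset.range j \ S by
          ext i; simp only [Finset.mem_sdiff, Finset.mem_range, Finset.mem_erase]; grind, mul_one,
        e4]
  have e3 : (∏ i ∈ S.erase c, if i < c then factor q t (u i) (u c) else 1) *
      (∏ j ∈ S.erase c, if c < j then factor q t (u j) (u c) else 1) =
      ∏ j ∈ S.erase c, factor q t (u j) (u c) := by
    rw [← Finset.prod_mul_distrib]
    refine Finset.prod_congr rfl fun j hj => ?_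
    have := Finset.ne_of_mem_erase hj
    rcases lt_or_gt_of_ne this with h | h
    · simp [h, h.not_gt]
    · simp [h, h.not_gt]
  rw [e1, e2, ← e3, branch, ← Finset.mul_prod_erase S _ hc]
  ring

/-- When the column `c` receives two boxes, the extra box may be added first or last. -/
theorem branch_double {S : Finset ℕ} {c : ℕ} (hc : c ∈ S) (u u₁ u₂ : ℕ → K)
    (h1 : ∀ i ∈ S, u₁ i = t * u i) (h1' : ∀ i ∉ S, u₁ i = u i)
    (h2 : u₂ c = t * u c) (h2' : ∀ i, i ≠ c → u₂ i = u i) :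
    branch {c} u₁ * branch S u = branch {c} u * branch S u₂ := by
  have e1 : branch {c} u₁ = (∏ i ∈ Finset.range c \ S, factor q t (u i) (t * u c)) *
      ∏ i ∈ S.erase c, if i < c then factor q t (u i) (u c) else 1 := by
    rw [branch_singleton, prod_range_eq S c]
    congr 1
    · refine Finset.prod_congr rfl fun i hi => ?_
      rw [h1' i (by grind), h1 c hc]
    · refine Finset.prod_congr rfl fun i hi => ?_
      rw [h1 i (Finset.mem_of_mem_erase hi), h1 c hc, factor_mul_mul _ _ _ _ _ t_ne_zero]
  have e2 : branch {c} u = (∏ i ∈ Finset.range c \ S, factor q t (u i) (u c)) *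
      ∏ i ∈ S.erase c, if i < c then factor q t (u i) (u c) else 1 := by
    rw [branch_singleton, prod_range_eq S c]
  have e3 : branch S u₂ = (∏ i ∈ Finset.range c \ S, factor q t (u i) (t * u c)) *
      ∏ j ∈ S.erase c, ∏ i ∈ Finset.range j \ S, factor q t (u i) (u j) := by
    rw [branch, ← Finset.mul_prod_erase S _ hc]
    have hne : ∀ {i j : ℕ}, i ∈ Finset.range j \ S → i ≠ c := by
      rintro i j hi rfl; simp [hc] at hi
    congr 1
    · refine Finset.prod_congr rfl fun i hi => ?_
      rw [h2, h2' i (hne hi)]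
    · refine Finset.prod_congr rfl fun j hj => Finset.prod_congr rfl fun i hi => ?_
      rw [h2' i (hne hi), h2' j (Finset.ne_of_mem_erase hj)]
  rw [e1, e2, e3, branch, ← Finset.mul_prod_erase S _ hc]
  ring

/-- The branching coefficient from column lengths `a` to column lengths `b`. -/
noncomputable def colBranch (a b : ℕ →₀ ℕ) : K :=
  open Classical in
  if a ≤ b ∧ ∀ i, b i ≤ a i + 1 then branch (b - a).support (colVar a) else 0

theorem colBranch_of_le {a b : ℕ →₀ ℕ} (h : a ≤ b) (h' : ∀ i, b i ≤ a i + 1) :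
    colBranch a b = branch (b - a).support (colVar a) := if_pos ⟨h, h'⟩

theorem colBranch_of_not {a b : ℕ →₀ ℕ} (h' : ¬ ∀ i, b i ≤ a i + 1) :
    colBranch a b = 0 := if_neg fun h => h' h.2

theorem colBranch_add_single (a : ℕ →₀ ℕ) (c : ℕ) :
    colBranch a (a + Finsupp.single c 1) = branch {c} (colVar a) := by
  rw [colBranch_of_le le_self_add]
  · rw [add_tsub_cancel_left, Finsupp.support_single _ one_ne_zero]
  · intro i
    by_cases h : c = i <;> simp [h]

theorem mem_support_sub {a b : ℕ →₀ ℕ} {i : ℕ} : i ∈ (b - a).support ↔ a i < b i := by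
  rw [Finsupp.mem_support_iff, Finsupp.tsub_apply]; omega

/-- A branching coefficient out of a partition vanishes unless it leads to a partition. -/
theorem antitone_of_colBranch_ne_zero {a b : ℕ →₀ ℕ} (ha : Antitone a) (h : colBranch a b ≠ 0) :
    Antitone b := by
  have hab : a ≤ b ∧ ∀ i, b i ≤ a i + 1 := by
    by_contra h'
    exact h (if_neg h')
  rw [colBranch_of_le hab.1 hab.2] at h
  refine antitone_nat_of_succ_le fun j => ?_
  by_contra! hj
  have h1 := ha (Nat.le_succ j)
  have h2 := hab.2 (j + 1)
  have h3 := hab.1 j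
  have h3' := hab.1 (j + 1)
  simp only [Nat.succ_eq_add_one] at h1
  refine h (Finset.prod_eq_zero (i := j + 1) (mem_support_sub.2 (by omega))
    (Finset.prod_eq_zero (i := j) ?_ ?_))
  · rw [Finset.mem_sdiff, mem_support_sub]
    exact ⟨by simp, by omega⟩
  -- the columns `j` and `j + 1` have equal length, which makes the numerator of their factor zero
  · have : colVar a j = q * colVar a (j + 1) := by
      have := q_ne_zero
      rw [colVar, colVar, show a j = a (j + 1) by omega, pow_succ q j]
      field_simp
    rw [factor, this]
    simp

section Identities

variable {a b : ℕ →₀ ℕ}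

theorem colBranch_sub_single {c : ℕ} (hc : 0 < b c) :
    colBranch (b - Finsupp.single c 1) b = branch {c} (colVar (b - Finsupp.single c 1)) := by
  have : b = (b - Finsupp.single c 1) + Finsupp.single c 1 :=
    (tsub_add_cancel_of_le (Finsupp.single_le_iff.2 hc)).symm
  conv_lhs => arg 2; rw [this]
  exact colBranch_add_single _ _

theorem colVar_of_lt {i : ℕ} (h : b i = a i + 1) : colVar b i = t * colVar a i := by
  rw [colVar, colVar, h]; ring

theorem colVar_of_eq {i : ℕ} (h : b i = a i) : colVar b i = colVar a i := by
  rw [colVar, colVar, h]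

theorem colBranch_mul_remove (hab : a ≤ b) (hb : ∀ i, b i ≤ a i + 1) {c : ℕ}
    (hc : c ∈ (b - a).support) :
    colBranch (b - Finsupp.single c 1) b * colBranch a (b - Finsupp.single c 1) =
      colBranch a b * ∏ j ∈ (b - a).support.erase c, factor q t (colVar a c) (colVar a j) := by
  have hc' := mem_support_sub.1 hc
  have hs : ∀ i, (b - Finsupp.single c 1 : ℕ →₀ ℕ) i = if i = c then b i - 1 else b i := fun i => by
    rw [Finsupp.tsub_apply, Finsupp.single_apply]; grind
  rw [colBranch_sub_single (by omega), colBranch_of_le hab hb, colBranch_of_le,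
    show (b - Finsupp.single c 1 - a : ℕ →₀ ℕ).support = (b - a).support.erase c by
      ext i
      rw [mem_support_sub, Finset.mem_erase, mem_support_sub, hs]
      have := hb i
      grind]
  · refine branch_remove_last hc _ _ (fun i hi => colVar_of_lt ?_) (fun i hi => colVar_of_eq ?_)
    · rw [Finset.mem_erase, mem_support_sub] at hi
      rw [hs]
      have := hb i
      grind
    · rw [Finset.mem_erase, mem_support_sub] at hi
      rw [hs]
      have := hb i
      have := hab i
      grind
  · intro i
    rw [hs]
    have := hab i
    grind
  · intro i
    rw [hs]
    have := hb i
    grind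

theorem colBranch_mul_add (hab : a ≤ b) (hb : ∀ i, b i ≤ a i + 1) {c : ℕ}
    (hc : c ∈ (b - a).support) :
    colBranch (a + Finsupp.single c 1) b * colBranch a (a + Finsupp.single c 1) =
      colBranch a b * ∏ j ∈ (b - a).support.erase c, factor q t (colVar a j) (colVar a c) := by
  have hc' := mem_support_sub.1 hc
  have hs : ∀ i, (a + Finsupp.single c 1 : ℕ →₀ ℕ) i = if i = c then a i + 1 else a i := fun i => by
    rw [Finsupp.add_apply, Finsupp.single_apply]; grind
  rw [colBranch_add_single, colBranch_of_le hab hb, colBranch_of_le,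
    show (b - (a + Finsupp.single c 1) : ℕ →₀ ℕ).support = (b - a).support.erase c by
      ext i
      rw [mem_support_sub, Finset.mem_erase, mem_support_sub, hs]
      have := hb i
      grind, mul_comm]
  · refine branch_add_first hc _ _ ?_ fun i hi => ?_
    · rw [colVar_add_single, if_pos rfl]
    · rw [colVar_add_single, if_neg hi]
  · intro i
    rw [hs]
    have := hab i
    grind
  · intro i
    rw [hs]
    have := hb i
    grind

/-- If column `c` receives at least two boxes, then the summands of `c` on the two sides of
`sum_colBranch_comm` agree, and unless they vanish the two values of the column variable differ by the factor `t`. -/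
theorem colBranch_mul_double {c : ℕ} (hab : a ≤ b) (hc : a c + 2 ≤ b c) :
    colBranch (b - Finsupp.single c 1) b * colBranch a (b - Finsupp.single c 1) =
      colBranch (a + Finsupp.single c 1) b * colBranch a (a + Finsupp.single c 1) ∧
    (colBranch (b - Finsupp.single c 1) b * colBranch a (b - Finsupp.single c 1) ≠ 0 →
      colVar (b - Finsupp.single c 1) c = t * colVar a c) := by
  have hs : ∀ i, (b - Finsupp.single c 1 : ℕ →₀ ℕ) i = if i = c then b i - 1 else b i := fun i => by
    rw [Finsupp.tsub_apply, Finsupp.single_apply]; grind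
  have hs' : ∀ i, (a + Finsupp.single c 1 : ℕ →₀ ℕ) i = if i = c then a i + 1 else a i := fun i => by
    rw [Finsupp.add_apply, Finsupp.single_apply]; grind
  by_cases hb : ∀ i, b i ≤ (a + Finsupp.single c 1 : ℕ →₀ ℕ) i + 1
  · have hbc : b c = a c + 2 := by have := hb c; rw [hs'] at this; grind
    refine ⟨?_, fun _ => colVar_of_lt ?_⟩
    · have hS : (b - (a + Finsupp.single c 1)).support = (b - Finsupp.single c 1 - a).support := by
        ext i
        rw [mem_support_sub, mem_support_sub, hs, hs']
        grind
      rw [colBranch_sub_single (by omega), colBranch_add_single, colBranch_of_le,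
        colBranch_of_le _ hb, hS]
      · refine (branch_double (mem_support_sub.2 ?_) _ _ _ (fun i hi => colVar_of_lt ?_)
          (fun i hi => colVar_of_eq ?_) ?_ fun i hi => ?_).trans (mul_comm _ _)
        · rw [hs]; grind
        · rw [mem_support_sub, hs] at hi
          have := hb i
          rw [hs'] at this
          rw [hs]
          grind
        · rw [mem_support_sub, hs] at hi
          have := hab i
          rw [hs]
          grind
        · rw [colVar_add_single, if_pos rfl]
        · rw [colVar_add_single, if_neg hi]
      · intro i
        rw [hs']
        have := hab i
        grind
      · intro i
        rw [hs]
        have := hab i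
        grind
      · intro i
        have := hb i
        rw [hs'] at this
        rw [hs]
        grind
    · rw [hs]; grind
  · rw [colBranch_of_not hb, colBranch_of_not (a := a) (b := b - Finsupp.single c 1)]
    · simp
    · intro h
      refine hb fun i => ?_
      have := h i
      rw [hs] at this
      rw [hs']
      grind

theorem colBranch_mul_of_ne {c d : ℕ} (hd : a d + 2 ≤ b d) (hcd : c ≠ d) :
    colBranch (b - Finsupp.single c 1) b * colBranch a (b - Finsupp.single c 1) = 0 ∧
    colBranch (a + Finsupp.single c 1) b * colBranch a (a + Finsupp.single c 1) = 0 := by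
  constructor
  · rw [colBranch_of_not (a := a), mul_zero]
    intro h
    have := h d
    rw [Finsupp.tsub_apply, Finsupp.single_apply, if_neg hcd] at this
    omega
  · rw [colBranch_of_not (b := b), zero_mul]
    intro h
    have := h d
    rw [Finsupp.add_apply, Finsupp.single_apply, if_neg hcd] at this
    omega

/-- Adding a horizontal strip and then one box, or one box and then a horizontal strip, gives the same
total weight. If every column receives at most one box this is `sum_prod_factor`; otherwise at most
one column contributes, with the same summand on both sides. -/
theorem sum_colBranch_comm (hab : a ≤ b) :
    ∑ c ∈ (b - a).support,
      colBranch (b - Finsupp.single c 1) b * colBranch a (b - Finsupp.single c 1) =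
    ∑ c ∈ (b - a).support,
      colBranch (a + Finsupp.single c 1) b * colBranch a (a + Finsupp.single c 1) := by
  by_cases hb : ∀ i, b i ≤ a i + 1
  · rw [Finset.sum_congr rfl fun c hc => colBranch_mul_remove hab hb hc,
      Finset.sum_congr rfl fun c hc => colBranch_mul_add hab hb hc, ← Finset.mul_sum,
      ← Finset.mul_sum, sum_prod_factor q t _ _ q_ne_zero t_ne_zero t_ne_one
        (fun i _ => colVar_ne_zero a i) (colVar_injective a).injOn
        (fun i _ j _ => colVar_ne_t_mul a i j) q_ne_one q_ne_t]
  · push Not at hb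
    obtain ⟨d, hd⟩ := hb
    refine Finset.sum_congr rfl fun c _ => ?_
    by_cases hcd : c = d
    · subst hcd
      exact (colBranch_mul_double hab hd).1
    · rw [(colBranch_mul_of_ne hd hcd).1, (colBranch_mul_of_ne hd hcd).2]

/-- The version of `sum_colBranch_comm` in which each box carries the weight that it contributes to the
eigenvalue, and the second sum is multiplied by `t⁻¹`. It follows from `sum_inv_mul_prod_factor` if
every column receives at most one box. -/
theorem sum_inv_colVar_mul_colBranch (hab : a ≤ b) :
    ∑ c ∈ (b - a).support, (colVar (b - Finsupp.single c 1) c)⁻¹ *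
      (colBranch (b - Finsupp.single c 1) b * colBranch a (b - Finsupp.single c 1)) -
    t⁻¹ * ∑ c ∈ (b - a).support, (colVar a c)⁻¹ *
      (colBranch (a + Finsupp.single c 1) b * colBranch a (a + Finsupp.single c 1)) =
    (1 - t⁻¹) * ((∑ c ∈ (b - a).support, (colVar a c)⁻¹) * colBranch a b) := by
  by_cases hb : ∀ i, b i ≤ a i + 1
  · have h := sum_inv_mul_prod_factor q t (b - a).support (colVar a) q_ne_zero t_ne_zero t_ne_one
      (fun i _ => colVar_ne_zero a i) (colVar_injective a).injOn
      (fun i _ j _ => colVar_ne_t_mul a i j) q_ne_one q_ne_t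
    have e1 : ∀ c ∈ (b - a).support, (colVar (b - Finsupp.single c 1) c)⁻¹ *
        (colBranch (b - Finsupp.single c 1) b * colBranch a (b - Finsupp.single c 1)) =
        colBranch a b * ((colVar a c)⁻¹ *
          ∏ j ∈ (b - a).support.erase c, factor q t (colVar a c) (colVar a j)) := fun c hc => by
      have := mem_support_sub.1 hc
      have := hb c
      rw [colBranch_mul_remove hab hb hc, colVar_of_eq (a := a) (b := b - Finsupp.single c 1)
        (by rw [Finsupp.tsub_apply, Finsupp.single_eq_same]; omega)]
      ring
    have e2 : ∀ c ∈ (b - a).support, (colVar a c)⁻¹ *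
        (colBranch (a + Finsupp.single c 1) b * colBranch a (a + Finsupp.single c 1)) =
        colBranch a b * ((colVar a c)⁻¹ *
          ∏ j ∈ (b - a).support.erase c, factor q t (colVar a j) (colVar a c)) := fun c hc => by
      rw [colBranch_mul_add hab hb hc]
      ring
    rw [Finset.sum_congr rfl e1, Finset.sum_congr rfl e2, ← Finset.mul_sum, ← Finset.mul_sum]
    linear_combination colBranch a b * h
  · rw [colBranch_of_not hb, mul_zero, mul_zero]
    push Not at hb
    obtain ⟨d, hd⟩ := hb
    rw [Finset.mul_sum, ← Finset.sum_sub_distrib]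
    refine Finset.sum_eq_zero fun c _ => ?_
    by_cases hcd : c = d
    · subst hcd
      obtain ⟨h1, h2⟩ := colBranch_mul_double hab hd
      rw [← h1]
      by_cases h0 : colBranch (b - Finsupp.single c 1) b * colBranch a (b - Finsupp.single c 1) = 0
      · rw [h0]; simp
      · rw [h2 h0, mul_inv]; ring
    · rw [(colBranch_mul_of_ne hd hcd).1, (colBranch_mul_of_ne hd hcd).2]
      simp

end Identities

/-! ### Branching coefficients of Young diagrams -/

/-- The column lengths of a Young diagram. -/
noncomputable def cols (μ : YoungDiagram) : ℕ →₀ ℕ :=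
  Finsupp.onFinset (Finset.range (μ.rowLen 0)) μ.colLen fun j hj => by
    rw [Finset.mem_range, ← YoungDiagram.mem_iff_lt_rowLen, YoungDiagram.mem_iff_lt_colLen]
    omega

@[simp]
theorem cols_apply (μ : YoungDiagram) (j : ℕ) : cols μ j = μ.colLen j := rfl

theorem cols_antitone (μ : YoungDiagram) : Antitone (cols μ) := fun _ _ h => μ.colLen_anti _ _ h

theorem cols_le_iff {μ lam : YoungDiagram} : cols μ ≤ cols lam ↔ μ ≤ lam := by
  constructor
  · rintro h ⟨i, j⟩ hij
    have := h j
    simp only [cols_apply] at this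
    have hij' : i < μ.colLen j := YoungDiagram.mem_iff_lt_colLen.1 hij
    exact YoungDiagram.mem_iff_lt_colLen.2 (hij'.trans_le this)
  · intro h j
    simp only [cols_apply]
    by_contra! hlt
    have h1 : (lam.colLen j, j) ∈ μ := YoungDiagram.mem_iff_lt_colLen.2 hlt
    have h2 := YoungDiagram.mem_iff_lt_colLen.1 (h h1)
    omega

theorem cols_injective : Function.Injective cols := fun _ _ h =>
  le_antisymm (cols_le_iff.1 h.le) (cols_le_iff.1 h.ge)

theorem exists_cols_eq {a : ℕ →₀ ℕ} (ha : Antitone a) : ∃ μ, cols μ = a := by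
  have hmem : ∀ i j, (i, j) ∈ ((a.support.sigma fun j => Finset.range (a j)).image
      fun x => (x.2, x.1)) ↔ i < a j := by
    intro i j
    simp only [Finset.mem_image, Finset.mem_sigma, Finsupp.mem_support_iff, Finset.mem_range,
      Sigma.exists, Prod.mk.injEq]
    constructor
    · rintro ⟨_, _, ⟨_, h2⟩, rfl, rfl⟩
      exact h2
    · intro h
      exact ⟨j, i, ⟨by omega, h⟩, rfl, rfl⟩
  have hlow : IsLowerSet (((a.support.sigma fun j => Finset.range (a j)).image
      fun x => (x.2, x.1) : Finset (ℕ × ℕ)) : Set (ℕ × ℕ)) := by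
    rintro ⟨i, j⟩ ⟨i', j'⟩ ⟨hi, hj⟩ h
    rw [Finset.mem_coe, hmem] at h ⊢
    exact lt_of_le_of_lt hi (h.trans_le (ha hj))
  refine ⟨⟨_, hlow⟩, Finsupp.ext fun j => eq_of_forall_lt_iff fun i => ?_⟩
  rw [cols_apply, ← YoungDiagram.mem_iff_lt_colLen, YoungDiagram.mem_mk, hmem]

theorem sum_cells_eq_sum_cols {M : Type*} [AddCommMonoid M] (μ : YoungDiagram) (f : ℕ × ℕ → M) :
    ∑ x ∈ μ.cells, f x = (cols μ).sum fun j n => ∑ i ∈ Finset.range n, f (i, j) := by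
  rw [Finsupp.sum, ← Finset.sum_fiberwise_of_maps_to (g := Prod.snd) (t := (cols μ).support)]
  · refine Finset.sum_congr rfl fun j _ => ?_
    change ∑ x ∈ μ.col j, f x = _
    rw [YoungDiagram.col_eq_prod, Finset.sum_product]
    simp
  · rintro ⟨i, j⟩ h
    rw [YoungDiagram.mem_cells, YoungDiagram.mem_iff_lt_colLen] at h
    simp only [Finsupp.mem_support_iff, cols_apply]
    omega

theorem sum_cells_eq_sum_rows {M : Type*} [AddCommMonoid M] (μ : YoungDiagram) (f : ℕ × ℕ → M) :
    ∑ x ∈ μ.cells, f x =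
      ∑ i ∈ Finset.range (μ.colLen 0), ∑ j ∈ Finset.range (μ.rowLen i), f (i, j) := by
  rw [← Finset.sum_fiberwise_of_maps_to (g := Prod.fst) (t := Finset.range (μ.colLen 0))]
  · refine Finset.sum_congr rfl fun i _ => ?_
    change ∑ x ∈ μ.row i, f x = _
    rw [YoungDiagram.row_eq_prod, Finset.sum_product]
    simp
  · rintro ⟨i, j⟩ h
    rw [Finset.mem_range, ← YoungDiagram.mem_iff_lt_colLen]
    exact μ.up_left_mem le_rfl (Nat.zero_le j) h

theorem card_eq_degree (μ : YoungDiagram) : μ.card = (cols μ).degree := by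
  rw [YoungDiagram.card, Finset.card_eq_sum_ones, sum_cells_eq_sum_cols]
  simp [Finsupp.sum, Finsupp.degree_apply]

theorem card_mono {μ lam : YoungDiagram} (h : μ ≤ lam) : μ.card ≤ lam.card :=
  Finset.card_le_card h

theorem eq_of_le_of_card_le {μ lam : YoungDiagram} (h : μ ≤ lam) (h' : lam.card ≤ μ.card) :
    μ = lam := YoungDiagram.ext (Finset.eq_of_subset_of_card_le h h')

/-- The sum over the boxes which gives the eigenvalue, in terms of column lengths. -/
noncomputable def colEigenvalue (a : ℕ →₀ ℕ) : K :=
  (q - 1) * a.sum fun j n => ∑ i ∈ Finset.range n, q ^ j * t⁻¹ ^ i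

theorem eigenvalue_eq_sum_cells (μ : YoungDiagram) :
    eigenvalue μ = (q - 1) * ∑ x ∈ μ.cells, q ^ x.2 * t⁻¹ ^ x.1 := by
  rw [sum_cells_eq_sum_rows, eigenvalue, Finset.mul_sum]
  refine Finset.sum_congr rfl fun i _ => ?_
  simp only
  rw [← Finset.sum_mul, ← mul_assoc, mul_geom_sum, t, pow_mul, inv_pow]

theorem eigenvalue_eq_colEigenvalue (μ : YoungDiagram) :
    eigenvalue μ = colEigenvalue (cols μ) := by
  rw [eigenvalue_eq_sum_cells, colEigenvalue, sum_cells_eq_sum_cols]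

theorem colEigenvalue_sub {a b : ℕ →₀ ℕ} (hab : a ≤ b) (hb : ∀ i, b i ≤ a i + 1) :
    colEigenvalue b - colEigenvalue a = (q - 1) * ∑ c ∈ (b - a).support, (colVar a c)⁻¹ := by
  have hs : a.support ⊆ b.support := Finsupp.support_mono hab
  rw [colEigenvalue, colEigenvalue, Finsupp.sum_of_support_subset a hs _ (by simp), Finsupp.sum,
    ← mul_sub, ← Finset.sum_sub_distrib]
  congr 1
  symm
  refine Finset.sum_subset_zero_on_sdiff (fun c hc => ?_) (fun c hc => ?_) fun c hc => ?_
  · rw [mem_support_sub] at hc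
    rw [Finsupp.mem_support_iff]
    omega
  · rw [Finset.mem_sdiff, mem_support_sub] at hc
    have : b c = a c := le_antisymm (not_lt.1 hc.2) (hab c)
    rw [this, sub_self]
  · have h1 := mem_support_sub.1 hc
    have : b c = a c + 1 := le_antisymm (hb c) h1
    rw [this, Finset.sum_range_succ, add_sub_cancel_left, colVar, mul_inv, inv_inv, inv_pow,
      mul_comm]

theorem colEigenvalue_add_single (a : ℕ →₀ ℕ) (c : ℕ) :
    colEigenvalue (a + Finsupp.single c 1) - colEigenvalue a = (q - 1) * (colVar a c)⁻¹ := by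
  rw [colEigenvalue_sub le_self_add, add_tsub_cancel_left, Finsupp.support_single _ one_ne_zero,
    Finset.sum_singleton]
  intro i
  by_cases h : c = i <;> simp [h]

/-- The eigenvalues of Macdonald's operator are pairwise distinct. -/
theorem eigenvalue_injective : Function.Injective eigenvalue := by
  intro lam μ h
  rw [eigenvalue_eq_sum_cells, eigenvalue_eq_sum_cells] at h
  have h := mul_left_cancel₀ (sub_ne_zero.2 q_ne_one) h
  set N := lam.colLen 0 + μ.colLen 0 with hN
  have hlt : ∀ ν : YoungDiagram, ν.colLen 0 ≤ N → ∀ x ∈ ν.cells, x.1 < N := by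
    rintro ν hν ⟨i, j⟩ hx
    have := YoungDiagram.mem_iff_lt_colLen.1 (ν.up_left_mem le_rfl (Nat.zero_le j) hx)
    simp only
    omega
  -- multiplied by `t ^ N`, the sums are polynomials in which distinct boxes have distinct monomials
  let P : YoungDiagram → MvPolynomial (Fin 2) ℂ := fun ν =>
    ∑ x ∈ ν.cells, MvPolynomial.monomial (Finsupp.single 0 x.2 + Finsupp.single 1 (2 * (N - x.1))) 1
  have hP : ∀ ν : YoungDiagram, ν.colLen 0 ≤ N → algebraMap _ K (P ν) =
      t ^ N * ∑ x ∈ ν.cells, q ^ x.2 * t⁻¹ ^ x.1 := by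
    intro ν hν
    rw [map_sum, Finset.mul_sum]
    refine Finset.sum_congr rfl fun x hx => ?_
    have hx' := hlt ν hν x hx
    have e : (MvPolynomial.monomial (Finsupp.single 0 x.2 + Finsupp.single 1 (2 * (N - x.1)))
        (1 : ℂ) : MvPolynomial (Fin 2) ℂ) =
        MvPolynomial.X 0 ^ x.2 * MvPolynomial.X 1 ^ (2 * (N - x.1)) := by
      rw [MvPolynomial.X_pow_eq_monomial, MvPolynomial.X_pow_eq_monomial,
        MvPolynomial.monomial_mul, one_mul]
    rw [e, map_mul, map_pow, map_pow, ← q, ← v, pow_mul, ← t, pow_sub₀ _ t_ne_zero hx'.le, inv_pow]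
    ring
  have hPP : P lam = P μ := by
    refine IsFractionRing.injective (MvPolynomial (Fin 2) ℂ) K ?_
    rw [hP lam (by omega), hP μ (by omega), h]
  have hc : ∀ ν : YoungDiagram, ν.colLen 0 ≤ N → ∀ i j, i < N →
      (MvPolynomial.coeff (Finsupp.single 0 j + Finsupp.single 1 (2 * (N - i))) (P ν) =
        if (i, j) ∈ ν then 1 else 0) := by
    intro ν hν i j hi
    simp only [P, MvPolynomial.coeff_sum, MvPolynomial.coeff_monomial]
    have h0 := Finset.sum_ite_eq' ν.cells (i, j) fun _ => (1 : ℂ)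
    simp only [YoungDiagram.mem_cells] at h0
    rw [← h0]
    refine Finset.sum_congr rfl fun x hx => ?_
    have hx' := hlt ν hν x hx
    refine if_congr ⟨fun h => ?_, ?_⟩ rfl rfl
    · have h0 := DFunLike.congr_fun h 0
      have h1 := DFunLike.congr_fun h 1
      simp at h0 h1
      ext
      · simp only; omega
      · exact h0
    · rintro rfl
      rfl
  ext ⟨i, j⟩
  by_cases hi : i < N
  · have h1 := hc lam (by omega) i j hi
    have h2 := hc μ (by omega) i j hi
    rw [hPP, h2] at h1
    simp only [YoungDiagram.mem_cells]
    by_cases ha : (i, j) ∈ lam <;> by_cases hb : (i, j) ∈ μ <;> simp_all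
  · exact ⟨fun h => absurd (hlt lam (by omega) _ h) hi, fun h => absurd (hlt μ (by omega) _ h) hi⟩

/-- The coefficient of `P_μ(x) y ^ k` in `P_λ(x, y)`. -/
noncomputable def stripCoeff (k : ℕ) (μ lam : YoungDiagram) : K :=
  if lam.card = μ.card + k then colBranch (cols μ) (cols lam) else 0

/-- The set of partitions contained in `lam`. -/
noncomputable def below (lam : YoungDiagram) : Finset YoungDiagram := (finite_Iic lam).toFinset

@[simp]
theorem mem_below {μ lam : YoungDiagram} : μ ∈ below lam ↔ μ ≤ lam := by simp [below]

theorem colBranch_ne_zero {μ lam : YoungDiagram} (h : colBranch (cols μ) (cols lam) ≠ 0) :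
    μ ≤ lam ∧ ∀ i, lam.colLen i ≤ μ.colLen i + 1 := by
  by_contra h'
  refine h (if_neg fun h'' => h' ?_)
  exact ⟨cols_le_iff.1 h''.1, h''.2⟩

theorem stripCoeff_ne_zero {k : ℕ} {μ lam : YoungDiagram} (h : stripCoeff k μ lam ≠ 0) :
    lam.card = μ.card + k ∧ μ ≤ lam ∧ ∀ i, lam.colLen i ≤ μ.colLen i + 1 := by
  unfold stripCoeff at h
  split_ifs at h with h1
  · exact ⟨h1, colBranch_ne_zero h⟩
  · exact absurd rfl h

theorem stripCoeff_zero_self (μ : YoungDiagram) : stripCoeff 0 μ μ = 1 := by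
  rw [stripCoeff, if_pos (by simp), colBranch_of_le le_rfl (by simp), tsub_self]
  simp [branch]

theorem stripCoeff_zero_of_ne {μ lam : YoungDiagram} (h : μ ≠ lam) : stripCoeff 0 μ lam = 0 := by
  by_contra h0
  obtain ⟨h1, h2, _⟩ := stripCoeff_ne_zero h0
  exact h (eq_of_le_of_card_le h2 (by omega))

theorem exists_eq_add_single {μ lam : YoungDiagram} (h : μ ≤ lam) (h' : lam.card = μ.card + 1) :
    ∃ c, cols lam = cols μ + Finsupp.single c 1 := by
  have hab := cols_le_iff.2 h
  rw [card_eq_degree, card_eq_degree] at h'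
  obtain ⟨d, hd⟩ := exists_add_of_le hab
  rw [hd, map_add] at h'
  have h1 : d.degree = 1 := by omega
  obtain ⟨c, hc⟩ : ∃ c, d c ≠ 0 := by
    by_contra! h0
    rw [show d = 0 from Finsupp.ext h0] at h1
    simp at h1
  obtain ⟨e, he⟩ := exists_add_of_le (Finsupp.single_le_iff.2 (Nat.one_le_iff_ne_zero.2 hc))
  rw [he, map_add, Finsupp.degree_single] at h1
  rw [(Finsupp.degree_eq_zero_iff e).1 (by omega), add_zero] at he
  exact ⟨c, by rw [hd, he]⟩

/-- Sums over the partitions between `μ` and `λ` of size `|λ| - 1` are sums over columns: the sequences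
of column lengths that are not partitions have a zero branching coefficient. -/
theorem sum_below_remove (f : YoungDiagram → K) (F : (ℕ →₀ ℕ) → K) (hF : ∀ ν, f ν = F (cols ν))
    {k : ℕ} {μ lam : YoungDiagram} (hcard : lam.card = μ.card + (k + 1)) :
    ∑ ν ∈ below lam, f ν * (stripCoeff 1 ν lam * stripCoeff k μ ν) =
      ∑ c ∈ (cols lam - cols μ).support, F (cols lam - Finsupp.single c 1) *
        (colBranch (cols lam - Finsupp.single c 1) (cols lam) *
          colBranch (cols μ) (cols lam - Finsupp.single c 1)) := by
  symm
  have hex : ∀ c, F (cols lam - Finsupp.single c 1) *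
        (colBranch (cols lam - Finsupp.single c 1) (cols lam) *
          colBranch (cols μ) (cols lam - Finsupp.single c 1)) ≠ 0 →
      ∃ ν, cols ν = cols lam - Finsupp.single c 1 := fun c hc =>
    exists_cols_eq (antitone_of_colBranch_ne_zero (cols_antitone μ)
      (right_ne_zero_of_mul (right_ne_zero_of_mul hc)))
  have hadd : ∀ c ∈ (cols lam - cols μ).support,
      (cols lam - Finsupp.single c 1) + Finsupp.single c 1 = cols lam := fun c hc => by
    have := mem_support_sub.1 hc
    exact tsub_add_cancel_of_le (Finsupp.single_le_iff.2 (by omega))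
  refine Finset.sum_bij_ne_zero (fun c _ h => (hex c h).choose) ?_ ?_ ?_ ?_
  · intro c hc h
    rw [mem_below, ← cols_le_iff, (hex c h).choose_spec]
    exact tsub_le_self
  · intro c hc h c' hc' h' he
    have h1 := (hex c h).choose_spec
    rw [he, (hex c' h').choose_spec] at h1
    have h2 := (hadd c' hc').trans (hadd c hc).symm
    rw [h1] at h2
    exact (Finsupp.single_left_injective one_ne_zero (add_left_cancel h2)).symm
  · intro ν hν h
    obtain ⟨h1, h2, _⟩ := stripCoeff_ne_zero (left_ne_zero_of_mul (right_ne_zero_of_mul h))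
    obtain ⟨h3, h4, _⟩ := stripCoeff_ne_zero (right_ne_zero_of_mul (right_ne_zero_of_mul h))
    obtain ⟨c, hc⟩ := exists_eq_add_single h2 h1
    have hν' : cols lam - Finsupp.single c 1 = cols ν := by rw [hc, add_tsub_cancel_right]
    have hmem : c ∈ (cols lam - cols μ).support := by
      rw [mem_support_sub, hc, Finsupp.add_apply, Finsupp.single_eq_same]
      exact Nat.lt_succ_of_le (cols_le_iff.2 h4 c)
    have hne : F (cols lam - Finsupp.single c 1) *
        (colBranch (cols lam - Finsupp.single c 1) (cols lam) *
          colBranch (cols μ) (cols lam - Finsupp.single c 1)) ≠ 0 := by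
      rw [hF, stripCoeff, if_pos h1, stripCoeff, if_pos h3] at h
      rwa [hν']
    exact ⟨c, hmem, hne, cols_injective ((hex c hne).choose_spec.trans hν')⟩
  · intro c hc h
    have hs := (hex c h).choose_spec
    have h1 : lam.card = (hex c h).choose.card + 1 := by
      rw [card_eq_degree, card_eq_degree, hs, ← hadd c hc, map_add, Finsupp.degree_single,
        add_tsub_cancel_right]
    rw [hF, hs, stripCoeff, if_pos h1, stripCoeff, if_pos (by omega), hs]

/-- Sums over the partitions between `μ` and `λ` of size `|μ| + 1` are sums over columns. -/
theorem sum_below_add (f : YoungDiagram → K) (F : (ℕ →₀ ℕ) → K) (hF : ∀ ν, f ν = F (cols ν))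
    {k : ℕ} {μ lam : YoungDiagram} (hcard : lam.card = μ.card + (k + 1)) :
    ∑ ν ∈ below lam, f ν * (stripCoeff k ν lam * stripCoeff 1 μ ν) =
      ∑ c ∈ (cols lam - cols μ).support, F (cols μ + Finsupp.single c 1) *
        (colBranch (cols μ + Finsupp.single c 1) (cols lam) *
          colBranch (cols μ) (cols μ + Finsupp.single c 1)) := by
  symm
  have hex : ∀ c, F (cols μ + Finsupp.single c 1) *
        (colBranch (cols μ + Finsupp.single c 1) (cols lam) *
          colBranch (cols μ) (cols μ + Finsupp.single c 1)) ≠ 0 →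
      ∃ ν, cols ν = cols μ + Finsupp.single c 1 := fun c hc =>
    exists_cols_eq (antitone_of_colBranch_ne_zero (cols_antitone μ)
      (right_ne_zero_of_mul (right_ne_zero_of_mul hc)))
  have hcd : ∀ c, ∀ ν, cols ν = cols μ + Finsupp.single c 1 → ν.card = μ.card + 1 := by
    intro c ν h
    rw [card_eq_degree, card_eq_degree, h, map_add, Finsupp.degree_single]
  refine Finset.sum_bij_ne_zero (fun c _ h => (hex c h).choose) ?_ ?_ ?_ ?_
  · intro c hc h
    have h1 := left_ne_zero_of_mul (right_ne_zero_of_mul h)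
    rw [← (hex c h).choose_spec] at h1
    exact mem_below.2 (colBranch_ne_zero h1).1
  · intro c hc h c' hc' h' he
    have h1 := (hex c h).choose_spec
    rw [he, (hex c' h').choose_spec] at h1
    exact (Finsupp.single_left_injective one_ne_zero (add_left_cancel h1)).symm
  · intro ν hν h
    obtain ⟨h1, h2, _⟩ := stripCoeff_ne_zero (left_ne_zero_of_mul (right_ne_zero_of_mul h))
    obtain ⟨h3, h4, _⟩ := stripCoeff_ne_zero (right_ne_zero_of_mul (right_ne_zero_of_mul h))
    obtain ⟨c, hc⟩ := exists_eq_add_single h4 h3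
    have hmem : c ∈ (cols lam - cols μ).support := by
      have := cols_le_iff.2 h2 c
      rw [hc, Finsupp.add_apply, Finsupp.single_eq_same] at this
      rw [mem_support_sub]
      omega
    have hne : F (cols μ + Finsupp.single c 1) *
        (colBranch (cols μ + Finsupp.single c 1) (cols lam) *
          colBranch (cols μ) (cols μ + Finsupp.single c 1)) ≠ 0 := by
      rw [hF, stripCoeff, if_pos h1, stripCoeff, if_pos h3] at h
      rwa [← hc]
    exact ⟨c, hmem, hne, cols_injective ((hex c hne).choose_spec.trans hc.symm)⟩
  · intro c hc h
    have hs := (hex c h).choose_spec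
    have h1 := hcd c _ hs
    rw [hF, hs, stripCoeff, if_pos (by omega), stripCoeff, if_pos h1, hs]

/-- Removing one box commutes with removing a horizontal strip. -/
theorem sum_stripCoeff_comm (k : ℕ) (μ lam : YoungDiagram) :
    ∑ ν ∈ below lam, stripCoeff 1 ν lam * stripCoeff k μ ν =
      ∑ ν ∈ below lam, stripCoeff k ν lam * stripCoeff 1 μ ν := by
  by_cases hle : μ ≤ lam ∧ lam.card = μ.card + (k + 1)
  · have h1 := sum_below_remove (fun _ => 1) (fun _ => 1) (fun _ => rfl) hle.2
    have h2 := sum_below_add (fun _ => 1) (fun _ => 1) (fun _ => rfl) hle.2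
    simp only [one_mul] at h1 h2
    rw [h1, h2, sum_colBranch_comm (cols_le_iff.2 hle.1)]
  · rw [Finset.sum_eq_zero, Finset.sum_eq_zero]
    · intro ν _
      by_contra h
      have h1 := stripCoeff_ne_zero (left_ne_zero_of_mul h)
      have h2 := stripCoeff_ne_zero (right_ne_zero_of_mul h)
      exact hle ⟨h2.2.1.trans h1.2.1, by omega⟩
    · intro ν _
      by_contra h
      have h1 := stripCoeff_ne_zero (left_ne_zero_of_mul h)
      have h2 := stripCoeff_ne_zero (right_ne_zero_of_mul h)
      exact hle ⟨h2.2.1.trans h1.2.1, by omega⟩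

/-- The recursion which determines the branching coefficients from those of single boxes. -/
theorem stripCoeff_recursion (k : ℕ) (μ lam : YoungDiagram) :
    (1 - t⁻¹) * ((eigenvalue lam - eigenvalue μ) * stripCoeff (k + 1) μ lam) =
      ∑ ν ∈ below lam, (eigenvalue lam - eigenvalue ν) * (stripCoeff 1 ν lam * stripCoeff k μ ν) -
      t⁻¹ * ∑ ν ∈ below lam, (eigenvalue ν - eigenvalue μ) *
        (stripCoeff k ν lam * stripCoeff 1 μ ν) := by
  by_cases hle : μ ≤ lam ∧ lam.card = μ.card + (k + 1)
  · rw [sum_below_remove _ (fun a => colEigenvalue (cols lam) - colEigenvalue a)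
        (fun ν => by rw [eigenvalue_eq_colEigenvalue, eigenvalue_eq_colEigenvalue]) hle.2,
      sum_below_add _ (fun a => colEigenvalue a - colEigenvalue (cols μ))
        (fun ν => by rw [eigenvalue_eq_colEigenvalue, eigenvalue_eq_colEigenvalue]) hle.2]
    have hab := cols_le_iff.2 hle.1
    have h := sum_inv_colVar_mul_colBranch hab
    have e1 : ∀ c ∈ (cols lam - cols μ).support,
        colEigenvalue (cols lam) - colEigenvalue (cols lam - Finsupp.single c 1) =
          (q - 1) * (colVar (cols lam - Finsupp.single c 1) c)⁻¹ := fun c hc => by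
      rw [← colEigenvalue_add_single, tsub_add_cancel_of_le]
      have := mem_support_sub.1 hc
      exact Finsupp.single_le_iff.2 (by omega)
    have e1' : ∀ c ∈ (cols lam - cols μ).support,
        (colEigenvalue (cols lam) - colEigenvalue (cols lam - Finsupp.single c 1)) *
          (colBranch (cols lam - Finsupp.single c 1) (cols lam) *
            colBranch (cols μ) (cols lam - Finsupp.single c 1)) =
        (q - 1) * ((colVar (cols lam - Finsupp.single c 1) c)⁻¹ *
          (colBranch (cols lam - Finsupp.single c 1) (cols lam) *
            colBranch (cols μ) (cols lam - Finsupp.single c 1))) := fun c hc => by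
      rw [e1 c hc, mul_assoc]
    rw [Finset.sum_congr rfl e1', ← Finset.mul_sum]
    simp only [colEigenvalue_add_single, mul_assoc]
    rw [← Finset.mul_sum]
    have e2 : (eigenvalue lam - eigenvalue μ) * stripCoeff (k + 1) μ lam =
        (q - 1) * ((∑ c ∈ (cols lam - cols μ).support, (colVar (cols μ) c)⁻¹) *
          colBranch (cols μ) (cols lam)) := by
      rw [stripCoeff, if_pos hle.2, eigenvalue_eq_colEigenvalue, eigenvalue_eq_colEigenvalue]
      by_cases hb : ∀ i, cols lam i ≤ cols μ i + 1
      · rw [colEigenvalue_sub hab hb, mul_assoc]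
      · rw [colBranch_of_not hb, mul_zero, mul_zero, mul_zero]
    rw [e2]
    linear_combination -(q - 1) * h
  · rw [Finset.sum_eq_zero, Finset.sum_eq_zero]
    · have : stripCoeff (k + 1) μ lam = 0 := by
        by_contra h
        have h1 := stripCoeff_ne_zero h
        exact hle ⟨h1.2.1, h1.1⟩
      simp [this]
    · intro ν _
      by_contra h
      have h1 := stripCoeff_ne_zero (left_ne_zero_of_mul (right_ne_zero_of_mul h))
      have h2 := stripCoeff_ne_zero (right_ne_zero_of_mul (right_ne_zero_of_mul h))
      exact hle ⟨h2.2.1.trans h1.2.1, by omega⟩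
    · intro ν _
      by_contra h
      have h1 := stripCoeff_ne_zero (left_ne_zero_of_mul (right_ne_zero_of_mul h))
      have h2 := stripCoeff_ne_zero (right_ne_zero_of_mul (right_ne_zero_of_mul h))
      exact hle ⟨h2.2.1.trans h1.2.1, by omega⟩

theorem isHorizontalStrip_iff {μ lam : YoungDiagram} :
    IsHorizontalStrip μ lam ↔ ∀ i, lam.colLen i ≤ μ.colLen i + 1 := by
  simp [IsHorizontalStrip, IsVerticalStrip]

/-- The explicit product `ψ_{λ/μ}` is the branching coefficient. -/
theorem psi_eq_colBranch {μ lam : YoungDiagram} (h : μ ≤ lam) (hs : IsHorizontalStrip μ lam) :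
    psi μ lam = colBranch (cols μ) (cols lam) := by
  have hab := cols_le_iff.2 h
  have hb := isHorizontalStrip_iff.1 hs
  rw [colBranch_of_le hab hb, branch, psi, Finset.prod_sigma']
  refine Finset.prod_bij' (fun p _ => ⟨p.2, p.1⟩) (fun p _ => (p.2, p.1)) ?_ ?_ ?_ ?_ ?_
  · rintro ⟨i, j⟩ hp
    simp only [Finset.mem_filter, Finset.mem_product, Finset.mem_range] at hp
    simp only [Finset.mem_sigma, mem_support_sub, Finset.mem_sdiff, Finset.mem_range, cols_apply]
    omega
  · rintro ⟨j, i⟩ hp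
    simp only [Finset.mem_sigma, mem_support_sub, Finset.mem_sdiff, Finset.mem_range,
      cols_apply] at hp
    have h1 := hb j
    have h2 := hb i
    have h3 := hab i
    have h4 : j < lam.rowLen 0 := by
      rw [← YoungDiagram.mem_iff_lt_rowLen, YoungDiagram.mem_iff_lt_colLen]
      omega
    simp only [cols_apply] at h3
    simp only [Finset.mem_filter, Finset.mem_product, Finset.mem_range]
    omega
  · rintro ⟨i, j⟩ _
    rfl
  · rintro ⟨j, i⟩ _
    rfl
  · rintro ⟨i, j⟩ hp
    simp only [Finset.mem_filter, Finset.mem_product, Finset.mem_range] at hp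
    obtain ⟨-, hij, hi, hj⟩ := hp
    have hvj := pow_ne_zero (μ.colLen j) t_ne_zero
    have hvi := pow_ne_zero (μ.colLen i) t_ne_zero
    have hqi := pow_ne_zero i q_ne_zero
    have hqj := pow_ne_zero j q_ne_zero
    have hv := v_ne_zero
    have hq := q_ne_zero
    have ht := t_ne_zero
    have e : ∀ m : ℤ, v ^ (2 * m) = t ^ m := fun m => by
      rw [t, zpow_mul]
      norm_cast
    simp only [factor, colVar, cols_apply, e, zpow_sub₀ t_ne_zero, zpow_sub₀ q_ne_zero,
      zpow_add₀ q_ne_zero, zpow_natCast, zpow_one]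
    have hpre : ∀ z : K, z ≠ 0 → t ^ μ.colLen j * z ≠ 0 := fun z hz => mul_ne_zero hvj hz
    set A := t ^ μ.colLen i
    set B := t ^ μ.colLen j
    set C := q ^ i
    set D := q ^ j
    have key : ∀ N₁ N₂ M₁ M₂ c : K, c ≠ 0 → (c * N₁ * (c * N₂)) / (c * M₁ * (c * M₂)) =
        N₁ * N₂ / (M₁ * M₂) := fun N₁ N₂ M₁ M₂ c hc => by
      rw [show c * N₁ * (c * N₂) = c * c * (N₁ * N₂) by ring,
        show c * M₁ * (c * M₂) = c * c * (M₁ * M₂) by ring, mul_div_mul_left _ _ (mul_ne_zero hc hc)]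
    rw [← key _ _ _ _ (-B * D⁻¹) (mul_ne_zero (neg_ne_zero.2 hvj) (inv_ne_zero hqj))]
    have ha1 : -B * D⁻¹ * (1 - A / B * (D / C / q)) = A * C⁻¹ / q - B * D⁻¹ := by
      field_simp; ring
    have ha2 : -B * D⁻¹ * (1 - A / B / t * (D / C * q)) = A * C⁻¹ * q / t - B * D⁻¹ := by
      field_simp; ring
    have ha3 : -B * D⁻¹ * (1 - A / B * (D / C)) = A * C⁻¹ - B * D⁻¹ := by
      field_simp; ring
    have ha4 : -B * D⁻¹ * (1 - A / B / t * (D / C)) = A * C⁻¹ / t - B * D⁻¹ := by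
      field_simp; ring
    rw [ha1, ha2, ha3, ha4,
      show (A * C⁻¹ - q * (B * D⁻¹)) * (A * C⁻¹ - t / q * (B * D⁻¹)) =
        t * ((A * C⁻¹ / q - B * D⁻¹) * (A * C⁻¹ * q / t - B * D⁻¹)) by field_simp,
      show (A * C⁻¹ - B * D⁻¹) * (A * C⁻¹ - t * (B * D⁻¹)) =
        t * ((A * C⁻¹ - B * D⁻¹) * (A * C⁻¹ / t - B * D⁻¹)) by field_simp,
      mul_div_mul_left _ _ ht]

/-! ### Commutation of the branching operators -/

section Ring

variable {𝕜 A : Type*} [Field 𝕜] [Ring A] [Algebra 𝕜 A]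

/-- If `[G (k + 1), E]` is expressed through `G k` and `F = [G 1, E]`, and `G 1` commutes with all
`G k`, then `[G j * G k, E]` is a symmetric expression in the products with smaller indices. -/
theorem commutator_recursion (s : 𝕜) (G : ℕ → A) (E : A) (hc : 1 - s ≠ 0)
    (h1 : ∀ k, G 1 * G k = G k * G 1)
    (hrec : ∀ k, (1 - s) • (G (k + 1) * E - E * G (k + 1)) =
      G k * (G 1 * E - E * G 1) - s • ((G 1 * E - E * G 1) * G k))
    (a b : ℕ) (hab : G a * G b = G b * G a) (hab' : G (a + 1) * G b = G b * G (a + 1))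
    (hab'' : G a * G (b + 1) = G (b + 1) * G a) :
    (G (a + 1) * G (b + 1) - G (b + 1) * G (a + 1)) * E =
      E * (G (a + 1) * G (b + 1) - G (b + 1) * G (a + 1)) := by
  obtain ⟨F, hF⟩ : ∃ F, F = G 1 * E - E * G 1 := ⟨_, rfl⟩
  obtain ⟨F₂, hF₂⟩ : ∃ F₂, F₂ = G 1 * F - F * G 1 := ⟨_, rfl⟩
  rw [← hF] at hrec
  have hrec₂ : ∀ k, (1 - s) • (G (k + 1) * F - F * G (k + 1)) = G k * F₂ - s • (F₂ * G k) := by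
    intro k
    have e1 : G (k + 1) * F - F * G (k + 1) =
        G 1 * (G (k + 1) * E - E * G (k + 1)) - (G (k + 1) * E - E * G (k + 1)) * G 1 := by
      rw [hF]
      have e2 : G (k + 1) * (G 1 * E) = G 1 * G (k + 1) * E := by rw [h1 (k + 1), mul_assoc]
      have e3 : E * G 1 * G (k + 1) = E * G (k + 1) * G 1 := by rw [mul_assoc, h1, mul_assoc]
      rw [mul_sub, sub_mul, mul_sub, sub_mul, e2, e3]
      noncomm_ring
    rw [e1, smul_sub, ← mul_smul_comm, ← smul_mul_assoc, hrec, hF₂]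
    have e4 : G 1 * (G k * F) = G k * (G 1 * F) := by rw [← mul_assoc, h1, mul_assoc]
    have e5 : F * G k * G 1 = F * G 1 * G k := by rw [mul_assoc, ← h1, mul_assoc]
    simp only [mul_sub, sub_mul, mul_smul_comm, smul_mul_assoc, smul_sub, e4, e5]
    rw [← mul_assoc (G 1) F (G k), mul_assoc (G k) F (G 1)]
    abel
  have key : ∀ m n : ℕ, ((1 - s) * (1 - s)) •
      (G (m + 1) * G (n + 1) * E - E * (G (m + 1) * G (n + 1))) =
      (1 - s) • ((G (m + 1) * G n + G m * G (n + 1)) * F -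
        s • (F * (G (m + 1) * G n + G m * G (n + 1)))) + (s * s) • (F₂ * (G m * G n)) -
        G m * G n * F₂ := by
    intro m n
    have k1 := congrArg (fun x => G (m + 1) * x) (hrec n)
    have k2 := congrArg (fun x => x * G (n + 1)) (hrec m)
    have k3 := congrArg (fun x => x * G n) (hrec₂ m)
    have k4 := congrArg (fun x => G m * x) (hrec₂ n)
    simp only [mul_sub, sub_mul, mul_add, add_mul, mul_smul_comm, smul_mul_assoc, mul_assoc]
      at k1 k2 k3 k4 ⊢
    linear_combination (norm := module) (1 - s) • k1 + (1 - s) • k2 - s • k3 - k4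
  have hsym : ((1 - s) * (1 - s)) •
      (G (a + 1) * G (b + 1) * E - E * (G (a + 1) * G (b + 1))) = ((1 - s) * (1 - s)) •
      (G (b + 1) * G (a + 1) * E - E * (G (b + 1) * G (a + 1))) := by
    rw [key, key, hab, hab', hab'', add_comm (G b * G (a + 1))]
  have h := smul_right_injective A (mul_ne_zero hc hc) hsym
  rw [sub_mul, mul_sub]
  linear_combination (norm := abel) h

end Ring

/-- The operator which removes a horizontal strip of size `k`, weighted by the branching
coefficients, on the vector space with basis the partitions. -/
noncomputable def removeStrip (k : ℕ) : Module.End K (YoungDiagram →₀ K) :=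
  Finsupp.linearCombination K fun lam =>
    ∑ ν ∈ below lam, Finsupp.single ν (stripCoeff k ν lam)

/-- The diagonal operator with the eigenvalues `α_λ`. -/
noncomputable def diagonal : Module.End K (YoungDiagram →₀ K) :=
  Finsupp.linearCombination K fun lam => Finsupp.single lam (eigenvalue lam)

theorem removeStrip_single (k : ℕ) (lam : YoungDiagram) :
    removeStrip k (Finsupp.single lam 1) =
      ∑ ν ∈ below lam, Finsupp.single ν (stripCoeff k ν lam) := by
  simp [removeStrip]

theorem removeStrip_single_apply (k : ℕ) (μ lam : YoungDiagram) :
    removeStrip k (Finsupp.single lam 1) μ = stripCoeff k μ lam := by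
  rw [removeStrip_single, Finsupp.finsetSum_apply]
  classical
  simp only [Finsupp.single_apply]
  rw [Finset.sum_ite_eq' (below lam) μ fun ν => stripCoeff k ν lam]
  split_ifs with h
  · rfl
  · by_contra h0
    exact h (mem_below.2 (stripCoeff_ne_zero (Ne.symm h0)).2.1)

theorem diagonal_single (lam : YoungDiagram) :
    diagonal (Finsupp.single lam 1) = eigenvalue lam • Finsupp.single lam 1 := by
  simp [diagonal]

theorem diagonal_apply (x : YoungDiagram →₀ K) (μ : YoungDiagram) :
    diagonal x μ = eigenvalue μ * x μ := by
  classical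
  induction x using Finsupp.induction_linear with
  | zero => simp
  | add x y hx hy => simp [hx, hy, mul_add]
  | single lam c =>
    simp only [diagonal, Finsupp.linearCombination_single, Finsupp.smul_single, smul_eq_mul,
      Finsupp.single_apply]
    split_ifs with h
    · rw [h, mul_comm]
    · simp

theorem apply_removeStrip_single (T : Module.End K (YoungDiagram →₀ K)) (k : ℕ)
    (μ lam : YoungDiagram) :
    T (removeStrip k (Finsupp.single lam 1)) μ =
      ∑ ν ∈ below lam, stripCoeff k ν lam * T (Finsupp.single ν 1) μ := by
  rw [removeStrip_single, map_sum, Finsupp.finsetSum_apply]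
  refine Finset.sum_congr rfl fun ν _ => ?_
  rw [← mul_one (stripCoeff k ν lam), ← smul_eq_mul, ← Finsupp.smul_single, map_smul,
    Finsupp.smul_apply, smul_eq_mul, smul_eq_mul, mul_one]

theorem end_ext {T T' : Module.End K (YoungDiagram →₀ K)}
    (h : ∀ μ lam, T (Finsupp.single lam 1) μ = T' (Finsupp.single lam 1) μ) : T = T' := by
  refine Finsupp.lhom_ext' fun lam => LinearMap.ext_ring (Finsupp.ext fun μ => ?_)
  exact h μ lam

theorem removeStrip_one_mul (k : ℕ) :
    removeStrip 1 * removeStrip k = removeStrip k * removeStrip 1 := by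
  refine end_ext fun μ lam => ?_
  rw [Module.End.mul_apply, Module.End.mul_apply, apply_removeStrip_single,
    apply_removeStrip_single]
  simp only [removeStrip_single_apply]
  exact (sum_stripCoeff_comm k μ lam).symm

theorem removeStrip_recursion (k : ℕ) :
    (1 - t⁻¹) • (removeStrip (k + 1) * diagonal - diagonal * removeStrip (k + 1)) =
      removeStrip k * (removeStrip 1 * diagonal - diagonal * removeStrip 1) -
        t⁻¹ • ((removeStrip 1 * diagonal - diagonal * removeStrip 1) * removeStrip k) := by
  refine end_ext fun μ lam => ?_
  have h1 : ∀ k μ lam, (removeStrip k * diagonal - diagonal * removeStrip k)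
      (Finsupp.single lam 1) μ = (eigenvalue lam - eigenvalue μ) * stripCoeff k μ lam := by
    intro k μ lam
    rw [LinearMap.sub_apply, Module.End.mul_apply, Module.End.mul_apply, diagonal_single, map_smul,
      Finsupp.sub_apply, diagonal_apply, Finsupp.smul_apply, removeStrip_single_apply, smul_eq_mul,
      sub_mul]
  have h2 : (removeStrip k * (removeStrip 1 * diagonal - diagonal * removeStrip 1))
      (Finsupp.single lam 1) μ = ∑ ν ∈ below lam, (eigenvalue lam - eigenvalue ν) *
        (stripCoeff 1 ν lam * stripCoeff k μ ν) := by
    rw [Module.End.mul_apply, show (removeStrip 1 * diagonal - diagonal * removeStrip 1)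
      (Finsupp.single lam 1) = ∑ ν ∈ below lam,
        ((eigenvalue lam - eigenvalue ν) * stripCoeff 1 ν lam) • Finsupp.single ν 1 from ?_]
    · simp only [map_sum, map_smul, Finsupp.finsetSum_apply, Finsupp.smul_apply,
        removeStrip_single_apply, smul_eq_mul, mul_assoc]
    · ext κ
      rw [h1, Finsupp.finsetSum_apply]
      classical
      simp only [Finsupp.smul_apply, Finsupp.single_apply, smul_eq_mul, mul_ite, mul_one, mul_zero]
      rw [Finset.sum_ite_eq' (below lam) κ fun ν =>
        (eigenvalue lam - eigenvalue ν) * stripCoeff 1 ν lam]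
      split_ifs with h
      · rfl
      · rw [show stripCoeff 1 κ lam = 0 by
          by_contra h0; exact h (mem_below.2 (stripCoeff_ne_zero h0).2.1), mul_zero]
  have h3 : ((removeStrip 1 * diagonal - diagonal * removeStrip 1) * removeStrip k)
      (Finsupp.single lam 1) μ = ∑ ν ∈ below lam, (eigenvalue ν - eigenvalue μ) *
        (stripCoeff k ν lam * stripCoeff 1 μ ν) := by
    rw [Module.End.mul_apply, apply_removeStrip_single]
    refine Finset.sum_congr rfl fun ν _ => ?_
    rw [h1]
    ring
  rw [LinearMap.smul_apply, Finsupp.smul_apply, h1, LinearMap.sub_apply, Finsupp.sub_apply, h2,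
    LinearMap.smul_apply, Finsupp.smul_apply, h3, smul_eq_mul, smul_eq_mul]
  exact stripCoeff_recursion k μ lam

theorem removeStrip_zero : removeStrip 0 = 1 := by
  refine end_ext fun μ lam => ?_
  rw [removeStrip_single_apply, Module.End.one_apply]
  by_cases h : μ = lam
  · rw [h, stripCoeff_zero_self, Finsupp.single_eq_same]
  · rw [stripCoeff_zero_of_ne h, Finsupp.single_eq_of_ne h]

theorem one_sub_inv_t_ne_zero : 1 - t⁻¹ ≠ 0 :=
  sub_ne_zero.2 fun h => t_ne_one (inv_eq_one.1 h.symm)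

/-- The branching operators commute: the coefficients of the commutator are killed by the
differences of the eigenvalues, which are distinct. -/
theorem removeStrip_comm (j k : ℕ) :
    removeStrip j * removeStrip k = removeStrip k * removeStrip j := by
  induction hn : j + k using Nat.strong_induction_on generalizing j k with
  | _ n ih =>
    rcases j with _ | a
    · rw [removeStrip_zero, one_mul, mul_one]
    rcases k with _ | b
    · rw [removeStrip_zero, one_mul, mul_one]
    have h := commutator_recursion t⁻¹ removeStrip diagonal one_sub_inv_t_ne_zero
      removeStrip_one_mul removeStrip_recursion a b (ih _ (by omega) a b rfl)
      (ih _ (by omega) (a + 1) b rfl) (ih _ (by omega) a (b + 1) rfl)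
    refine end_ext fun μ lam => ?_
    -- the entries of the commutator on the diagonal vanish because both products lower the size
    by_cases hμ : μ = lam
    · have hz : ∀ m n : ℕ, (removeStrip (m + 1) * removeStrip (n + 1))
          (Finsupp.single lam 1) μ = 0 := by
        intro m n
        rw [Module.End.mul_apply, apply_removeStrip_single]
        refine Finset.sum_eq_zero fun ν _ => ?_
        rw [removeStrip_single_apply]
        by_contra h0
        have h1 := stripCoeff_ne_zero (left_ne_zero_of_mul h0)
        have h2 := stripCoeff_ne_zero (right_ne_zero_of_mul h0)
        rw [hμ] at h2
        omega
      rw [hz, hz]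
    · have h' := DFunLike.congr_fun (LinearMap.congr_fun h (Finsupp.single lam 1)) μ
      rw [Module.End.mul_apply, Module.End.mul_apply, diagonal_apply, diagonal_single, map_smul,
        Finsupp.smul_apply, smul_eq_mul, ← sub_eq_zero, ← sub_mul] at h'
      rcases mul_eq_zero.1 h' with h'' | h''
      · exact absurd (eigenvalue_injective (sub_eq_zero.1 h'')).symm hμ
      · rw [LinearMap.sub_apply, Finsupp.sub_apply] at h''
        exact sub_eq_zero.1 h''

/-- Removing successively horizontal strips of sizes `j` and `k` may be done in either order. -/
theorem sum_stripCoeff_mul_comm (j k : ℕ) (μ lam : YoungDiagram) :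
    ∑ ν ∈ below lam, stripCoeff j ν lam * stripCoeff k μ ν =
      ∑ ν ∈ below lam, stripCoeff k ν lam * stripCoeff j μ ν := by
  have h := DFunLike.congr_fun (LinearMap.congr_fun (removeStrip_comm j k)
    (Finsupp.single lam 1)) μ
  simp only [Module.End.mul_apply, apply_removeStrip_single, removeStrip_single_apply] at h
  exact h.symm

/-! ### The power sums as free generators of the ring of symmetric functions -/

section FiniteVariables

open MvPolynomial

variable (n : ℕ)

theorem esymm_mem_adjoin_psum (k : ℕ) (hk : k ≤ n) :
    esymm (Fin n) K k ∈ Algebra.adjoin K (Set.range fun i : Fin n => psum (Fin n) K (i + 1)) := by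
  induction k using Nat.strong_induction_on with
  | _ k ih =>
    rcases Nat.eq_zero_or_pos k with rfl | hpos
    · rw [esymm_zero]
      exact one_mem _
    have h := mul_esymm_eq_sum (Fin n) K k
    have hk0 : (k : K) ≠ 0 := Nat.cast_ne_zero.2 hpos.ne'
    have h' : esymm (Fin n) K k = (k : K)⁻¹ • ((k : MvPolynomial (Fin n) K) *
        esymm (Fin n) K k) := by
      rw [← map_natCast (C : K →+* MvPolynomial (Fin n) K) k, ← smul_eq_C_mul, smul_smul,
        inv_mul_cancel₀ hk0, one_smul]
    rw [h', h]
    refine Subalgebra.smul_mem _ (mul_mem (pow_mem (neg_mem (one_mem _)) _)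
      (sum_mem fun a ha => ?_)) _
    rw [Finset.mem_filter, Finset.HasAntidiagonal.mem_antidiagonal] at ha
    refine mul_mem (mul_mem (pow_mem (neg_mem (one_mem _)) _) (ih _ ha.2 (by omega)))
      (Algebra.subset_adjoin ⟨⟨a.2 - 1, by omega⟩, ?_⟩)
    simp only
    congr 1
    omega

theorem mem_adjoin_psum_of_isSymmetric {p : MvPolynomial (Fin n) K} (hp : p.IsSymmetric) :
    p ∈ Algebra.adjoin K (Set.range fun i : Fin n => psum (Fin n) K (i + 1)) := by
  obtain ⟨r, hr⟩ := esymmAlgHom_surjective K (σ := Fin n) (n := n) (by simp) ⟨p, hp⟩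
  have h := esymmAlgHom_apply (σ := Fin n) (R := K) (n := n) r
  rw [hr] at h
  change p = _ at h
  rw [h]
  exact (Algebra.adjoin_le (by
    rintro _ ⟨i, rfl⟩
    exact esymm_mem_adjoin_psum n _ i.2)) ((aeval_range (R := K) (fun i : Fin n =>
      esymm (Fin n) K (i + 1))) ▸ AlgHom.mem_range_self _ r :
        _ ∈ Algebra.adjoin K (Set.range fun i : Fin n => esymm (Fin n) K (i + 1)))

/-- The first `n` power sums in `n` variables are algebraically independent: they generate the
ring of symmetric polynomials, which is a polynomial ring in `n` variables. -/
theorem algebraicIndependent_psum :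
    AlgebraicIndependent K fun i : Fin n => psum (Fin n) K (i + 1) := by
  let e := esymmAlgEquiv (Fin n) K (n := n) (by simp)
  let x : Fin n → MvPolynomial (Fin n) K := fun i =>
    e.symm ⟨psum (Fin n) K (i + 1), psum_isSymmetric _ _ _⟩
  let f : MvPolynomial (Fin n) K →ₐ[K] MvPolynomial (Fin n) K :=
    (symmetricSubalgebra (Fin n) K).val.comp e.toAlgHom
  have hf : Function.Injective f := Subtype.val_injective.comp e.injective
  have hfx : ∀ i, f (x i) = psum (Fin n) K (i + 1) := fun i => by
    change ((e (e.symm _) : symmetricSubalgebra (Fin n) K) : MvPolynomial (Fin n) K) = _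
    rw [e.apply_symm_apply]
  have htop : ∀ p, p ∈ Algebra.adjoin K (Set.range x) := by
    intro p
    have h1 : f p ∈ Algebra.adjoin K (Set.range fun i : Fin n => psum (Fin n) K (i + 1)) :=
      mem_adjoin_psum_of_isSymmetric n (e p).2
    have h2 : (Set.range fun i : Fin n => psum (Fin n) K (i + 1)) = f '' Set.range x := by
      rw [← Set.range_comp]
      exact congrArg Set.range (funext fun i => (hfx i).symm)
    rw [h2, ← AlgHom.map_adjoin] at h1
    obtain ⟨p', hp', hpp⟩ := h1
    exact hf hpp ▸ hp'
  have : Algebra.IsAlgebraic (Algebra.adjoin K (Set.range x)) (MvPolynomial (Fin n) K) :=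
    ⟨fun p => isAlgebraic_algebraMap (⟨p, htop p⟩ : Algebra.adjoin K (Set.range x))⟩
  have hx : AlgebraicIndependent K x :=
    (Algebra.IsAlgebraic.isTranscendenceBasis_of_le_trdeg_of_finite K x
      (by rw [MvPolynomial.trdeg_of_isDomain]; simp)).1
  have := hx.map' hf
  exact (funext hfx : f ∘ x = _) ▸ this

end FiniteVariables

/-- The restriction of symmetric functions to `m` variables, as a morphism of algebras. -/
noncomputable def restrictHom (m : ℕ) : SymFun →ₐ[K] MvPolynomial (Fin m) K :=
  (Pi.evalAlgHom K (fun m : ℕ => MvPolynomial (Fin m) K) m).comp symmetricFunctions.val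

theorem restrictHom_apply (m : ℕ) (f : SymFun) : restrictHom m f = restrict m f := rfl

theorem symFun_ext {f g : SymFun} (h : ∀ m, restrict m f = restrict m g) : f = g :=
  Subtype.ext (funext h)

@[simp]
theorem restrictHom_powerSum (m s : ℕ) :
    restrictHom m (powerSum s) = MvPolynomial.psum (Fin m) K (s + 1) := rfl

theorem theta_restrict (m : ℕ) (f : SymFun) : theta m (restrict (m + 1) f) = restrict m f :=
  f.2.2.1 m

theorem restrict_isSymmetric (m : ℕ) (f : SymFun) : (restrict m f).IsSymmetric := f.2.1 m

theorem theta_eq_killCompl (m : ℕ) :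
    theta m = MvPolynomial.killCompl (Fin.castSucc_injective m) := by
  refine MvPolynomial.algHom_ext fun i => ?_
  induction i using Fin.lastCases with
  | last =>
    rw [theta, MvPolynomial.aeval_X, Fin.lastCases_last, MvPolynomial.killCompl,
      MvPolynomial.aeval_X, dif_neg]
    rintro ⟨x, hx⟩
    exact Fin.castSucc_ne_last x hx
  | cast i =>
    rw [theta, MvPolynomial.aeval_X, Fin.lastCases_castSucc, ← MvPolynomial.rename_X,
      MvPolynomial.killCompl_rename_app]

theorem coeff_theta (m : ℕ) (p : MvPolynomial (Fin (m + 1)) K) (d : Fin m →₀ ℕ) :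
    (theta m p).coeff d = p.coeff (d.mapDomain Fin.castSucc) := by
  rw [theta_eq_killCompl, MvPolynomial.coeff_killCompl]

/-- A symmetric function of degree at most `d` which vanishes in `d` variables is zero. -/
theorem eq_zero_of_restrict_eq_zero {f : SymFun} {d : ℕ}
    (hd : ∀ m, (restrict m f).totalDegree ≤ d) (h : restrict d f = 0) : f = 0 := by
  have hle : ∀ k, k ≤ d → restrict (d - k) f = 0 := by
    intro k
    induction k with
    | zero => exact fun _ => h
    | succ k ih =>
      intro hk
      have h1 := ih (by omega)
      rw [show d - k = d - (k + 1) + 1 by omega] at h1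
      rw [← theta_restrict, h1, map_zero]
  have hge : ∀ k, restrict (d + k) f = 0 := by
    intro k
    induction k with
    | zero => exact h
    | succ k ih =>
      change restrict (d + k + 1) f = 0
      ext e
      rw [MvPolynomial.coeff_zero]
      by_contra hne
      have hdeg : (e.sum fun _ n => n) ≤ d :=
        (MvPolynomial.le_totalDegree (MvPolynomial.mem_support_iff.2 hne)).trans (hd _)
      obtain ⟨i, hi⟩ : ∃ i, e i = 0 := by
        by_contra! hall
        have h1 : ∑ i : Fin (d + k + 1), 1 ≤ ∑ i, e i :=
          Finset.sum_le_sum fun i _ => Nat.one_le_iff_ne_zero.2 (hall i)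
        rw [Finsupp.sum_fintype _ _ fun _ => rfl] at hdeg
        simp at h1
        omega
      set σ := Equiv.swap i (Fin.last (d + k))
      have h2 : (restrict (d + k + 1) f).coeff (e.mapDomain σ) ≠ 0 := by
        have h3 := restrict_isSymmetric (d + k + 1) f σ
        rw [← h3, MvPolynomial.coeff_rename_mapDomain _ σ.injective]
        exact hne
      have h4 : e.mapDomain σ (Fin.last _) = 0 := by
        rw [show Fin.last (d + k) = σ i by simp [σ], Finsupp.mapDomain_apply σ.injective, hi]
      have h5 : ((e.mapDomain σ).comapDomain Fin.castSucc
          (Fin.castSucc_injective _).injOn).mapDomain Fin.castSucc = e.mapDomain σ := by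
        refine Finsupp.mapDomain_comapDomain _ (Fin.castSucc_injective _) _ fun j hj => ?_
        refine Fin.exists_castSucc_eq.2 ?_
        rintro rfl
        exact (Finsupp.mem_support_iff.1 hj) h4
      rw [← h5, ← coeff_theta, theta_restrict, ih, MvPolynomial.coeff_zero] at h2
      exact h2 rfl
  refine symFun_ext fun m => ?_
  change restrict m f = 0
  rcases le_total m d with hm | hm
  · have := hle (d - m) (by omega)
    rwa [Nat.sub_sub_self hm] at this
  · have := hge (m - d)
    rwa [Nat.add_sub_cancel' hm] at this

/-- The morphism from the polynomial ring to symmetric functions given by the power sums. -/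
noncomputable def ofPowerSums : MvPolynomial ℕ K →ₐ[K] SymFun := MvPolynomial.aeval powerSum

theorem restrictHom_ofPowerSums (m : ℕ) (p : MvPolynomial ℕ K) :
    restrictHom m (ofPowerSums p) =
      MvPolynomial.aeval (fun s => MvPolynomial.psum (Fin m) K (s + 1)) p := by
  rw [ofPowerSums, ← AlgHom.comp_apply, MvPolynomial.comp_aeval]
  rfl

theorem ofPowerSums_injective : Function.Injective ofPowerSums := by
  rw [injective_iff_map_eq_zero]
  intro p hp
  obtain ⟨n, hn⟩ : ∃ n, p.vars ⊆ Finset.range n := p.vars.exists_nat_subset_range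
  obtain ⟨r, rfl⟩ := MvPolynomial.exists_rename_eq_of_vars_subset_range p
    (fun i : Fin n => (i : ℕ)) Fin.val_injective fun i hi =>
      ⟨⟨i, Finset.mem_range.1 (hn hi)⟩, rfl⟩
  have h := restrictHom_ofPowerSums n (MvPolynomial.rename (fun i : Fin n => (i : ℕ)) r)
  rw [hp, map_zero, MvPolynomial.aeval_rename] at h
  have hr : r = 0 := (injective_iff_map_eq_zero _).1 (algebraicIndependent_psum n) r h.symm
  rw [hr, map_zero]

theorem homogeneousComponent_aeval_psum (m j : ℕ) (p : MvPolynomial ℕ K) :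
    MvPolynomial.homogeneousComponent j
      (MvPolynomial.aeval (fun s => MvPolynomial.psum (Fin m) K (s + 1)) p) =
    MvPolynomial.aeval (fun s => MvPolynomial.psum (Fin m) K (s + 1))
      (MvPolynomial.weightedHomogeneousComponent (fun s : ℕ => s + 1) j p) := by
  have hpsum : ∀ s, (MvPolynomial.psum (Fin m) K (s + 1)).IsHomogeneous (s + 1) := fun s =>
    MvPolynomial.IsHomogeneous.sum _ _ _ fun i _ => MvPolynomial.isHomogeneous_X_pow i _
  induction p using MvPolynomial.induction_on' with
  | monomial d c =>
    have h1 : (MvPolynomial.aeval (fun s => MvPolynomial.psum (Fin m) K (s + 1))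
        (MvPolynomial.monomial d c)).IsHomogeneous (Finsupp.weight (fun s : ℕ => s + 1) d) := by
      rw [MvPolynomial.aeval_monomial, Finsupp.weight_apply, MvPolynomial.algebraMap_eq]
      refine MvPolynomial.IsHomogeneous.C_mul ?_ c
      refine MvPolynomial.IsHomogeneous.prod _ _ _ fun i _ => ?_
      simp only [smul_eq_mul]
      rw [mul_comm]
      exact (hpsum i).pow _
    have h2 := MvPolynomial.isWeightedHomogeneous_monomial (fun s : ℕ => s + 1) d c rfl
    rw [MvPolynomial.homogeneousComponent_of_mem h1,
      MvPolynomial.weightedHomogeneousComponent_of_mem h2]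
    split_ifs <;> simp
  | add p r hp hr => simp only [map_add, hp, hr]

theorem ofPowerSums_surjective : Function.Surjective ofPowerSums := by
  intro f
  obtain ⟨d, hd⟩ := f.2.2.2
  have hd' : ∀ m, (restrict m f).totalDegree ≤ d := hd
  have h1 : restrict d f ∈ Algebra.adjoin K
      (Set.range fun s : ℕ => MvPolynomial.psum (Fin d) K (s + 1)) :=
    Algebra.adjoin_mono (by rintro _ ⟨i, rfl⟩; exact ⟨i, rfl⟩)
      (mem_adjoin_psum_of_isSymmetric d (restrict_isSymmetric d f))
  rw [← MvPolynomial.aeval_range] at h1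
  obtain ⟨p, hp⟩ := h1
  change MvPolynomial.aeval _ p = restrict d f at hp
  let p' := ∑ j ∈ Finset.range (d + 1),
    MvPolynomial.weightedHomogeneousComponent (fun s : ℕ => s + 1) j p
  have hp' : ∀ m, restrict m (ofPowerSums p') = ∑ j ∈ Finset.range (d + 1),
      MvPolynomial.homogeneousComponent j
        (MvPolynomial.aeval (fun s => MvPolynomial.psum (Fin m) K (s + 1)) p) := fun m => by
    rw [← restrictHom_apply, restrictHom_ofPowerSums, map_sum]
    exact Finset.sum_congr rfl fun j _ => (homogeneousComponent_aeval_psum m j p).symm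
  refine ⟨p', (sub_eq_zero.1 (eq_zero_of_restrict_eq_zero (d := d) (fun m => ?_) ?_)).symm⟩
  · change (restrict m f - restrict m (ofPowerSums p')).totalDegree ≤ d
    refine (MvPolynomial.totalDegree_sub _ _).trans (max_le (hd' m) ?_)
    rw [hp']
    refine MvPolynomial.totalDegree_finsetSum_le fun j hj => ?_
    exact (MvPolynomial.homogeneousComponent_isHomogeneous _ _).totalDegree_le.trans
      (Nat.lt_succ_iff.1 (Finset.mem_range.1 hj))
  · change restrict d f - restrict d (ofPowerSums p') = 0
    rw [hp', hp, sub_eq_zero]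
    conv_lhs => rw [← MvPolynomial.sum_homogeneousComponent (restrict d f)]
    refine Finset.sum_subset (by
      intro j hj
      have := hd' d
      rw [Finset.mem_range] at hj ⊢
      omega) fun j _ hj => ?_
    refine MvPolynomial.homogeneousComponent_eq_zero _ _ ?_
    rw [Finset.mem_range] at hj
    omega

/-- The ring of symmetric functions is the polynomial ring in the power sums. -/
noncomputable def powerSumEquiv : MvPolynomial ℕ K ≃ₐ[K] SymFun :=
  AlgEquiv.ofBijective ofPowerSums ⟨ofPowerSums_injective, ofPowerSums_surjective⟩

section Lift

variable {B : Type*} [CommSemiring B] [Algebra K B]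

/-- The morphism of algebras with prescribed values on the power sums. -/
noncomputable def symLift (y : ℕ → B) : SymFun →ₐ[K] B :=
  (MvPolynomial.aeval y).comp powerSumEquiv.symm.toAlgHom

@[simp]
theorem symLift_powerSum (y : ℕ → B) (s : ℕ) : symLift y (powerSum s) = y s := by
  have : powerSumEquiv.symm (powerSum s) = MvPolynomial.X s := by
    rw [AlgEquiv.symm_apply_eq]
    exact (MvPolynomial.aeval_X _ _).symm
  change MvPolynomial.aeval y (powerSumEquiv.symm (powerSum s)) = _
  rw [this, MvPolynomial.aeval_X]

theorem symFun_algHom_ext {φ ψ : SymFun →ₐ[K] B} (h : ∀ s, φ (powerSum s) = ψ (powerSum s)) :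
    φ = ψ := by
  have h1 : φ.comp ofPowerSums = ψ.comp ofPowerSums :=
    MvPolynomial.algHom_ext fun s => by
      simpa [ofPowerSums] using h s
  refine AlgHom.ext fun f => ?_
  obtain ⟨p, rfl⟩ := ofPowerSums_surjective f
  exact AlgHom.congr_fun h1 p

end Lift

theorem existsUnique_isCoproduct : ∃! D, IsCoproduct D := by
  refine ⟨symLift fun s => powerSum s ⊗ₜ[K] 1 + 1 ⊗ₜ[K] powerSum s, fun s => by simp, ?_⟩
  exact fun D hD => symFun_algHom_ext fun s => by rw [hD s, symLift_powerSum]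

theorem coproduct_powerSum (s : ℕ) :
    coproduct (powerSum s) = powerSum s ⊗ₜ[K] 1 + 1 ⊗ₜ[K] powerSum s :=
  Classical.epsilon_spec existsUnique_isCoproduct.exists s

/-! ### Adding one variable -/

section Bivariate

open Polynomial

theorem coeff_coeff_swap {R : Type*} [CommSemiring R] (p : R[X][X]) (i j : ℕ) :
    ((Bivariate.swap p).coeff i).coeff j = (p.coeff j).coeff i := by
  induction p using Polynomial.induction_on' with
  | add p r hp hr => simp [hp, hr]
  | monomial n f =>
    induction f using Polynomial.induction_on' with
    | add p r hp hr => simp only [map_add, coeff_add, hp, hr]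
    | monomial m a =>
      rw [Bivariate.swap_monomial_monomial]
      simp only [coeff_monomial]
      split_ifs <;> simp_all [coeff_monomial]

end Bivariate

open Polynomial in
/-- The exchange of the two variables, as a morphism of algebras over the ground field. -/
noncomputable def swapHom (R : Type*) [CommSemiring R] [Algebra K R] : R[X][X] →ₐ[K] R[X][X] :=
  AlgHom.restrictScalars K ((Bivariate.swap (R := R) : R[X][X] ≃ₐ[R] R[X][X]) : R[X][X] →ₐ[R] R[X][X])

open Polynomial in
theorem swapHom_apply {R : Type*} [CommSemiring R] [Algebra K R] (p : R[X][X]) :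
    swapHom R p = Bivariate.swap p := rfl

/-- The morphism `Λ → Λ[y]` with `p_r ↦ p_r + a_r y ^ r`. -/
noncomputable def shiftHom (a : ℕ → K) : SymFun →ₐ[K] Polynomial SymFun :=
  symLift fun s => Polynomial.C (powerSum s) + a s • Polynomial.X ^ (s + 1)

theorem shiftHom_powerSum (a : ℕ → K) (s : ℕ) :
    shiftHom a (powerSum s) = Polynomial.C (powerSum s) + a s • Polynomial.X ^ (s + 1) :=
  symLift_powerSum _ s

/-- The morphism `shiftHom b` on the coefficients of polynomials. -/
noncomputable def mapShift (b : ℕ → K) :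
    Polynomial SymFun →ₐ[K] Polynomial (Polynomial SymFun) :=
  Polynomial.mapAlgHom (shiftHom b)

theorem coeff_mapShift (b : ℕ → K) (p : Polynomial SymFun) (i : ℕ) :
    (mapShift b p).coeff i = shiftHom b (p.coeff i) := Polynomial.coeff_map _ _

theorem mapShift_shiftHom (a b : ℕ → K) (s : ℕ) :
    mapShift b (shiftHom a (powerSum s)) =
      Polynomial.C (Polynomial.C (powerSum s)) + b s • Polynomial.C (Polynomial.X ^ (s + 1)) +
        a s • Polynomial.X ^ (s + 1) := by
  rw [shiftHom_powerSum, map_add, map_smul, map_pow, mapShift, Polynomial.coe_mapAlgHom,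
    Polynomial.map_C, Polynomial.map_X]
  change Polynomial.C (shiftHom b (powerSum s)) + _ = _
  rw [shiftHom_powerSum, map_add, Polynomial.smul_C]

theorem coeff_shiftHom_comm (a b : ℕ → K) (i j : ℕ) (f : SymFun) :
    (shiftHom b ((shiftHom a f).coeff i)).coeff j =
      (shiftHom a ((shiftHom b f).coeff j)).coeff i := by
  have h : (mapShift b).comp (shiftHom a) =
      (swapHom SymFun).comp ((mapShift a).comp (shiftHom b)) := by
    refine symFun_algHom_ext (B := Polynomial (Polynomial SymFun)) fun s => ?_
    rw [AlgHom.comp_apply, AlgHom.comp_apply, AlgHom.comp_apply, mapShift_shiftHom,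
      mapShift_shiftHom, map_add, map_add, map_smul, map_smul, swapHom_apply, swapHom_apply,
      swapHom_apply,
      Polynomial.Bivariate.swap_C_C, Polynomial.C_pow,
      map_pow (Polynomial.Bivariate.swap (R := SymFun)), map_pow, Polynomial.Bivariate.swap_X,
      Polynomial.Bivariate.swap_Y]
    abel
  have h' := congrArg (fun p => (Polynomial.coeff p i).coeff j) (AlgHom.congr_fun h f)
  simp only [AlgHom.comp_apply, swapHom_apply] at h'
  rwa [coeff_coeff_swap, coeff_mapShift, coeff_mapShift] at h'

/-- The operator `f ↦ f(x₁, x₂, …, y)` of addition of a variable `y`. -/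
noncomputable def addVar : SymFun →ₐ[K] Polynomial SymFun := shiftHom fun _ => 1

/-- The coefficient of `y ^ k` in `f(x₁, x₂, …, y)`, as a linear operator. -/
noncomputable def extract (k : ℕ) : SymFun →ₗ[K] SymFun :=
  ((Polynomial.lcoeff SymFun k).restrictScalars K).comp addVar.toLinearMap

theorem coeff_addVar (k : ℕ) (f : SymFun) : (addVar f).coeff k = extract k f := rfl

theorem addVar_powerSum (s : ℕ) :
    addVar (powerSum s) = Polynomial.C (powerSum s) + Polynomial.X ^ (s + 1) := by
  rw [addVar, shiftHom_powerSum, one_smul]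

theorem extract_comm (i j : ℕ) (f : SymFun) :
    extract i (extract j f) = extract j (extract i f) :=
  coeff_shiftHom_comm _ _ j i f

theorem extract_zero (f : SymFun) : extract 0 f = f := by
  have h : ((Polynomial.aeval (0 : SymFun)).restrictScalars K).comp addVar = AlgHom.id K SymFun :=
    symFun_algHom_ext fun s => by simp [addVar_powerSum]
  have h' := AlgHom.congr_fun h f
  rw [← coeff_addVar, Polynomial.coeff_zero_eq_aeval_zero]
  exact h'

/-- The polynomials in `m + 1` variables, as polynomials in the last variable. -/
noncomputable def splitLast (m : ℕ) :
    MvPolynomial (Fin (m + 1)) K →ₐ[K] Polynomial (MvPolynomial (Fin m) K) :=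
  MvPolynomial.aeval (Fin.lastCases Polynomial.X fun i => Polynomial.C (MvPolynomial.X i))

theorem splitLast_X_last (m : ℕ) :
    splitLast m (MvPolynomial.X (Fin.last m)) = Polynomial.X := by
  rw [splitLast, MvPolynomial.aeval_X, Fin.lastCases_last]

theorem splitLast_X_castSucc (m : ℕ) (i : Fin m) :
    splitLast m (MvPolynomial.X i.castSucc) = Polynomial.C (MvPolynomial.X i) := by
  rw [splitLast, MvPolynomial.aeval_X, Fin.lastCases_castSucc]

theorem splitLast_rename (m : ℕ) (p : MvPolynomial (Fin m) K) :
    splitLast m (MvPolynomial.rename Fin.castSucc p) = Polynomial.C p := by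
  have h : (splitLast m).comp (MvPolynomial.rename Fin.castSucc) = Polynomial.CAlgHom := by
    refine MvPolynomial.algHom_ext fun i => ?_
    rw [AlgHom.comp_apply, MvPolynomial.rename_X, splitLast_X_castSucc]
    rfl
  exact AlgHom.congr_fun h p

theorem coeff_splitLast (m : ℕ) (p : MvPolynomial (Fin (m + 1)) K) (e : Fin (m + 1) →₀ ℕ) :
    ((splitLast m p).coeff (e (Fin.last m))).coeff
      (e.comapDomain Fin.castSucc (Fin.castSucc_injective m).injOn) = p.coeff e := by
  induction p using MvPolynomial.induction_on' with
  | add p r hp hr => simp only [map_add, Polynomial.coeff_add, MvPolynomial.coeff_add, hp, hr]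
  | monomial d c =>
    have h1 : splitLast m (MvPolynomial.monomial d c) =
        Polynomial.monomial (d (Fin.last m)) (MvPolynomial.monomial
          (d.comapDomain Fin.castSucc (Fin.castSucc_injective m).injOn) c) := by
      rw [splitLast, MvPolynomial.aeval_monomial,
        Finsupp.prod_fintype _ _ (by simp), Fin.prod_univ_castSucc]
      simp only [Fin.lastCases_castSucc, Fin.lastCases_last]
      rw [← Polynomial.C_mul_X_pow_eq_monomial, ← mul_assoc, MvPolynomial.monomial_eq,
        Finsupp.prod_fintype _ _ (by simp)]
      simp [Polynomial.C_mul, map_prod, IsScalarTower.algebraMap_apply K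
        (MvPolynomial (Fin m) K) (Polynomial (MvPolynomial (Fin m) K)),
        MvPolynomial.algebraMap_eq]
    rw [h1, Polynomial.coeff_monomial, MvPolynomial.coeff_monomial]
    by_cases hde : d = e
    · subst hde
      simp
    · rw [if_neg hde]
      split_ifs with h
      · rw [MvPolynomial.coeff_monomial, if_neg]
        intro h'
        refine hde (Finsupp.ext fun i => ?_)
        induction i using Fin.lastCases with
        | last => exact h
        | cast i => exact DFunLike.congr_fun h' i
      · simp

theorem splitLast_injective (m : ℕ) : Function.Injective (splitLast m) := fun p r h => by
  ext e
  rw [← coeff_splitLast, h, coeff_splitLast]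

theorem splitLast_restrict (m : ℕ) (f : SymFun) :
    splitLast m (restrict (m + 1) f) = (addVar f).map (restrictHom m).toRingHom := by
  have h : (splitLast m).comp (restrictHom (m + 1)) =
      (Polynomial.mapAlgHom (restrictHom m)).comp addVar := by
    refine symFun_algHom_ext fun s => ?_
    rw [AlgHom.comp_apply, AlgHom.comp_apply, restrictHom_powerSum, addVar_powerSum,
      MvPolynomial.psum, Fin.sum_univ_castSucc]
    simp only [map_add, map_sum, map_pow, splitLast_X_castSucc, splitLast_X_last]
    simp [MvPolynomial.psum]
  exact AlgHom.congr_fun h f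

theorem restrict_extract (m k : ℕ) (f : SymFun) :
    restrict m (extract k f) = (splitLast m (restrict (m + 1) f)).coeff k := by
  rw [splitLast_restrict, Polynomial.coeff_map]
  rfl

/-- The constant term of a symmetric function. -/
noncomputable def constTerm : SymFun →ₐ[K] K := symLift fun _ => 0

theorem constTerm_powerSum (s : ℕ) : constTerm (powerSum s) = 0 := symLift_powerSum _ s

theorem restrict_zero_eq (f : SymFun) : restrict 0 f = MvPolynomial.C (constTerm f) := by
  have h : restrictHom 0 = (Algebra.ofId K (MvPolynomial (Fin 0) K)).comp constTerm :=
    symFun_algHom_ext fun s => by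
      rw [AlgHom.comp_apply, constTerm_powerSum, map_zero, restrictHom_powerSum]
      simp [MvPolynomial.psum]
  exact AlgHom.congr_fun h f

/-- A function which does not change when a variable is added is constant. -/
theorem eq_zero_of_extract {f : SymFun} (h : ∀ k, extract (k + 1) f = 0) (h0 : constTerm f = 0) :
    f = 0 := by
  have hf : addVar f = Polynomial.C f := by
    ext1 k
    cases k with
    | zero => rw [coeff_addVar, extract_zero, Polynomial.coeff_C_zero]
    | succ k => rw [coeff_addVar, h, Polynomial.coeff_C_succ]
  refine symFun_ext fun m => ?_
  change restrict m f = 0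
  induction m with
  | zero => rw [restrict_zero_eq, h0, map_zero]
  | succ m ih =>
    refine splitLast_injective m ?_
    rw [splitLast_restrict, hf, Polynomial.map_C, map_zero]
    change Polynomial.C (restrict m f) = 0
    rw [ih, map_zero]

theorem ext_of_extract {f g : SymFun} (h : ∀ k, extract (k + 1) f = extract (k + 1) g)
    (h0 : constTerm f = constTerm g) : f = g :=
  sub_eq_zero.1 (eq_zero_of_extract (fun k => by rw [map_sub, h, sub_self])
    (by rw [map_sub, h0, sub_self]))

theorem constTerm_eq_zero {f : SymFun} {d : ℕ} (hf : IsHomogeneous f d) (hd : d ≠ 0) :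
    constTerm f = 0 := by
  by_contra h
  have h1 := hf 0
  rw [restrict_zero_eq] at h1
  have h2 := h1 (d := 0) (by rwa [MvPolynomial.coeff_zero_C])
  rw [map_zero] at h2
  exact hd h2.symm

theorem mapDomain_castSucc_last (m : ℕ) (e : Fin m →₀ ℕ) :
    e.mapDomain Fin.castSucc (Fin.last m) = 0 := by
  refine Finsupp.mapDomain_of_notMem_range _ _ ?_
  rintro ⟨i, hi⟩
  exact Fin.castSucc_ne_last i hi

theorem degree_of_coeff_ne_zero {σ : Type*} {p : MvPolynomial σ K} {d : ℕ}
    (hp : p.IsHomogeneous d) {e : σ →₀ ℕ} (he : p.coeff e ≠ 0) : e.degree = d := by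
  rw [Finsupp.degree_eq_weight_one]
  exact hp he

theorem coeff_restrict_extract (m k : ℕ) (f : SymFun) (e : Fin m →₀ ℕ) :
    (restrict m (extract k f)).coeff e = (restrict (m + 1) f).coeff
      (e.mapDomain Fin.castSucc + Finsupp.single (Fin.last m) k) := by
  have h := coeff_splitLast m (restrict (m + 1) f)
    (e.mapDomain Fin.castSucc + Finsupp.single (Fin.last m) k)
  rw [Finsupp.add_apply, mapDomain_castSucc_last, Finsupp.single_eq_same, zero_add, ← restrict_extract] at h
  rw [← h]
  congr 1
  ext i
  rw [Finsupp.comapDomain_apply, Finsupp.add_apply,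
    Finsupp.mapDomain_apply (Fin.castSucc_injective m),
    Finsupp.single_eq_of_ne (Fin.castSucc_ne_last i), add_zero]

theorem degree_mapDomain_add_single (m k : ℕ) (e : Fin m →₀ ℕ) :
    (e.mapDomain Fin.castSucc + Finsupp.single (Fin.last m) k).degree = e.degree + k := by
  rw [map_add, Finsupp.degree_single]
  congr 1
  simp only [Finsupp.degree_eq_sum, Fin.sum_univ_castSucc,
    Finsupp.mapDomain_apply (Fin.castSucc_injective m)]
  rw [mapDomain_castSucc_last, add_zero]

theorem isHomogeneous_extract {f : SymFun} {d : ℕ} (hf : IsHomogeneous f d) (k : ℕ) :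
    IsHomogeneous (extract k f) (d - k) := by
  intro m e he
  have hdeg : e.degree = Finsupp.weight 1 e := by rw [Finsupp.degree_eq_weight_one]; rfl
  rw [← hdeg]
  rw [coeff_restrict_extract] at he
  have := degree_of_coeff_ne_zero (hf (m + 1)) he
  rw [degree_mapDomain_add_single] at this
  omega

theorem extract_eq_zero {f : SymFun} {d k : ℕ} (hf : IsHomogeneous f d) (hk : d < k) :
    extract k f = 0 := by
  refine symFun_ext fun m => ?_
  ext e
  change _ = MvPolynomial.coeff e 0
  rw [coeff_restrict_extract, MvPolynomial.coeff_zero]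
  by_contra he
  have := degree_of_coeff_ne_zero (hf (m + 1)) he
  rw [degree_mapDomain_add_single] at this
  omega

/-! ### Symmetric functions from the branching coefficients -/

/-- The skew Macdonald polynomial `P_{λ/μ}(x₁, …, x_m)`, built one variable at a time. -/
noncomputable def skewPoly (μ : YoungDiagram) : (m : ℕ) → YoungDiagram → MvPolynomial (Fin m) K
  | 0, lam => MvPolynomial.C (stripCoeff 0 μ lam)
  | m + 1, lam => ∑ ν ∈ below lam, ∑ k ∈ Finset.range (lam.card + 1),
      MvPolynomial.C (stripCoeff k ν lam) * (MvPolynomial.X (Fin.last m) ^ k *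
        MvPolynomial.rename Fin.castSucc (skewPoly μ m ν))

theorem skewPoly_succ (μ : YoungDiagram) (m : ℕ) (lam : YoungDiagram) {B : Finset YoungDiagram}
    {N : ℕ} (hB : below lam ⊆ B) (hN : lam.card < N) :
    skewPoly μ (m + 1) lam = ∑ ν ∈ B, ∑ k ∈ Finset.range N,
      MvPolynomial.C (stripCoeff k ν lam) * (MvPolynomial.X (Fin.last m) ^ k *
        MvPolynomial.rename Fin.castSucc (skewPoly μ m ν)) := by
  have h0 : ∀ k ν, stripCoeff k ν lam ≠ 0 → ν ∈ below lam ∧ k ∈ Finset.range (lam.card + 1) := by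
    intro k ν h
    obtain ⟨h1, h2, _⟩ := stripCoeff_ne_zero h
    exact ⟨mem_below.2 h2, Finset.mem_range.2 (by omega)⟩
  rw [skewPoly]
  refine Eq.trans (Finset.sum_congr rfl fun ν _ => ?_) (Finset.sum_subset hB fun ν _ hν => ?_)
  · refine Finset.sum_subset (Finset.range_subset_range.2 hN) fun k _ hk => ?_
    rw [not_not.1 fun h => hk (h0 k ν h).2, map_zero, zero_mul]
  · refine Finset.sum_eq_zero fun k _ => ?_
    rw [not_not.1 fun h => hν (h0 k ν h).1, map_zero, zero_mul]

theorem skewPoly_succ_succ (μ : YoungDiagram) (m : ℕ) (lam : YoungDiagram) :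
    skewPoly μ (m + 2) lam = ∑ κ ∈ below lam, ∑ k ∈ Finset.range (lam.card + 1),
      ∑ l ∈ Finset.range (lam.card + 1),
        MvPolynomial.C (∑ ν ∈ below lam, stripCoeff k ν lam * stripCoeff l κ ν) *
          (MvPolynomial.X (Fin.last (m + 1)) ^ k * (MvPolynomial.X (Fin.last m).castSucc ^ l *
            MvPolynomial.rename Fin.castSucc (MvPolynomial.rename Fin.castSucc
              (skewPoly μ m κ)))) := by
  rw [skewPoly]
  have h1 : ∀ ν ∈ below lam, skewPoly μ (m + 1) ν = ∑ κ ∈ below lam,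
      ∑ l ∈ Finset.range (lam.card + 1),
        MvPolynomial.C (stripCoeff l κ ν) * (MvPolynomial.X (Fin.last m) ^ l *
          MvPolynomial.rename Fin.castSucc (skewPoly μ m κ)) := fun ν hν =>
    skewPoly_succ μ m ν (fun κ hκ => mem_below.2 ((mem_below.1 hκ).trans (mem_below.1 hν)))
      (Nat.lt_succ_of_le (card_mono (mem_below.1 hν)))
  simp only [map_sum, Finset.sum_mul, MvPolynomial.C_mul]
  have h2 : ∀ ν ∈ below lam, ∀ k ∈ Finset.range (lam.card + 1),
      MvPolynomial.C (stripCoeff k ν lam) * (MvPolynomial.X (Fin.last (m + 1)) ^ k *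
        MvPolynomial.rename Fin.castSucc (skewPoly μ (m + 1) ν)) =
      ∑ κ ∈ below lam, ∑ l ∈ Finset.range (lam.card + 1),
        MvPolynomial.C (stripCoeff k ν lam) * MvPolynomial.C (stripCoeff l κ ν) *
          (MvPolynomial.X (Fin.last (m + 1)) ^ k * (MvPolynomial.X (Fin.last m).castSucc ^ l *
            MvPolynomial.rename Fin.castSucc (MvPolynomial.rename Fin.castSucc
              (skewPoly μ m κ)))) := by
    intro ν hν k _
    rw [h1 ν hν]
    simp only [map_sum, map_mul, map_pow, MvPolynomial.rename_X, MvPolynomial.rename_C,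
      Finset.mul_sum]
    refine Finset.sum_congr rfl fun κ _ => Finset.sum_congr rfl fun l _ => ?_
    ring
  rw [Finset.sum_congr rfl fun ν hν => Finset.sum_congr rfl (h2 ν hν)]
  rw [Finset.sum_congr rfl fun ν _ => Finset.sum_comm, Finset.sum_comm]
  refine Finset.sum_congr rfl fun κ _ => ?_
  rw [Finset.sum_comm]
  refine Finset.sum_congr rfl fun k _ => ?_
  rw [Finset.sum_comm]

/-- Adjacent transpositions generate the symmetric group; those of earlier variables are treated by
induction, and the last one amounts to the commutation of the branching operators. -/
theorem skewPoly_isSymmetric (μ : YoungDiagram) (m : ℕ) (lam : YoungDiagram) :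
    (skewPoly μ m lam).IsSymmetric := by
  induction m generalizing lam with
  | zero =>
    intro e
    rw [Subsingleton.elim e 1, Equiv.Perm.coe_one, MvPolynomial.rename_id, AlgHom.id_apply]
  | succ m ih =>
    intro e
    have he : e ∈ Submonoid.closure
        (Set.range fun i : Fin m => Equiv.swap i.castSucc i.succ) := by
      rw [Equiv.Perm.mclosure_swap_castSucc_succ]
      trivial
    induction he using Submonoid.closure_induction with
    | one => rw [Equiv.Perm.coe_one, MvPolynomial.rename_id, AlgHom.id_apply]
    | mul x y _ _ hx hy =>
      rw [Equiv.Perm.coe_mul, ← MvPolynomial.rename_rename, hy, hx]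
    | mem x hx =>
      obtain ⟨i, rfl⟩ := hx
      cases m with
      | zero => exact i.elim0
      | succ m =>
        induction i using Fin.lastCases with
        | last =>
          have h1 : ∀ p : MvPolynomial (Fin m) K, MvPolynomial.rename
              (Equiv.swap (Fin.last m).castSucc (Fin.last m).succ)
              (MvPolynomial.rename Fin.castSucc (MvPolynomial.rename Fin.castSucc p)) =
              MvPolynomial.rename Fin.castSucc (MvPolynomial.rename Fin.castSucc p) := by
            intro p
            rw [MvPolynomial.rename_rename, MvPolynomial.rename_rename,
              MvPolynomial.rename_rename]
            refine congrArg (fun g => MvPolynomial.rename g p) (funext fun j => ?_)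
            refine Equiv.swap_apply_of_ne_of_ne (fun h => ?_) (fun h => ?_)
            · exact Fin.castSucc_ne_last j (Fin.castSucc_injective _ h)
            · exact Fin.castSucc_ne_last _ (h.trans (Fin.succ_last m))
          rw [skewPoly_succ_succ]
          simp only [map_sum, map_mul, map_pow, MvPolynomial.rename_X, h1]
          refine Finset.sum_congr rfl fun κ _ => ?_
          rw [Finset.sum_comm]
          refine Finset.sum_congr rfl fun k _ => Finset.sum_congr rfl fun l _ => ?_
          rw [← Fin.succ_last, Equiv.swap_apply_left, Equiv.swap_apply_right]
          simp only [← map_mul, ← map_sum, MvPolynomial.rename_C]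
          rw [sum_stripCoeff_mul_comm]
          ring
        | cast i =>
          rw [skewPoly]
          simp only [map_sum, map_mul, map_pow, MvPolynomial.rename_X, MvPolynomial.rename_C]
          refine Finset.sum_congr rfl fun ν _ => Finset.sum_congr rfl fun k _ => ?_
          rw [Equiv.swap_apply_of_ne_of_ne (Fin.castSucc_ne_last _).symm
            (by rw [Fin.succ_castSucc]; exact (Fin.castSucc_ne_last _).symm)]
          congr 2
          conv_rhs => rw [← ih ν (Equiv.swap i.castSucc i.succ)]
          rw [MvPolynomial.rename_rename, MvPolynomial.rename_rename, Fin.succ_castSucc]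
          refine congrArg (fun g => MvPolynomial.rename g (skewPoly μ (m + 1) ν)) (funext fun j => ?_)
          exact (Function.Injective.map_swap (Fin.castSucc_injective _) _ _ _).symm

theorem theta_skewPoly (μ : YoungDiagram) (m : ℕ) (lam : YoungDiagram) :
    theta m (skewPoly μ (m + 1) lam) = skewPoly μ m lam := by
  have h1 : ∀ p, theta m (MvPolynomial.rename Fin.castSucc p) = p := fun p => by
    rw [theta_eq_killCompl, MvPolynomial.killCompl_rename_app]
  have h2 : theta m (MvPolynomial.X (Fin.last m)) = 0 := by simp [theta]
  rw [skewPoly]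
  simp only [map_sum, map_mul, map_pow, h1, h2]
  rw [Finset.sum_eq_single lam, Finset.sum_eq_single 0]
  · simp [stripCoeff_zero_self, theta]
  · intro k _ hk
    simp [hk]
  · simp
  · intro ν _ hν
    refine Finset.sum_eq_zero fun k _ => ?_
    rcases eq_or_ne k 0 with rfl | hk
    · rw [stripCoeff_zero_of_ne hν]
      simp
    · simp [hk]
  · simp

theorem skewPoly_aux (μ : YoungDiagram) (m : ℕ) (lam : YoungDiagram) :
    (skewPoly μ m lam).IsHomogeneous (lam.card - μ.card) ∧
      (skewPoly μ m lam ≠ 0 → μ ≤ lam) := by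
  induction m generalizing lam with
  | zero =>
    rw [skewPoly]
    rcases eq_or_ne (stripCoeff 0 μ lam) 0 with h | h
    · simp [h, MvPolynomial.isHomogeneous_zero]
    · obtain ⟨h1, h2, _⟩ := stripCoeff_ne_zero h
      rw [show lam.card - μ.card = 0 by omega]
      exact ⟨MvPolynomial.isHomogeneous_C _ _, fun _ => h2⟩
  | succ m ih =>
    have key : ∀ ν ∈ below lam, ∀ k, MvPolynomial.C (stripCoeff k ν lam) *
        (MvPolynomial.X (Fin.last m) ^ k *
          MvPolynomial.rename Fin.castSucc (skewPoly μ m ν)) ≠ 0 →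
        μ ≤ lam ∧ k + (ν.card - μ.card) = lam.card - μ.card := by
      intro ν _ k h
      obtain ⟨h1, h2, _⟩ := stripCoeff_ne_zero (k := k) (μ := ν) (lam := lam)
        (fun h0 => h (by rw [h0, map_zero, zero_mul]))
      have h3 := (ih ν).2 fun h0 => h (by rw [h0]; simp)
      have := card_mono h3
      exact ⟨h3.trans h2, by omega⟩
    constructor
    · rw [skewPoly]
      refine MvPolynomial.IsHomogeneous.sum _ _ _ fun ν hν =>
        MvPolynomial.IsHomogeneous.sum _ _ _ fun k _ => ?_
      by_cases h : MvPolynomial.C (stripCoeff k ν lam) * (MvPolynomial.X (Fin.last m) ^ k *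
          MvPolynomial.rename Fin.castSucc (skewPoly μ m ν)) = 0
      · rw [h]
        exact MvPolynomial.isHomogeneous_zero _ _ _
      · rw [← (key ν hν k h).2]
        exact ((MvPolynomial.isHomogeneous_X_pow _ k).mul (ih ν).1.rename_isHomogeneous).C_mul _
    · intro h
      rw [skewPoly] at h
      obtain ⟨ν, hν, h⟩ := Finset.exists_ne_zero_of_sum_ne_zero h
      obtain ⟨k, _, h⟩ := Finset.exists_ne_zero_of_sum_ne_zero h
      exact (key ν hν k h).1

/-- The skew Macdonald polynomial `P_{λ/μ}`, built from the branching coefficients. It is zero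
unless `μ ⊂ λ`. -/
noncomputable def skewSym (μ lam : YoungDiagram) : SymFun :=
  ⟨fun m => skewPoly μ m lam, fun m => skewPoly_isSymmetric μ m lam,
    fun m => theta_skewPoly μ m lam, _, fun m => (skewPoly_aux μ m lam).1.totalDegree_le⟩

theorem isHomogeneous_skewSym (μ lam : YoungDiagram) :
    IsHomogeneous (skewSym μ lam) (lam.card - μ.card) := fun m => (skewPoly_aux μ m lam).1

theorem skewSym_eq_zero {μ lam : YoungDiagram} (h : ¬ μ ≤ lam) : skewSym μ lam = 0 :=
  symFun_ext fun m => not_not.1 fun h0 => h ((skewPoly_aux μ m lam).2 h0)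

theorem constTerm_skewSym (μ lam : YoungDiagram) :
    constTerm (skewSym μ lam) = stripCoeff 0 μ lam := by
  have h : skewPoly μ 0 lam = MvPolynomial.C (constTerm (skewSym μ lam)) :=
    restrict_zero_eq (skewSym μ lam)
  rw [skewPoly] at h
  exact (MvPolynomial.C_injective _ _ h).symm

theorem extract_skewSym (k : ℕ) (μ lam : YoungDiagram) :
    extract k (skewSym μ lam) = ∑ ν ∈ below lam, stripCoeff k ν lam • skewSym μ ν := by
  refine symFun_ext fun m => ?_
  have h1 : restrict m (∑ ν ∈ below lam, stripCoeff k ν lam • skewSym μ ν) =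
      ∑ ν ∈ below lam, stripCoeff k ν lam • skewPoly μ m ν := by
    rw [← restrictHom_apply, map_sum]
    exact Finset.sum_congr rfl fun ν _ => map_smul _ _ _
  rw [h1, restrict_extract]
  change (splitLast m (skewPoly μ (m + 1) lam)).coeff k = _
  rw [skewPoly_succ μ m lam (N := lam.card + k + 1) subset_rfl (by omega)]
  have h2 : ∀ c : K, splitLast m (MvPolynomial.C c) = Polynomial.C (MvPolynomial.C c) := fun c =>
    (splitLast m).commutes c
  simp only [map_sum, map_mul, map_pow, splitLast_X_last, splitLast_rename, h2,
    Polynomial.finsetSum_coeff, Polynomial.coeff_C_mul, Polynomial.coeff_mul_C,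
    Polynomial.coeff_X_pow]
  refine Finset.sum_congr rfl fun ν _ => ?_
  rw [Finset.sum_eq_single k]
  · rw [if_pos rfl, one_mul, MvPolynomial.smul_eq_C_mul]
  · intro l _ hl
    rw [if_neg hl.symm]
    simp
  · intro h
    exact absurd (Finset.mem_range.2 (by omega)) h

/-! ### The functions `g_r` -/

section GeneratingSeries

variable {A B : Type*} [CommSemiring A] [Algebra K A] [CommSemiring B] [Algebra K B]

/-- The series `(1 - t⁻¹ x u) / (1 - x u)` in the variable `u`. -/
noncomputable def gFactor (x : A) : PowerSeries A :=
  PowerSeries.mk fun n => if n = 0 then 1 else (1 - t⁻¹) • x ^ n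

theorem coeff_zero_gFactor (x : A) : PowerSeries.coeff 0 (gFactor x) = 1 := by
  simp [gFactor]

theorem coeff_succ_gFactor (x : A) (n : ℕ) :
    PowerSeries.coeff (n + 1) (gFactor x) = (1 - t⁻¹) • x ^ (n + 1) := by
  rw [gFactor, PowerSeries.coeff_mk, if_neg (Nat.succ_ne_zero n)]

/-- The equation `(1 - x u) * gFactor x = 1 - t⁻¹ x u`, without subtraction. -/
theorem gFactor_add (x : A) :
    gFactor x + PowerSeries.C (t⁻¹ • x) * PowerSeries.X =
      1 + PowerSeries.C x * (PowerSeries.X * gFactor x) := by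
  ext n
  rw [map_add, map_add, PowerSeries.coeff_C_mul, PowerSeries.coeff_C_mul]
  cases n with
  | zero => simp [coeff_zero_gFactor]
  | succ n =>
    rw [coeff_succ_gFactor, PowerSeries.coeff_succ_X_mul, PowerSeries.coeff_one,
      if_neg (Nat.succ_ne_zero n), zero_add, PowerSeries.coeff_X]
    cases n with
    | zero =>
      rw [coeff_zero_gFactor, zero_add, if_pos rfl, mul_one, mul_one, pow_one, ← add_smul,
        sub_add_cancel, one_smul]
    | succ n =>
      rw [coeff_succ_gFactor, if_neg (by omega), mul_zero, add_zero, pow_succ', mul_smul_comm]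

theorem map_gFactor (φ : A →ₐ[K] B) (x : A) :
    PowerSeries.map (φ : A →+* B) (gFactor x) = gFactor (φ x) := by
  ext n
  rw [PowerSeries.coeff_map]
  cases n with
  | zero => rw [coeff_zero_gFactor, coeff_zero_gFactor, map_one]
  | succ n =>
    rw [coeff_succ_gFactor, coeff_succ_gFactor, ← map_pow, ← map_smul]
    rfl

theorem gFactor_zero : gFactor (0 : A) = 1 := by
  ext n
  cases n with
  | zero => rw [coeff_zero_gFactor]; simp
  | succ n => rw [coeff_succ_gFactor, PowerSeries.coeff_one]; simp

end GeneratingSeries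

/-- The generating series `∏_j (1 - t⁻¹ x_j u) / (1 - x_j u)` of the functions `g_r` in `m`
variables. -/
noncomputable def gSeries (m : ℕ) : PowerSeries (MvPolynomial (Fin m) K) :=
  ∏ j, gFactor (MvPolynomial.X j)

theorem map_gSeries {m : ℕ} {B : Type*} [CommSemiring B] [Algebra K B]
    (φ : MvPolynomial (Fin m) K →ₐ[K] B) :
    PowerSeries.map (φ : MvPolynomial (Fin m) K →+* B) (gSeries m) =
      ∏ j, gFactor (φ (MvPolynomial.X j)) := by
  rw [gSeries, map_prod]
  exact Finset.prod_congr rfl fun j _ => map_gFactor φ _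

theorem isHomogeneous_coeff_gSeries (m r : ℕ) :
    (PowerSeries.coeff r (gSeries m)).IsHomogeneous r := by
  have h : ∀ (S : Finset (Fin m)) (r : ℕ), (PowerSeries.coeff r
      (∏ j ∈ S, gFactor (MvPolynomial.X j : MvPolynomial (Fin m) K))).IsHomogeneous r := by
    classical
    intro S
    induction S using Finset.induction_on with
    | empty =>
      intro r
      rw [Finset.prod_empty, PowerSeries.coeff_one]
      split_ifs with h
      · rw [h]
        exact MvPolynomial.isHomogeneous_one _ _
      · exact MvPolynomial.isHomogeneous_zero _ _ _
    | insert a S ha ih =>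
      intro r
      rw [Finset.prod_insert ha, PowerSeries.coeff_mul]
      refine MvPolynomial.IsHomogeneous.sum _ _ _ fun p hp => ?_
      rw [← Finset.HasAntidiagonal.mem_antidiagonal.1 hp]
      refine MvPolynomial.IsHomogeneous.mul ?_ (ih _)
      cases p.1 with
      | zero =>
        rw [coeff_zero_gFactor]
        exact MvPolynomial.isHomogeneous_one _ _
      | succ n =>
        rw [coeff_succ_gFactor, MvPolynomial.smul_eq_C_mul]
        exact (MvPolynomial.isHomogeneous_X_pow _ _).C_mul _
  exact h _ r

/-- The symmetric function `g_r`, the coefficient of `u ^ r` in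
`∏_j (1 - t⁻¹ x_j u) / (1 - x_j u)`. -/
noncomputable def gSym (r : ℕ) : SymFun :=
  ⟨fun m => PowerSeries.coeff r (gSeries m), fun m e => by
      have h := congrArg (PowerSeries.coeff r) (map_gSeries (MvPolynomial.rename e))
      simp only [MvPolynomial.rename_X] at h
      rw [Equiv.prod_comp e (fun j => gFactor (MvPolynomial.X j : MvPolynomial (Fin m) K)),
        PowerSeries.coeff_map] at h
      exact h,
    fun m => by
      have h := congrArg (PowerSeries.coeff r) (map_gSeries (theta m))
      rw [PowerSeries.coeff_map, Fin.prod_univ_castSucc] at h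
      have h1 : theta m (MvPolynomial.X (Fin.last m)) = 0 := by simp [theta]
      have h2 : ∀ j : Fin m, theta m (MvPolynomial.X j.castSucc) = MvPolynomial.X j := fun j => by
        simp [theta]
      simp only [h1, h2, gFactor_zero, mul_one] at h
      exact h,
    r, fun m => (isHomogeneous_coeff_gSeries m r).totalDegree_le⟩

theorem isHomogeneous_gSym (r : ℕ) : IsHomogeneous (gSym r) r :=
  fun m => isHomogeneous_coeff_gSeries m r

theorem polynomial_ext_of_restrict {p r : Polynomial SymFun}
    (h : ∀ m, p.map (restrictHom m).toRingHom = r.map (restrictHom m).toRingHom) : p = r := by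
  ext1 k
  refine symFun_ext fun m => ?_
  have := congrArg (fun p => Polynomial.coeff p k) (h m)
  rwa [Polynomial.coeff_map, Polynomial.coeff_map] at this

theorem map_addVar_gSym (m r : ℕ) : (addVar (gSym r)).map (restrictHom m).toRingHom =
    PowerSeries.coeff r (PowerSeries.map (Polynomial.C) (gSeries m) * gFactor Polynomial.X) := by
  rw [← splitLast_restrict]
  have h := congrArg (PowerSeries.coeff r) (map_gSeries (splitLast m))
  rw [PowerSeries.coeff_map, Fin.prod_univ_castSucc] at h
  simp only [splitLast_X_castSucc, splitLast_X_last] at h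
  have h2 := map_gSeries (Polynomial.CAlgHom : MvPolynomial (Fin m) K →ₐ[K] _)
  exact h.trans (congrArg (fun x => PowerSeries.coeff r (x * _)) h2.symm)

theorem gSym_zero : gSym 0 = 1 := by
  refine symFun_ext fun m => ?_
  change PowerSeries.coeff 0 (gSeries m) = 1
  rw [gSeries, PowerSeries.coeff_zero_eq_constantCoeff, map_prod]
  refine Finset.prod_eq_one fun j _ => ?_
  rw [← PowerSeries.coeff_zero_eq_constantCoeff, coeff_zero_gFactor]

theorem addVar_gSym_succ (r : ℕ) :
    addVar (gSym (r + 1)) + t⁻¹ • (Polynomial.X * Polynomial.C (gSym r)) =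
      Polynomial.C (gSym (r + 1)) + Polynomial.X * addVar (gSym r) := by
  refine polynomial_ext_of_restrict fun m => ?_
  have h := congrArg (fun x => PowerSeries.coeff (r + 1)
    (PowerSeries.map (Polynomial.C) (gSeries m) * x))
    (gFactor_add (Polynomial.X : Polynomial (MvPolynomial (Fin m) K)))
  simp only [mul_add, mul_one, map_add] at h
  rw [← map_addVar_gSym, mul_left_comm, PowerSeries.coeff_C_mul,
    mul_comm _ PowerSeries.X, PowerSeries.coeff_succ_X_mul, mul_left_comm,
    PowerSeries.coeff_C_mul, mul_left_comm, PowerSeries.coeff_succ_X_mul, ← map_addVar_gSym,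
    PowerSeries.coeff_map, PowerSeries.coeff_map] at h
  have hs : (t⁻¹ • (Polynomial.X * Polynomial.C (gSym r))).map (restrictHom m).toRingHom =
      (t⁻¹ • Polynomial.X) * Polynomial.C (restrict m (gSym r)) := by
    ext1 k
    rw [Polynomial.coeff_map, smul_mul_assoc, Polynomial.coeff_smul, Polynomial.coeff_smul,
      mul_comm, mul_comm Polynomial.X, Polynomial.coeff_C_mul, Polynomial.coeff_C_mul,
      Polynomial.coeff_X, Polynomial.coeff_X]
    change restrictHom m _ = _
    rw [map_smul, map_mul]
    split_ifs
    · rw [map_one]; rfl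
    · rw [map_zero]; rfl
  rw [Polynomial.map_add, Polynomial.map_add, Polynomial.map_mul, Polynomial.map_X, hs,
    Polynomial.map_C]
  exact h

/-! ### The scaling of the variables -/

/-- The substitution `x_i ↦ q x_i` of all the variables. -/
noncomputable def scale : SymFun →ₐ[K] SymFun := symLift fun s => q ^ (s + 1) • powerSum s

theorem scale_powerSum (s : ℕ) : scale (powerSum s) = q ^ (s + 1) • powerSum s :=
  symLift_powerSum _ s

theorem coeff_restrict_scale (m : ℕ) (f : SymFun) (e : Fin m →₀ ℕ) :
    (restrict m (scale f)).coeff e = q ^ e.degree * (restrict m f).coeff e := by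
  have h : (restrictHom m).comp scale =
      (MvPolynomial.aeval fun j => q • MvPolynomial.X j).comp (restrictHom m) := by
    refine symFun_algHom_ext fun s => ?_
    rw [AlgHom.comp_apply, AlgHom.comp_apply, scale_powerSum, map_smul, restrictHom_powerSum]
    simp [MvPolynomial.psum, smul_pow, Finset.smul_sum]
  have h' : restrict m (scale f) = _ := AlgHom.congr_fun h f
  rw [h', AlgHom.comp_apply, restrictHom_apply]
  induction restrict m f using MvPolynomial.induction_on' with
  | add p r hp hr => rw [map_add, MvPolynomial.coeff_add, hp, hr, MvPolynomial.coeff_add, mul_add]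
  | monomial d c =>
    have h1 : MvPolynomial.aeval (fun j => q • (MvPolynomial.X j : MvPolynomial (Fin m) K))
        (MvPolynomial.monomial d c) = q ^ d.degree • MvPolynomial.monomial d c := by
      rw [MvPolynomial.aeval_monomial, MvPolynomial.monomial_eq, Finsupp.prod, Finsupp.prod,
        Finsupp.degree_apply, ← Finset.prod_pow_eq_pow_sum]
      simp only [smul_pow]
      rw [Finset.prod_smul, mul_smul_comm]
      rfl
    rw [h1, MvPolynomial.coeff_smul, smul_eq_mul, MvPolynomial.coeff_monomial]
    split_ifs with hd
    · rw [hd]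
    · rw [mul_zero, mul_zero]

theorem isHomogeneous_iff_scale {f : SymFun} {d : ℕ} : IsHomogeneous f d ↔ scale f = q ^ d • f := by
  constructor
  · intro h
    refine symFun_ext fun m => ?_
    ext e
    change _ = (q ^ d • restrict m f).coeff e
    rw [coeff_restrict_scale, MvPolynomial.coeff_smul, smul_eq_mul]
    by_cases he : (restrict m f).coeff e = 0
    · rw [he, mul_zero, mul_zero]
    · rw [degree_of_coeff_ne_zero (h m) he]
  · intro h m e he
    have h1 := coeff_restrict_scale m f e
    rw [h] at h1
    change (q ^ d • restrict m f).coeff e = _ at h1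
    rw [MvPolynomial.coeff_smul, smul_eq_mul] at h1
    have h2 := q_pow_injective (mul_right_cancel₀ he h1)
    rw [h2, Finsupp.degree_eq_weight_one]
    rfl

/-- The morphism `scale` on the coefficients of polynomials, together with `y ↦ q y`. -/
noncomputable def scalePoly : Polynomial SymFun →ₐ[K] Polynomial SymFun :=
  Polynomial.eval₂AlgHom ((Polynomial.CAlgHom : SymFun →ₐ[K] Polynomial SymFun).comp scale)
      (q • Polynomial.X) fun _ => Commute.all _ _

theorem scalePoly_C (f : SymFun) : scalePoly (Polynomial.C f) = Polynomial.C (scale f) :=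
  Polynomial.eval₂_C _ _

theorem scalePoly_X : scalePoly Polynomial.X = q • Polynomial.X := Polynomial.eval₂_X _ _

theorem scale_coeff_shiftHom (a : ℕ → K) (i : ℕ) (f : SymFun) :
    (shiftHom a (scale f)).coeff i = q ^ i • scale ((shiftHom a f).coeff i) := by
  have h : (shiftHom a).comp scale = scalePoly.comp (shiftHom a) := by
    refine symFun_algHom_ext fun s => ?_
    rw [AlgHom.comp_apply, AlgHom.comp_apply, scale_powerSum, map_smul, shiftHom_powerSum,
      map_add, map_smul, map_pow]
    rw [scalePoly_C, scalePoly_X, scale_powerSum, smul_pow, smul_add, Polynomial.smul_C, smul_comm]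
  have h' := AlgHom.congr_fun h f
  rw [AlgHom.comp_apply, AlgHom.comp_apply] at h'
  rw [h']
  induction shiftHom a f using Polynomial.induction_on' with
  | add p r hp hr => rw [map_add, Polynomial.coeff_add, hp, hr, Polynomial.coeff_add, map_add,
      smul_add]
  | monomial n c =>
    have h1 : scalePoly (Polynomial.monomial n c) = q ^ n • Polynomial.monomial n (scale c) := by
      rw [← Polynomial.C_mul_X_pow_eq_monomial, ← Polynomial.C_mul_X_pow_eq_monomial, map_mul,
        map_pow, scalePoly_C, scalePoly_X, smul_pow, mul_smul_comm]
    rw [h1, Polynomial.coeff_smul, Polynomial.coeff_monomial, Polynomial.coeff_monomial]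
    split_ifs with hn
    · rw [hn]
    · rw [map_zero, smul_zero, smul_zero]

/-- The ring structure found by unification with the structure of a semiring. -/
noncomputable instance symFunCommRing : CommRing SymFun :=
  Subalgebra.toCommRing symmetricFunctions

/-- Subtraction of symmetric functions, from the ring structure: the subtraction inherited from
additive subgroups is equal to it, but not at the transparency of instances. -/
noncomputable instance symFunSub : Sub SymFun := symFunCommRing.toRing.toSub

/-- Negation of symmetric functions, from the ring structure, for the same reason. -/
noncomputable instance symFunNeg : Neg SymFun := symFunCommRing.toRing.toNeg

/-! ### Macdonald's operator on symmetric functions -/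

theorem symFun_smul_cancel {c : K} (hc : c ≠ 0) {f g : SymFun} (h : c • f = c • g) : f = g := by
  rw [← one_smul K f, ← inv_mul_cancel₀ hc, ← smul_smul, h, smul_smul, inv_mul_cancel₀ hc, one_smul]

/-- The morphism `Λ → Λ[y]` of algebras which is the insertion of `q y` and the removal of `y`,
that is, `p_r ↦ p_r + (q ^ r - 1) y ^ r`. -/
noncomputable def qInsert : SymFun →ₐ[K] Polynomial SymFun := shiftHom fun s => q ^ (s + 1) - 1

/-- The function `g_{i - n}`, which is zero if `i < n`. -/
noncomputable def gShift (n i : ℕ) : SymFun := if n ≤ i then gSym (i - n) else 0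

/-- The operator `f ↦ ∑_i g_{i - n} f_i`, where `f_i` are the coefficients of `qInsert f`. -/
noncomputable def vertexOp (n : ℕ) : SymFun →ₗ[K] SymFun :=
  (Polynomial.lsum fun i => LinearMap.mulLeft K (gShift n i)).comp qInsert.toLinearMap

theorem vertexOp_apply (n : ℕ) {f : SymFun} {N : ℕ} (hN : (qInsert f).natDegree < N) :
    vertexOp n f = ∑ i ∈ Finset.range N, gShift n i * (qInsert f).coeff i :=
  Polynomial.sum_over_range' _ (fun _ => mul_zero _) N hN

theorem addVar_gShift (i : ℕ) :
    addVar (gShift 0 i) + t⁻¹ • (Polynomial.X * Polynomial.C (gShift 1 i)) =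
      Polynomial.C (gShift 0 i) + Polynomial.X * addVar (gShift 1 i) := by
  cases i with
  | zero => simp [gShift, gSym_zero]
  | succ i =>
    have h0 : gShift 0 (i + 1) = gSym (i + 1) := by simp [gShift]
    have h1 : gShift 1 (i + 1) = gSym i := by simp [gShift]
    rw [h0, h1, addVar_gSym_succ]

/-- The commutation relation of the vertex operator with the addition of a variable, which comes from
`addVar_gShift`. -/
theorem extract_vertexOp (k : ℕ) (f : SymFun) :
    extract (k + 1) (vertexOp 0 f) + t⁻¹ • vertexOp 1 (extract k f) =
      vertexOp 0 (extract (k + 1) f) + extract k (vertexOp 1 f) := by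
  obtain ⟨N, h1, h2, h3⟩ : ∃ N, (qInsert f).natDegree < N ∧
      (qInsert (extract k f)).natDegree < N ∧ (qInsert (extract (k + 1) f)).natDegree < N :=
    ⟨(qInsert f).natDegree + (qInsert (extract k f)).natDegree +
      (qInsert (extract (k + 1) f)).natDegree + 1, by omega, by omega, by omega⟩
  rw [vertexOp_apply 0 h1, vertexOp_apply 1 h1, vertexOp_apply 1 h2, vertexOp_apply 0 h3]
  simp only [map_sum, Finset.smul_sum]
  rw [← Finset.sum_add_distrib, ← Finset.sum_add_distrib]
  refine Finset.sum_congr rfl fun i _ => ?_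
  have e : ∀ j, (qInsert (extract j f)).coeff i = extract j ((qInsert f).coeff i) := fun j =>
    coeff_shiftHom_comm _ _ j i f
  rw [e, e]
  have h := congrArg (fun p => (p * addVar ((qInsert f).coeff i)).coeff (k + 1))
    (addVar_gShift i)
  simp only [add_mul, Polynomial.coeff_add, ← map_mul, smul_mul_assoc, Polynomial.coeff_smul,
    mul_assoc, Polynomial.coeff_X_mul, Polynomial.coeff_C_mul, coeff_addVar] at h
  exact h

/-- Macdonald's operator `E` on symmetric functions. -/
noncomputable def macdonaldE : SymFun →ₗ[K] SymFun :=
  (1 - t⁻¹)⁻¹ • (vertexOp 0 - LinearMap.id)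

theorem macdonaldE_apply (f : SymFun) : macdonaldE f = (1 - t⁻¹)⁻¹ • (vertexOp 0 f - f) := by
  rw [macdonaldE, LinearMap.smul_apply, LinearMap.sub_apply, LinearMap.id_apply]

theorem vertexOp_zero (f : SymFun) : vertexOp 0 f = f + (1 - t⁻¹) • macdonaldE f := by
  rw [macdonaldE_apply, smul_smul, mul_inv_cancel₀ one_sub_inv_t_ne_zero, one_smul,
    add_sub_cancel]

theorem vertexOp_one (f : SymFun) :
    vertexOp 1 f = extract 1 (macdonaldE f) - macdonaldE (extract 1 f) := by
  have h := extract_vertexOp 0 f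
  rw [vertexOp_zero, vertexOp_zero, extract_zero, extract_zero, map_add, map_smul, zero_add] at h
  refine symFun_smul_cancel one_sub_inv_t_ne_zero ?_
  rw [smul_sub, sub_smul, one_smul]
  rw [add_assoc, add_assoc] at h
  have h' := add_left_cancel h
  rw [sub_eq_sub_iff_add_eq_add, add_comm, ← h', add_comm]

/-- The commutation relation of `E` with the coefficients of the added variable is the one
satisfied by the branching operators. -/
theorem extract_macdonaldE (k : ℕ) (f : SymFun) :
    (1 - t⁻¹) • (extract (k + 1) (macdonaldE f) - macdonaldE (extract (k + 1) f)) =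
      extract k (extract 1 (macdonaldE f) - macdonaldE (extract 1 f)) -
        t⁻¹ • (extract 1 (macdonaldE (extract k f)) - macdonaldE (extract 1 (extract k f))) := by
  have h := extract_vertexOp k f
  rw [vertexOp_zero, vertexOp_zero, map_add, map_smul, vertexOp_one, vertexOp_one, add_assoc,
    add_assoc] at h
  have h' := add_left_cancel h
  rw [smul_sub, sub_eq_sub_iff_add_eq_add, h', add_comm]

theorem macdonaldE_one : macdonaldE 1 = 0 := by
  have h : vertexOp 0 1 = 1 := by
    rw [vertexOp_apply 0 (N := 1) (by simp)]
    simp [gShift, gSym_zero]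
  rw [macdonaldE_apply, h, sub_self, smul_zero]

theorem isHomogeneous_macdonaldE {f : SymFun} {d : ℕ} (hf : IsHomogeneous f d) :
    IsHomogeneous (macdonaldE f) d := by
  rw [isHomogeneous_iff_scale] at hf ⊢
  have h : scale (vertexOp 0 f) = q ^ d • vertexOp 0 f := by
    rw [vertexOp_apply 0 (Nat.lt_succ_self _), map_sum, Finset.smul_sum]
    refine Finset.sum_congr rfl fun i _ => ?_
    have h1 : scale (gShift 0 i) = q ^ i • gShift 0 i := by
      have := isHomogeneous_iff_scale.1 (isHomogeneous_gSym i)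
      simpa [gShift] using this
    have h2 := scale_coeff_shiftHom (fun s => q ^ (s + 1) - 1) i f
    rw [hf, map_smul, Polynomial.coeff_smul] at h2
    change q ^ d • (qInsert f).coeff i = q ^ i • scale ((qInsert f).coeff i) at h2
    rw [map_mul, h1, smul_mul_assoc, ← mul_smul_comm, ← h2, mul_smul_comm]
  rw [macdonaldE_apply, map_smul, map_sub, h, hf, smul_comm, ← smul_sub]

/-! ### Comparison with Macdonald's operators in finitely many variables -/

section PartialFractions

open Polynomial

variable {F ι : Type*} [Field F] [DecidableEq ι]

/-- Partial fractions for `∏ (1 - c x_j u) / ∏ (1 - x_j u)`, with denominators cleared. -/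
theorem prod_one_sub_eq (S : Finset ι) (x : ι → F) {c : F} (hc : c ≠ 0)
    (hx : Function.Injective x) (hx0 : ∀ i, x i ≠ 0) :
    ∏ j ∈ S, (1 - C (c * x j) * X) = C (c ^ S.card) * ∏ j ∈ S, (1 - C (x j) * X) +
      ∑ i ∈ S, C ((1 - c) * ∏ j ∈ S.erase i, ((x i - c * x j) / (x i - x j))) *
        ∏ j ∈ S.erase i, (1 - C (x j) * X) := by
  have h := prod_sub_eq_add_sum S (fun i => (x i)⁻¹) (fun i => (c * x i)⁻¹)
    (fun i _ j _ hij => hx (inv_injective hij))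
  have e : ∀ (S : Finset ι) (y : ι → F), (∀ i, y i ≠ 0) →
      ∏ j ∈ S, (1 - C (y j) * X) = C (∏ j ∈ S, (- y j)) * ∏ j ∈ S, (X - C (y j)⁻¹) := by
    intro S y hy
    rw [map_prod, ← Finset.prod_mul_distrib]
    refine Finset.prod_congr rfl fun j _ => ?_
    rw [mul_sub, ← C_mul, neg_mul, mul_inv_cancel₀ (hy j), C_neg, C_neg, C_1]
    ring
  have hS : ∀ S : Finset ι, ∏ j ∈ S, -(c * x j) = c ^ S.card * ∏ j ∈ S, (- x j) := by
    intro S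
    rw [← Finset.prod_const, ← Finset.prod_mul_distrib]
    exact Finset.prod_congr rfl fun j _ => by ring
  rw [e S (fun j => c * x j) (fun i => mul_ne_zero hc (hx0 i)), h, mul_add, hS, C_mul, mul_assoc,
    ← e S x hx0, Finset.mul_sum]
  congr 1
  refine Finset.sum_congr rfl fun i hi => ?_
  rw [e (S.erase i) x hx0, ← mul_assoc, ← mul_assoc, ← C_mul, ← C_mul, ← C_mul]
  congr 2
  rw [← Finset.mul_prod_erase S (fun j => -x j) hi,
    ← Finset.mul_prod_erase S (fun j => (x i)⁻¹ - (c * x j)⁻¹) hi,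
    mul_div_assoc, ← Finset.prod_div_distrib]
  have h1 : ∏ j ∈ S.erase i, (((x i)⁻¹ - (c * x j)⁻¹) / ((x i)⁻¹ - (x j)⁻¹)) =
      (c ^ (S.erase i).card)⁻¹ * ∏ j ∈ S.erase i, ((x i - c * x j) / (x i - x j)) := by
    rw [← inv_pow, ← Finset.prod_const, ← Finset.prod_mul_distrib]
    refine Finset.prod_congr rfl fun j hj => ?_
    have hij : x i - x j ≠ 0 := sub_ne_zero.2 fun h => Finset.ne_of_mem_erase hj (hx h).symm
    have hij' : x j - x i ≠ 0 := sub_ne_zero.2 fun h => Finset.ne_of_mem_erase hj (hx h)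
    have := hx0 i
    have := hx0 j
    have h3 : (x i)⁻¹ - (x j)⁻¹ ≠ 0 := by
      rw [inv_sub_inv (hx0 i) (hx0 j)]
      exact div_ne_zero hij' (mul_ne_zero (hx0 i) (hx0 j))
    rw [div_eq_iff h3]
    field_simp
    ring
  have h2 : c ^ S.card = c * c ^ (S.erase i).card := by
    rw [← Finset.card_erase_add_one hi, pow_succ']
  rw [h1, h2]
  have := hx0 i
  have hc' : c ^ (S.erase i).card ≠ 0 := pow_ne_zero _ hc
  generalize ∏ j ∈ S.erase i, ((x i - c * x j) / (x i - x j)) = P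
  generalize ∏ j ∈ S.erase i, (-x j) = Q
  field_simp
  ring

theorem prod_geometric_eq (S : Finset ι) (x : ι → F) {c : F} (hc : c ≠ 0)
    (hx : Function.Injective x) (hx0 : ∀ i, x i ≠ 0) (G : ι → PowerSeries F)
    (H : ι → PowerSeries F)
    (hG : ∀ i, (1 - PowerSeries.C (x i) * PowerSeries.X) * G i =
      1 - PowerSeries.C (c * x i) * PowerSeries.X)
    (hH : ∀ i, (1 - PowerSeries.C (x i) * PowerSeries.X) * H i = 1) :
    ∏ j ∈ S, G j = PowerSeries.C (c ^ S.card) +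
      ∑ i ∈ S, PowerSeries.C ((1 - c) * ∏ j ∈ S.erase i, ((x i - c * x j) / (x i - x j))) * H i := by
  have h := congrArg (Polynomial.coeToPowerSeries.ringHom (R := F))
    (prod_one_sub_eq S x hc hx hx0)
  simp only [map_add, map_sum, map_mul (Polynomial.coeToPowerSeries.ringHom (R := F)),
    map_prod (Polynomial.coeToPowerSeries.ringHom (R := F)),
    map_sub (Polynomial.coeToPowerSeries.ringHom (R := F)), map_one,
    Polynomial.coeToPowerSeries.ringHom_apply, Polynomial.coe_C, Polynomial.coe_X] at h
  have hGH : ∀ i, G i = (1 - PowerSeries.C (c * x i) * PowerSeries.X) * H i := fun i => by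
    rw [← hG, mul_right_comm, hH, one_mul]
  have hp : ∀ S : Finset ι, (∏ j ∈ S, (1 - PowerSeries.C (x j) * PowerSeries.X)) *
      ∏ j ∈ S, H j = 1 := fun S => by
    rw [← Finset.prod_mul_distrib]
    exact Finset.prod_eq_one fun i _ => hH i
  rw [Finset.prod_congr rfl fun i _ => hGH i, Finset.prod_mul_distrib]
  rw [Finset.prod_congr rfl fun i _ => by rw [map_mul]] at h
  rw [Finset.prod_congr rfl fun i _ => by rw [map_mul], h, add_mul, mul_assoc, hp, mul_one, Finset.sum_mul]
  congr 1
  refine Finset.sum_congr rfl fun i hi => ?_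
  rw [← Finset.mul_prod_erase S H hi]
  linear_combination (PowerSeries.C ((1 - c) *
    ∏ j ∈ S.erase i, ((x i - c * x j) / (x i - x j))) * H i) * hp (S.erase i)

end PartialFractions

/-- A symmetric function in `m` variables, as a rational function. -/
noncomputable def ratHom (m : ℕ) : SymFun →ₐ[K] RatFun m := (toRat m).comp (restrictHom m)

theorem ratHom_apply (m : ℕ) (f : SymFun) : ratHom m f = toRat m (restrict m f) := rfl

theorem toRat_injective (m : ℕ) : Function.Injective (toRat m) :=
  IsFractionRing.injective (MvPolynomial (Fin m) K) (RatFun m)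

theorem ratX_injective (m : ℕ) : Function.Injective (ratX : Fin m → RatFun m) :=
  (toRat_injective m).comp (MvPolynomial.X_injective)

theorem ratX_ne_zero {m : ℕ} (i : Fin m) : ratX i ≠ 0 :=
  (map_ne_zero_iff _ (toRat_injective m)).2 (MvPolynomial.X_ne_zero i)

theorem coeff_zero_shiftHom (a : ℕ → K) (f : SymFun) : (shiftHom a f).coeff 0 = f := by
  have h : ((Polynomial.aeval (0 : SymFun)).restrictScalars K).comp (shiftHom a) =
      AlgHom.id K SymFun :=
    symFun_algHom_ext fun s => by simp [shiftHom_powerSum]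
  rw [Polynomial.coeff_zero_eq_aeval_zero]
  exact AlgHom.congr_fun h f

theorem toRat_qShift {m : ℕ} (i : Fin m) (f : SymFun) :
    toRat m (qShift i (restrict m f)) =
      (qInsert f).eval₂ (ratHom m : SymFun →+* RatFun m) (ratX i) := by
  have h : ((toRat m).comp (qShift i)).comp (restrictHom m) =
      (Polynomial.eval₂AlgHom (ratHom m) (ratX i) fun _ => Commute.all _ _).comp qInsert := by
    refine symFun_algHom_ext fun s => ?_
    have h1 : Polynomial.eval₂AlgHom (ratHom m) (ratX i) (fun _ => Commute.all _ _)
        (Polynomial.C (powerSum s)) = ratHom m (powerSum s) := Polynomial.eval₂_C _ _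
    have h2 : Polynomial.eval₂AlgHom (ratHom m) (ratX i) (fun _ => Commute.all _ _)
        Polynomial.X = ratX i := Polynomial.eval₂_X _ _
    have h3 : qShift i (MvPolynomial.psum (Fin m) K (s + 1)) =
        MvPolynomial.psum (Fin m) K (s + 1) +
          (q ^ (s + 1) - 1) • MvPolynomial.X i ^ (s + 1) := by
      rw [MvPolynomial.psum, map_sum, ← Finset.add_sum_erase _ _ (Finset.mem_univ i),
        ← Finset.add_sum_erase _ _ (Finset.mem_univ i), Finset.sum_congr rfl fun j hj => by
          rw [map_pow, qShift, MvPolynomial.aeval_X, if_neg (Finset.ne_of_mem_erase hj)]]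
      rw [map_pow, qShift, MvPolynomial.aeval_X, if_pos rfl, smul_pow, sub_smul, one_smul]
      ring
    rw [AlgHom.comp_apply, AlgHom.comp_apply, AlgHom.comp_apply, restrictHom_powerSum, h3,
      qInsert, shiftHom_powerSum, map_add, map_add, map_smul, map_smul, map_pow, map_pow, h1, h2]
    rfl
  exact AlgHom.congr_fun h f

/-- The coefficient `∏_{j ≠ i} (x_i - t⁻¹ x_j) / (x_i - x_j)` of the `q`-shift of `x_i` in `E`. -/
noncomputable def shiftCoeff {m : ℕ} (i : Fin m) : RatFun m :=
  ∏ j ∈ Finset.univ.erase i,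
    ((ratX i - algebraMap K (RatFun m) t⁻¹ * ratX j) / (ratX i - ratX j))

theorem ratHom_gSym (m r : ℕ) : ratHom m (gSym r) =
    (if r = 0 then algebraMap K (RatFun m) t⁻¹ ^ m else 0) +
      (1 - algebraMap K (RatFun m) t⁻¹) * ∑ i, shiftCoeff i * ratX i ^ r := by
  have h1 := congrArg (PowerSeries.coeff r) (map_gSeries (toRat m))
  rw [PowerSeries.coeff_map] at h1
  have h2 := prod_geometric_eq Finset.univ (ratX : Fin m → RatFun m)
    (c := algebraMap K (RatFun m) t⁻¹)
    ((map_ne_zero _).2 (inv_ne_zero t_ne_zero)) (ratX_injective m) ratX_ne_zero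
    (fun i => gFactor (ratX i)) (fun i => PowerSeries.mk fun n => ratX i ^ n)
    (fun i => by
      have h := gFactor_add (ratX i)
      rw [Algebra.smul_def] at h
      linear_combination h)
    (fun i => by
      ext n
      rw [sub_mul, one_mul, mul_assoc, map_sub, PowerSeries.coeff_C_mul]
      cases n with
      | zero => simp
      | succ n =>
        rw [PowerSeries.coeff_succ_X_mul, PowerSeries.coeff_mk, PowerSeries.coeff_mk,
          PowerSeries.coeff_one, if_neg (Nat.succ_ne_zero n), pow_succ']
        exact sub_self _)
  have h3 : ratHom m (gSym r) = PowerSeries.coeff r (∏ j, gFactor (ratX j)) := h1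
  rw [h3, h2, map_add, map_sum, PowerSeries.coeff_C, Finset.card_univ, Fintype.card_fin,
    Finset.mul_sum]
  congr 1
  refine Finset.sum_congr rfl fun i _ => ?_
  rw [PowerSeries.coeff_C_mul, PowerSeries.coeff_mk, mul_assoc]
  rfl

theorem ratHom_vertexOp (m : ℕ) (f : SymFun) : ratHom m (vertexOp 0 f) =
    algebraMap K (RatFun m) t⁻¹ ^ m * ratHom m f + (1 - algebraMap K (RatFun m) t⁻¹) *
      ∑ i, shiftCoeff i * toRat m (qShift i (restrict m f)) := by
  have hN := Nat.lt_succ_self (qInsert f).natDegree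
  rw [vertexOp_apply 0 hN, map_sum]
  have h1 : ∀ i : Fin m, toRat m (qShift i (restrict m f)) =
      ∑ r ∈ Finset.range ((qInsert f).natDegree + 1),
        ratHom m ((qInsert f).coeff r) * ratX i ^ r := fun i => by
    rw [toRat_qShift, Polynomial.eval₂_eq_sum_range]
    rfl
  have h2 : ∀ r, ratHom m (gShift 0 r * (qInsert f).coeff r) =
      (if r = 0 then algebraMap K (RatFun m) t⁻¹ ^ m else 0) * ratHom m ((qInsert f).coeff r) +
      (1 - algebraMap K (RatFun m) t⁻¹) *
        ∑ i, shiftCoeff i * (ratHom m ((qInsert f).coeff r) * ratX i ^ r) := fun r => by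
    rw [map_mul, gShift, if_pos (Nat.zero_le r), Nat.sub_zero, ratHom_gSym, add_mul, mul_assoc,
      Finset.sum_mul]
    congr 2
    exact Finset.sum_congr rfl fun i _ => by ring
  rw [Finset.sum_congr rfl fun r _ => h2 r, Finset.sum_add_distrib, ← Finset.mul_sum]
  congr 1
  · rw [Finset.sum_eq_single 0]
    · rw [if_pos rfl, qInsert, coeff_zero_shiftHom]
    · intro r _ hr
      rw [if_neg hr, zero_mul]
    · intro h
      exact absurd (Finset.mem_range.2 (Nat.succ_pos _)) h
  · rw [Finset.sum_comm]
    congr 1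
    refine Finset.sum_congr rfl fun i _ => ?_
    rw [h1, Finset.mul_sum]

theorem v_sub_inv_ne_zero : v - v⁻¹ ≠ 0 := fun h => by
  have := v_ne_zero
  refine t_ne_one ?_
  rw [t, pow_two]
  nth_rewrite 1 [sub_eq_zero.1 h]
  exact inv_mul_cancel₀ this

theorem opE_eq (m : ℕ) (hm : 1 ≤ m) (p : MvPolynomial (Fin m) K) : opE m p =
    ∑ i, shiftCoeff i * toRat m (qShift i p) -
      ((1 - t⁻¹ ^ m) * (1 - t⁻¹)⁻¹) • toRat m p := by
  obtain ⟨n, rfl⟩ : ∃ n, m = n + 1 := ⟨m - 1, by omega⟩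
  have hv := v_ne_zero
  have e1 : v ^ (1 - ((n + 1 : ℕ) : ℤ)) = (v ^ n)⁻¹ := by
    rw [← zpow_natCast, ← zpow_neg]
    congr 1
    push_cast
    ring
  rw [opE, e1, smul_sub, smul_smul]
  congr 1
  · rw [opD, Finset.smul_sum]
    refine Finset.sum_congr rfl fun i _ => ?_
    rw [← smul_mul_assoc]
    congr 1
    have h1 : ∀ j : Fin (n + 1), (v • ratX i - v⁻¹ • ratX j) / (ratX i - ratX j) =
        algebraMap K (RatFun (n + 1)) v *
          ((ratX i - algebraMap K (RatFun (n + 1)) t⁻¹ * ratX j) / (ratX i - ratX j)) := fun j => by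
      rw [← mul_div_assoc, mul_sub, ← mul_assoc, ← map_mul, Algebra.smul_def, Algebra.smul_def]
      congr 4
      rw [t]
      field_simp
    rw [Finset.prod_congr rfl fun j _ => h1 j, Finset.prod_mul_distrib, Finset.prod_const,
      Finset.card_erase_of_mem (Finset.mem_univ i), Finset.card_univ, Fintype.card_fin,
      Nat.add_sub_cancel, ← map_pow, ← Algebra.smul_def, smul_smul,
      inv_mul_cancel₀ (pow_ne_zero n hv), one_smul]
    rfl
  · congr 1
    have h2 := v_sub_inv_ne_zero
    have h3 := one_sub_inv_t_ne_zero
    rw [vInt]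
    have h4 : v - v⁻¹ = v * (1 - t⁻¹) := by
      rw [t]
      field_simp
    have h5 : v ^ (n + 1) - v⁻¹ ^ (n + 1) = v ^ (n + 1) * (1 - t⁻¹ ^ (n + 1)) := by
      rw [mul_sub, mul_one, ← mul_pow]
      congr 2
      rw [t]
      field_simp
    rw [h4, h5, pow_succ v]
    field_simp

theorem stableE_macdonaldE (f : SymFun) : StableE f (macdonaldE f) := by
  intro m hm
  have h := ratHom_vertexOp m f
  have h3 := one_sub_inv_t_ne_zero
  have h4 : (1 - algebraMap K (RatFun m) t⁻¹) ≠ 0 := by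
    rw [← map_one (algebraMap K (RatFun m)), ← map_sub]
    exact (map_ne_zero _).2 h3
  rw [opE_eq m hm, ← ratHom_apply, ← ratHom_apply, macdonaldE_apply, map_smul, map_sub, h,
    Algebra.smul_def, Algebra.smul_def, map_mul, map_inv₀, map_sub, map_sub, map_one, map_pow]
  have h5 : (1 - algebraMap K (RatFun m) t⁻¹)⁻¹ * (1 - algebraMap K (RatFun m) t⁻¹) = 1 :=
    inv_mul_cancel₀ h4
  linear_combination -(∑ i, shiftCoeff i * toRat m (qShift i (restrict m f))) * h5

/-- The vertex operator is the limit of the operators `E_m`. -/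
theorem stableE_iff {f g : SymFun} : StableE f g ↔ g = macdonaldE f := by
  refine ⟨fun h => ?_, fun h => h ▸ stableE_macdonaldE f⟩
  have h1 : ∀ m ≥ 1, restrict m g = restrict m (macdonaldE f) := fun m hm =>
    toRat_injective m ((h m hm).symm.trans (stableE_macdonaldE f m hm))
  refine symFun_ext fun m => ?_
  rw [← theta_restrict m g, ← theta_restrict m (macdonaldE f), h1 _ (by omega)]

/-! ### The eigenvectors -/

/-- The coefficient of `x ^ d` of a symmetric function in one variable. -/
noncomputable def rowCoeff (d : ℕ) : SymFun →ₗ[K] K := constTerm.toLinearMap.comp (extract d)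

theorem rowCoeff_apply (d : ℕ) (f : SymFun) : rowCoeff d f = constTerm (extract d f) := rfl

theorem restrict_one_coeff (f : SymFun) (e : Fin 1 →₀ ℕ) :
    (restrict 1 f).coeff e = rowCoeff (e 0) f := by
  have h := coeff_splitLast 0 (restrict 1 f) e
  rw [← restrict_extract, restrict_zero_eq] at h
  rw [← h, Subsingleton.elim (Finsupp.comapDomain _ _ _) (0 : Fin 0 →₀ ℕ),
    MvPolynomial.coeff_zero_C]
  rfl

theorem rowCoeff_eq_coeff (d : ℕ) (f : SymFun) :
    rowCoeff d f = (restrict 1 f).coeff (Finsupp.single 0 d) := by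
  rw [restrict_one_coeff, Finsupp.single_eq_same]

theorem rowCoeff_macdonaldE (d : ℕ) (f : SymFun) :
    rowCoeff d (macdonaldE f) = (q ^ d - 1) * rowCoeff d f := by
  have h1 : ((qShift (0 : Fin 1))).comp (restrictHom 1) = (restrictHom 1).comp scale := by
    refine symFun_algHom_ext fun s => ?_
    rw [AlgHom.comp_apply, AlgHom.comp_apply, scale_powerSum, map_smul, restrictHom_powerSum]
    simp [MvPolynomial.psum, qShift, smul_pow]
  have h2 : restrict 1 (macdonaldE f) = restrict 1 (scale f) - restrict 1 f := by
    refine toRat_injective 1 ?_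
    rw [← stableE_macdonaldE f 1 le_rfl, opE_eq 1 le_rfl, pow_one,
      mul_inv_cancel₀ one_sub_inv_t_ne_zero, one_smul, map_sub]
    have h3 : qShift (0 : Fin 1) (restrict 1 f) = restrict 1 (scale f) := AlgHom.congr_fun h1 f
    simp [shiftCoeff, h3]
  rw [rowCoeff_eq_coeff, h2, MvPolynomial.coeff_sub, coeff_restrict_scale, rowCoeff_eq_coeff,
    Finsupp.degree_single, sub_mul, one_mul]

theorem rowCoeff_skewSym (k : ℕ) (μ lam : YoungDiagram) :
    rowCoeff k (skewSym μ lam) = stripCoeff k μ lam := by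
  rw [rowCoeff_apply, extract_skewSym, map_sum]
  simp only [map_smul, constTerm_skewSym, smul_eq_mul]
  rw [Finset.sum_eq_single μ]
  · rw [stripCoeff_zero_self, mul_one]
  · intro ν _ hν
    rw [stripCoeff_zero_of_ne hν.symm, mul_zero]
  · intro h
    by_contra h0
    exact h (mem_below.2 (stripCoeff_ne_zero (left_ne_zero_of_mul h0)).2.1)

theorem card_bot : (⊥ : YoungDiagram).card = 0 := rfl

theorem colLen_bot (i : ℕ) : (⊥ : YoungDiagram).colLen i = 0 := by
  by_contra h
  exact YoungDiagram.notMem_bot _ ((YoungDiagram.mem_iff_lt_colLen (μ := ⊥)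
    (i := 0) (j := i)).2 (Nat.pos_of_ne_zero h))

theorem card_eq_sum_rowLen (μ : YoungDiagram) :
    μ.card = ∑ i ∈ Finset.range (μ.colLen 0), μ.rowLen i := by
  rw [YoungDiagram.card, Finset.card_eq_sum_ones, sum_cells_eq_sum_rows]
  simp

theorem eigenvalue_of_colLen_le_one {lam : YoungDiagram} (h : lam.colLen 0 ≤ 1) :
    eigenvalue lam = q ^ lam.card - 1 := by
  rw [eigenvalue, card_eq_sum_rowLen]
  interval_cases lam.colLen 0 <;> simp

/-- A homogeneous symmetric function of positive degree `d` is zero as soon as it has no term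
`x ^ d` in one variable and its coefficients in an added variable are determined by the first
one. -/
theorem eq_zero_of_extract_relation {h : SymFun} {d : ℕ} (hd : 0 < d) (hh : IsHomogeneous h d)
    (hrel : ∀ k, (1 - t⁻¹) • extract (k + 2) h = extract (k + 1) (extract 1 h))
    (h0 : extract d h = 0) : h = 0 := by
  let G : Module.End K SymFun := extract 1
  have hG : ∀ (j k : ℕ) (f : SymFun), (G ^ j) (extract k f) = extract k ((G ^ j) f) := by
    intro j k f
    induction j with
    | zero => rfl
    | succ j ih =>
      rw [pow_succ', Module.End.mul_apply, ih, Module.End.mul_apply]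
      exact extract_comm 1 k _
  have hpow : ∀ k, (1 - t⁻¹) ^ k • extract (k + 1) h = (G ^ (k + 1)) h := by
    intro k
    induction k with
    | zero => rw [pow_zero, one_smul, zero_add, pow_one]
    | succ k ih =>
      rw [pow_succ, ← smul_smul, hrel, ← extract_comm, ← map_smul, ih, pow_succ' G (k + 1),
        Module.End.mul_apply]
  have hhom : ∀ j, IsHomogeneous ((G ^ j) h) (d - j) := by
    intro j
    induction j with
    | zero => exact hh
    | succ j ih =>
      rw [pow_succ', Module.End.mul_apply, Nat.sub_add_eq]
      exact isHomogeneous_extract ih 1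
  -- `(extract 1) ^ d` kills `h`, and then so do the smaller powers, one after the other
  have hdown : ∀ i, i ≤ d → (G ^ (d - i)) h = 0 := by
    intro i
    induction i with
    | zero =>
      intro _
      obtain ⟨e, rfl⟩ : ∃ e, d = e + 1 := ⟨d - 1, by omega⟩
      rw [Nat.sub_zero, ← hpow, h0, smul_zero]
    | succ i ih =>
      intro hi
      refine eq_zero_of_extract (fun k => ?_)
        (constTerm_eq_zero (hhom _) (by omega))
      refine symFun_smul_cancel (pow_ne_zero k one_sub_inv_t_ne_zero) ?_
      rw [← hG, ← map_smul, hpow, smul_zero, ← Module.End.mul_apply, ← pow_add,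
        show d - (i + 1) + (k + 1) = k + (d - i) by omega, pow_add, Module.End.mul_apply,
        ih (by omega), map_zero]
  have := hdown d le_rfl
  rwa [Nat.sub_self, pow_zero, Module.End.one_apply] at this

/-- The linear map which sends the basis vector `λ` to the function built from the branching
coefficients. -/
noncomputable def toSymFun : (YoungDiagram →₀ K) →ₗ[K] SymFun :=
  Finsupp.linearCombination K (skewSym ⊥)

theorem toSymFun_single (lam : YoungDiagram) :
    toSymFun (Finsupp.single lam 1) = skewSym ⊥ lam := by
  rw [toSymFun, Finsupp.linearCombination_single, one_smul]

theorem extract_toSymFun (k : ℕ) (x : YoungDiagram →₀ K) :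
    extract k (toSymFun x) = toSymFun (removeStrip k x) := by
  have h : (extract k).comp toSymFun = toSymFun.comp (removeStrip k) := by
    refine Finsupp.lhom_ext' fun lam => LinearMap.ext_ring ?_
    change extract k (toSymFun (Finsupp.single lam 1)) =
      toSymFun (removeStrip k (Finsupp.single lam 1))
    rw [toSymFun_single, extract_skewSym, removeStrip_single, map_sum]
    refine Finset.sum_congr rfl fun ν _ => ?_
    rw [toSymFun, Finsupp.linearCombination_single]
  exact LinearMap.congr_fun h x

theorem skewSym_bot_bot : skewSym ⊥ ⊥ = 1 := by
  refine ext_of_extract (fun k => ?_) ?_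
  · rw [extract_eq_zero (isHomogeneous_skewSym ⊥ ⊥) (by rw [Nat.sub_self]; omega)]
    rw [← coeff_addVar, map_one, Polynomial.coeff_one, if_neg (by omega)]
  · rw [constTerm_skewSym, stripCoeff_zero_self, map_one]

theorem isHomogeneous_skewSym_bot (lam : YoungDiagram) :
    IsHomogeneous (skewSym ⊥ lam) lam.card := isHomogeneous_skewSym ⊥ lam

/-- By induction on `λ`, the defect `E P_λ - α_λ P_λ` satisfies the relation of
`eq_zero_of_extract_relation`; its coefficient in one variable vanishes because that of
`P_λ` is zero unless `λ` has one row, and then `α_λ` is the eigenvalue in one variable. -/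
theorem macdonaldE_skewSym (lam : YoungDiagram) :
    macdonaldE (skewSym ⊥ lam) = eigenvalue lam • skewSym ⊥ lam := by
  induction hn : lam.card using Nat.strong_induction_on generalizing lam with
  | _ n ih =>
  rcases Nat.eq_zero_or_pos n with rfl | hpos
  · have hbot : lam = ⊥ := (eq_of_le_of_card_le bot_le (by omega)).symm
    rw [hbot, skewSym_bot_bot, macdonaldE_one, eigenvalue, colLen_bot, Finset.sum_range_zero,
      zero_smul]
  rw [← sub_eq_zero]
  set h := macdonaldE (skewSym ⊥ lam) - eigenvalue lam • skewSym ⊥ lam with hh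
  have hlow : ∀ ν : YoungDiagram, ν.card ≤ n → ∀ k, macdonaldE (toSymFun
      (removeStrip (k + 1) (Finsupp.single ν 1))) =
      toSymFun (diagonal (removeStrip (k + 1) (Finsupp.single ν 1))) := by
    intro ν hν k
    rw [removeStrip_single, map_sum, map_sum, map_sum, map_sum]
    refine Finset.sum_congr rfl fun κ _ => ?_
    by_cases h0 : stripCoeff (k + 1) κ ν = 0
    · rw [h0, Finsupp.single_zero, map_zero, map_zero, map_zero, map_zero]
    · have hc := (stripCoeff_ne_zero h0).1
      rw [← mul_one (stripCoeff (k + 1) κ ν), ← smul_eq_mul, ← Finsupp.smul_single, map_smul,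
        map_smul, map_smul, map_smul, diagonal_single, toSymFun_single, map_smul,
        toSymFun_single, ih κ.card (by omega) κ rfl]
  have hlow' : ∀ k, macdonaldE (toSymFun
      (removeStrip 1 (removeStrip (k + 1) (Finsupp.single lam 1)))) =
      toSymFun (diagonal (removeStrip 1 (removeStrip (k + 1) (Finsupp.single lam 1)))) := by
    intro k
    rw [removeStrip_single]
    simp only [map_sum]
    refine Finset.sum_congr rfl fun κ hκ => ?_
    rw [← mul_one (stripCoeff (k + 1) κ lam), ← smul_eq_mul, ← Finsupp.smul_single]
    simp only [map_smul]
    rw [hlow κ ((card_mono (mem_below.1 hκ)).trans hn.le) 0]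
  have hhom : IsHomogeneous h n := by
    have h1 := isHomogeneous_skewSym_bot lam
    have h2 := isHomogeneous_macdonaldE h1
    rw [hn, isHomogeneous_iff_scale] at h1 h2
    rw [isHomogeneous_iff_scale, hh, map_sub, map_smul, h1, h2, smul_comm (eigenvalue lam),
      smul_sub]
  refine eq_zero_of_extract_relation (d := n) hpos hhom (fun k => ?_) ?_
  · have e1 := extract_macdonaldE (k + 1) (skewSym ⊥ lam)
    have e2 := congrArg toSymFun (LinearMap.congr_fun (removeStrip_recursion (k + 1))
      (Finsupp.single lam 1))
    simp only [LinearMap.smul_apply, LinearMap.sub_apply, Module.End.mul_apply, diagonal_single,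
      map_smul, map_sub] at e2
    rw [← toSymFun_single] at e1
    simp only [extract_toSymFun, map_sub] at e1
    rw [hlow lam hn.le, hlow lam hn.le 0, hlow lam hn.le, hlow' k] at e1
    simp only [extract_toSymFun] at e1
    rw [hh, map_sub, map_sub, map_sub, map_smul, map_smul, map_smul, ← toSymFun_single]
    simp only [extract_toSymFun]
    rw [smul_sub, smul_sub] at e1 e2
    rw [smul_sub]
    linear_combination (norm := abel) e1 - e2
  · have h1 := isHomogeneous_extract hhom n
    rw [Nat.sub_self] at h1
    refine eq_zero_of_extract (fun k => extract_eq_zero h1 (Nat.succ_pos k)) ?_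
    rw [← rowCoeff_apply, hh, map_sub, map_smul, rowCoeff_macdonaldE, rowCoeff_skewSym,
      smul_eq_mul, ← sub_mul]
    by_cases h0 : stripCoeff n ⊥ lam = 0
    · rw [h0, mul_zero]
    · have h2 := (stripCoeff_ne_zero h0).2.2 0
      rw [colLen_bot] at h2
      rw [eigenvalue_of_colLen_le_one h2, hn, sub_self, zero_mul]

/-! ### Coefficients of monomial symmetric functions -/

theorem prod_map_X {σ : Type*} [DecidableEq σ] (s : Multiset σ) :
    (s.map fun i => (MvPolynomial.X i : MvPolynomial σ K)).prod =
      MvPolynomial.monomial (Multiset.toFinsupp s) 1 := by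
  induction s using Multiset.induction_on with
  | empty => simp
  | cons a s ih =>
    rw [Multiset.map_cons, Multiset.prod_cons, ih, ← Multiset.singleton_add, map_add,
      Multiset.toFinsupp_singleton, MvPolynomial.X, MvPolynomial.monomial_mul, one_mul]

theorem ofSym_parts {σ : Type*} [DecidableEq σ] {n : ℕ} (s : Sym σ n) :
    (Nat.Partition.ofSym s).parts =
      (Multiset.toFinsupp s.1).support.val.map (Multiset.toFinsupp s.1) := by
  rw [Multiset.toFinsupp_support]
  rfl

theorem coeff_msymm_of_eq {σ : Type*} [Fintype σ] [DecidableEq σ] {n : ℕ} {μ : n.Partition}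
    {e : σ →₀ ℕ} (h : μ.parts = e.support.val.map e) :
    (MvPolynomial.msymm σ K μ).coeff e = 1 := by
  have hcard : (Finsupp.toMultiset e).card = n := by
    rw [Finsupp.card_toMultiset, ← μ.parts_sum, h]
    rfl
  have hs : Nat.Partition.ofSym (Sym.mk (Finsupp.toMultiset e) hcard) = μ := by
    ext1
    rw [ofSym_parts, h]
    change Multiset.map (Multiset.toFinsupp (Finsupp.toMultiset e)) _ = _
    rw [Sym.mk, Finsupp.toMultiset_toFinsupp]
  rw [MvPolynomial.msymm, MvPolynomial.coeff_sum, Finset.sum_eq_single ⟨Sym.mk _ hcard, hs⟩]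
  · change MvPolynomial.coeff e ((Finsupp.toMultiset e).map fun i => MvPolynomial.X i).prod = 1
    rw [prod_map_X, Finsupp.toMultiset_toFinsupp, MvPolynomial.coeff_monomial, if_pos rfl]
  · rintro ⟨⟨s, hs'⟩, hs''⟩ _ hne
    change MvPolynomial.coeff e (s.map fun i => MvPolynomial.X i).prod = 0
    rw [prod_map_X, MvPolynomial.coeff_monomial, if_neg]
    rintro rfl
    refine hne (Subtype.ext (Subtype.ext ?_))
    exact (Multiset.toFinsupp_toMultiset s).symm
  · exact fun h => absurd (Finset.mem_univ _) h

theorem parts_eq_of_coeff_msymm_ne_zero {σ : Type*} [Fintype σ] [DecidableEq σ] {n : ℕ}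
    {μ : n.Partition} {e : σ →₀ ℕ} (h : (MvPolynomial.msymm σ K μ).coeff e ≠ 0) :
    μ.parts = e.support.val.map e := by
  rw [MvPolynomial.msymm, MvPolynomial.coeff_sum] at h
  obtain ⟨⟨s, rfl⟩, _, h⟩ := Finset.exists_ne_zero_of_sum_ne_zero h
  change MvPolynomial.coeff e (s.1.map fun i => MvPolynomial.X i).prod ≠ 0 at h
  rw [prod_map_X, MvPolynomial.coeff_monomial] at h
  rw [ofSym_parts, not_not.1 fun h0 => h (if_neg h0)]

theorem isHomogeneous_monomialSymm (μ : YoungDiagram) :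
    IsHomogeneous (monomialSymm μ) μ.card := by
  intro m e he
  have h := parts_eq_of_coeff_msymm_ne_zero he
  have h1 : (μ.rowLens : Multiset ℕ).sum = e.degree := congrArg Multiset.sum h
  have h2 : e.degree = Finsupp.weight 1 e := by rw [Finsupp.degree_eq_weight_one]; rfl
  rw [← h2, ← h1, card_eq_sum_rowLen, Multiset.sum_coe, YoungDiagram.rowLens]
  rfl

/-- The exponents `(λ_1, …, λ_m)`. -/
noncomputable def rowExp (m : ℕ) (lam : YoungDiagram) : Fin m →₀ ℕ :=
  Finsupp.equivFunOnFinite.symm fun i => lam.rowLen i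

theorem rowExp_apply (m : ℕ) (lam : YoungDiagram) (i : Fin m) :
    rowExp m lam i = lam.rowLen i := rfl

theorem rowLen_ne_zero_iff {lam : YoungDiagram} {i : ℕ} :
    lam.rowLen i ≠ 0 ↔ i < lam.colLen 0 := by
  rw [← YoungDiagram.mem_iff_lt_colLen, YoungDiagram.mem_iff_lt_rowLen, Nat.pos_iff_ne_zero]

theorem map_support_rowExp {m : ℕ} {lam : YoungDiagram} (h : lam.colLen 0 ≤ m) :
    (rowExp m lam).support.val.map (rowExp m lam) = lam.rowLens := by
  have h1 : (rowExp m lam).support.map Fin.valEmbedding = Finset.range (lam.colLen 0) := by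
    ext i
    simp only [Finset.mem_map, Finsupp.mem_support_iff, rowExp_apply, rowLen_ne_zero_iff,
      Fin.valEmbedding_apply, Finset.mem_range]
    constructor
    · rintro ⟨j, hj, rfl⟩
      exact hj
    · exact fun hi => ⟨⟨i, hi.trans_le h⟩, hi, rfl⟩
  have h2 := congrArg (fun s => Finset.val s |>.map lam.rowLen) h1
  simp only [Finset.map_val, Multiset.map_map] at h2
  exact h2

theorem rowLens_injective {μ ν : YoungDiagram}
    (h : (μ.rowLens : Multiset ℕ) = (ν.rowLens : Multiset ℕ)) : μ = ν := by
  have h1 : μ.rowLens = ν.rowLens :=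
    (Multiset.coe_eq_coe.1 h).eq_of_sortedGE μ.rowLens_sorted ν.rowLens_sorted
  refine YoungDiagram.equivListRowLens.injective (Subtype.ext ?_)
  exact h1

theorem mapDomain_rowExp {m : ℕ} {lam : YoungDiagram} (h : lam.colLen 0 ≤ m) :
    (rowExp m lam).mapDomain Fin.castSucc = rowExp (m + 1) lam := by
  ext i
  induction i using Fin.lastCases with
  | last =>
    rw [mapDomain_castSucc_last, rowExp_apply, Fin.val_last]
    by_contra h0
    have := rowLen_ne_zero_iff.1 (Ne.symm h0)
    omega
  | cast i =>
    rw [Finsupp.mapDomain_apply (Fin.castSucc_injective m), rowExp_apply, rowExp_apply,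
      Fin.val_castSucc]

/-- The coefficient of the monomial with exponents `ν`. -/
noncomputable def coeffAt (ν : YoungDiagram) : SymFun →ₗ[K] K :=
  (MvPolynomial.lcoeff K (rowExp (ν.colLen 0) ν)).comp (restrictHom (ν.colLen 0)).toLinearMap

theorem coeff_rowExp {m : ℕ} {ν : YoungDiagram} (h : ν.colLen 0 ≤ m) (f : SymFun) :
    (restrict m f).coeff (rowExp m ν) = coeffAt ν f := by
  induction m, h using Nat.le_induction with
  | base => rfl
  | succ m hm ih => rw [← ih, ← theta_restrict m f, coeff_theta, mapDomain_rowExp hm]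

theorem coeffAt_monomialSymm_self (ν : YoungDiagram) : coeffAt ν (monomialSymm ν) = 1 := by
  refine coeff_msymm_of_eq ?_
  rw [map_support_rowExp le_rfl]
  rfl

theorem coeffAt_monomialSymm_of_ne {μ ν : YoungDiagram} (h : μ ≠ ν) :
    coeffAt ν (monomialSymm μ) = 0 := by
  by_contra h0
  have h1 := parts_eq_of_coeff_msymm_ne_zero h0
  rw [map_support_rowExp le_rfl] at h1
  exact h (rowLens_injective h1)

theorem exists_rowLen_eq {a : ℕ →₀ ℕ} (ha : Antitone a) : ∃ ν : YoungDiagram, ∀ i,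
    ν.rowLen i = a i := by
  obtain ⟨μ, hμ⟩ := exists_cols_eq ha
  refine ⟨μ.transpose, fun i => ?_⟩
  rw [YoungDiagram.rowLen_transpose, ← cols_apply, hμ]

/-- A homogeneous symmetric function is determined by its coefficients at weakly decreasing
exponents. -/
theorem eq_zero_of_coeffAt {f : SymFun} {d : ℕ} (hf : IsHomogeneous f d)
    (h : ∀ ν, coeffAt ν f = 0) : f = 0 := by
  refine eq_zero_of_restrict_eq_zero (fun m => (hf m).totalDegree_le) ?_
  ext e
  rw [MvPolynomial.coeff_zero]
  set σ := Tuple.sort fun i => OrderDual.toDual (e i) with hσ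
  have hanti : Antitone (e ∘ σ) := fun i j hij =>
    Tuple.monotone_sort (fun i => OrderDual.toDual (e i)) hij
  let a : ℕ →₀ ℕ := Finsupp.onFinset (Finset.range d)
    (fun i => if hi : i < d then e (σ ⟨i, hi⟩) else 0) (fun i hi => by
      rw [Finset.mem_range]
      by_contra h0
      exact hi (dif_neg h0))
  have ha' : ∀ i, a i = if hi : i < d then e (σ ⟨i, hi⟩) else 0 := fun i => rfl
  have ha : Antitone a := by
    intro i j hij
    rw [ha', ha']
    by_cases hj : j < d
    · rw [dif_pos hj, dif_pos (hij.trans_lt hj)]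
      exact hanti (Fin.mk_le_mk.2 hij)
    · rw [dif_neg hj]
      exact Nat.zero_le _
  obtain ⟨ν, hν⟩ := exists_rowLen_eq ha
  have hνd : ν.colLen 0 ≤ d := by
    by_contra! h0
    refine rowLen_ne_zero_iff.2 h0 ?_
    rw [hν, ha', dif_neg (lt_irrefl d)]
  have he : (rowExp d ν).mapDomain σ = e := by
    ext i
    obtain ⟨j, rfl⟩ := σ.surjective i
    rw [Finsupp.mapDomain_apply σ.injective, rowExp_apply, hν, ha', dif_pos j.2]
  rw [← he, ← restrict_isSymmetric d f σ, MvPolynomial.coeff_rename_mapDomain _ σ.injective,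
    coeff_rowExp hνd, h]

theorem card_eq_sum_range {μ : YoungDiagram} {k : ℕ} (h : μ.colLen 0 ≤ k) :
    μ.card = ∑ i ∈ Finset.range k, μ.rowLen i := by
  rw [card_eq_sum_rowLen]
  refine Finset.sum_subset (Finset.range_subset_range.2 h) fun i _ hi => ?_
  by_contra h0
  exact hi (Finset.mem_range.2 (rowLen_ne_zero_iff.1 h0))

theorem finite_card_eq (d : ℕ) : {ν : YoungDiagram | ν.card = d}.Finite := by
  refine Set.Finite.of_finite_image (f := YoungDiagram.cells)
    ((Finset.finite_toSet (Finset.range d ×ˢ Finset.range d).powerset).subset ?_)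
    fun a _ b _ h => YoungDiagram.ext h
  rintro _ ⟨ν, hν, rfl⟩
  rw [Set.mem_ofPred_eq] at hν
  rw [Finset.mem_coe, Finset.mem_powerset]
  rintro ⟨i, j⟩ hij
  have hij' : (i, j) ∈ ν := hij
  rw [Finset.mem_product, Finset.mem_range, Finset.mem_range]
  have h1 : (Finset.range (ν.colLen j)).image (fun a => (a, j)) ⊆ ν.cells := by
    intro x hx
    obtain ⟨a, ha, rfl⟩ := Finset.mem_image.1 hx
    exact YoungDiagram.mem_iff_lt_colLen.2 (Finset.mem_range.1 ha)
  have h2 : (Finset.range (ν.rowLen i)).image (fun a => (i, a)) ⊆ ν.cells := by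
    intro x hx
    obtain ⟨a, ha, rfl⟩ := Finset.mem_image.1 hx
    exact YoungDiagram.mem_iff_lt_rowLen.2 (Finset.mem_range.1 ha)
  have h3 := Finset.card_le_card h1
  have h4 := Finset.card_le_card h2
  rw [Finset.card_image_of_injective _ (Prod.mk_left_injective j), Finset.card_range] at h3
  rw [Finset.card_image_of_injective _ (Prod.mk_right_injective i), Finset.card_range] at h4
  change _ ≤ ν.card at h3
  change _ ≤ ν.card at h4
  rw [hν] at h3 h4
  exact ⟨(YoungDiagram.mem_iff_lt_colLen.1 hij').trans_le h3,
    (YoungDiagram.mem_iff_lt_rowLen.1 hij').trans_le h4⟩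

theorem card_of_coeffAt_ne_zero {f : SymFun} {d : ℕ} (hf : IsHomogeneous f d) {ν : YoungDiagram}
    (h : coeffAt ν f ≠ 0) : ν.card = d := by
  have h1 : (rowExp (ν.colLen 0) ν).degree = d := degree_of_coeff_ne_zero (hf _) h
  rw [← h1, card_eq_sum_rowLen, Finsupp.degree_eq_sum, Finset.sum_range]
  rfl

theorem isHomogeneous_smul {f : SymFun} {d : ℕ} (hf : IsHomogeneous f d) (c : K) :
    IsHomogeneous (c • f) d := by
  rw [isHomogeneous_iff_scale] at hf ⊢
  rw [map_smul, hf, smul_comm]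

theorem isHomogeneous_sub {f g : SymFun} {d : ℕ} (hf : IsHomogeneous f d)
    (hg : IsHomogeneous g d) : IsHomogeneous (f - g) d := by
  rw [isHomogeneous_iff_scale] at hf hg ⊢
  rw [map_sub, hf, hg, smul_sub]

theorem isHomogeneous_sum {ι : Type*} (S : Finset ι) {f : ι → SymFun} {d : ℕ}
    (hf : ∀ i ∈ S, IsHomogeneous (f i) d) : IsHomogeneous (∑ i ∈ S, f i) d := by
  rw [isHomogeneous_iff_scale, map_sum, Finset.smul_sum]
  exact Finset.sum_congr rfl fun i hi => isHomogeneous_iff_scale.1 (hf i hi)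

theorem eq_sum_coeffAt {f : SymFun} {d : ℕ} (hf : IsHomogeneous f d) :
    f = ∑ ν ∈ (finite_card_eq d).toFinset, coeffAt ν f • monomialSymm ν := by
  rw [← sub_eq_zero]
  refine eq_zero_of_coeffAt (d := d) (isHomogeneous_sub hf (isHomogeneous_sum _ fun ν hν => ?_))
    fun ν => ?_
  · have := (Set.Finite.mem_toFinset _).1 hν
    exact isHomogeneous_smul (this ▸ isHomogeneous_monomialSymm ν) _
  · rw [map_sub, map_sum, sub_eq_zero, Finset.sum_eq_single ν]
    · rw [map_smul, coeffAt_monomialSymm_self, smul_eq_mul, mul_one]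
    · intro μ _ hμ
      rw [map_smul, coeffAt_monomialSymm_of_ne hμ, smul_zero]
    · intro h
      have h0 : coeffAt ν f = 0 := by
        by_contra h0
        exact h ((Set.Finite.mem_toFinset _).2 (card_of_coeffAt_ne_zero hf h0))
      rw [h0, zero_smul, map_zero]

theorem mem_lowerSpan {f : SymFun} {lam : YoungDiagram} (hf : IsHomogeneous f lam.card)
    (h : ∀ ν, coeffAt ν f ≠ 0 → DominanceLT ν lam) : f ∈ lowerSpan lam := by
  rw [eq_sum_coeffAt hf]
  refine Submodule.sum_mem _ fun ν _ => ?_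
  by_cases h0 : coeffAt ν f = 0
  · rw [h0, zero_smul]
    exact Submodule.zero_mem _
  · exact Submodule.smul_mem _ _ (Submodule.subset_span ⟨ν, h ν h0, rfl⟩)

/-! ### Triangularity -/

theorem coeff_skewPoly_succ (μ : YoungDiagram) (m : ℕ) (lam : YoungDiagram)
    (e : Fin (m + 1) →₀ ℕ) : (skewPoly μ (m + 1) lam).coeff e =
      ∑ ν ∈ below lam, stripCoeff (e (Fin.last m)) ν lam * (skewPoly μ m ν).coeff
        (e.comapDomain Fin.castSucc (Fin.castSucc_injective m).injOn) := by
  have h1 := restrict_extract m (e (Fin.last m)) (skewSym μ lam)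
  rw [extract_skewSym] at h1
  change _ = (splitLast m (skewPoly μ (m + 1) lam)).coeff (e (Fin.last m)) at h1
  rw [← coeff_splitLast, ← h1, ← restrictHom_apply, map_sum, MvPolynomial.coeff_sum]
  refine Finset.sum_congr rfl fun ν _ => ?_
  rw [map_smul, MvPolynomial.coeff_smul, smul_eq_mul]
  rfl

theorem rowLen_mono {μ lam : YoungDiagram} (h : μ ≤ lam) (i : ℕ) : μ.rowLen i ≤ lam.rowLen i := by
  by_contra! h0
  exact lt_irrefl _ (YoungDiagram.mem_iff_lt_rowLen.1 (h (YoungDiagram.mem_iff_lt_rowLen.2 h0)))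

/-- The exponents of the monomials in the functions built from the branching coefficients are
dominated by `λ`. -/
theorem dominance_of_coeff_ne_zero {m : ℕ} {lam : YoungDiagram} {e : Fin m →₀ ℕ}
    (h : (skewPoly ⊥ m lam).coeff e ≠ 0) : lam.colLen 0 ≤ m ∧
      ∀ k, (∑ i : Fin m, if (i : ℕ) < k then e i else 0) ≤
        ∑ i ∈ Finset.range k, lam.rowLen i := by
  induction m generalizing lam with
  | zero =>
    rw [skewPoly] at h
    have h0 : stripCoeff 0 ⊥ lam ≠ 0 := fun h0 => h (by rw [h0, map_zero, MvPolynomial.coeff_zero])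
    have h1 := (stripCoeff_ne_zero h0).1
    rw [card_bot] at h1
    have h2 : ⊥ = lam := eq_of_le_of_card_le bot_le (by rw [h1]; exact le_refl _)
    rw [← h2, colLen_bot]
    simp
  | succ m ih =>
    rw [coeff_skewPoly_succ] at h
    obtain ⟨ν, _, h⟩ := Finset.exists_ne_zero_of_sum_ne_zero h
    obtain ⟨h1, h2, h3⟩ := stripCoeff_ne_zero (left_ne_zero_of_mul h)
    obtain ⟨h4, h5⟩ := ih (right_ne_zero_of_mul h)
    have h6 : lam.colLen 0 ≤ m + 1 := (h3 0).trans (by omega)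
    refine ⟨h6, fun k => ?_⟩
    rw [Fin.sum_univ_castSucc]
    simp only [Fin.val_castSucc, Fin.val_last]
    have h7 := h5 k
    simp only [Finsupp.comapDomain_apply] at h7
    split_ifs with hk
    · rw [← card_eq_sum_range (h4.trans hk.le)] at h7
      rw [← card_eq_sum_range (h6.trans hk), h1]
      exact Nat.add_le_add_right h7 _
    · rw [add_zero]
      exact h7.trans (Finset.sum_le_sum fun i _ => rowLen_mono h2 i)

/-- The diagram of the first `m` rows. -/
def firstRows (m : ℕ) (lam : YoungDiagram) : YoungDiagram where
  cells := lam.cells.filter fun x => x.1 < m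
  isLowerSet := by
    rintro ⟨i, j⟩ ⟨i', j'⟩ ⟨hi, hj⟩ h
    rw [Finset.mem_coe, Finset.mem_filter] at h ⊢
    exact ⟨lam.up_left_mem hi hj h.1, lt_of_le_of_lt hi h.2⟩

theorem mem_firstRows {m i j : ℕ} {lam : YoungDiagram} :
    (i, j) ∈ firstRows m lam ↔ (i, j) ∈ lam ∧ i < m := by
  change (i, j) ∈ lam.cells.filter _ ↔ _
  rw [Finset.mem_filter]
  rfl

theorem colLen_firstRows (m : ℕ) (lam : YoungDiagram) (j : ℕ) :
    (firstRows m lam).colLen j = min (lam.colLen j) m := by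
  refine eq_of_forall_lt_iff fun i => ?_
  rw [← YoungDiagram.mem_iff_lt_colLen, mem_firstRows, YoungDiagram.mem_iff_lt_colLen, lt_min_iff]

theorem rowLen_firstRows {m i : ℕ} (lam : YoungDiagram) (hi : i < m) :
    (firstRows m lam).rowLen i = lam.rowLen i := by
  refine eq_of_forall_lt_iff fun j => ?_
  rw [← YoungDiagram.mem_iff_lt_rowLen, mem_firstRows, YoungDiagram.mem_iff_lt_rowLen]
  exact and_iff_left hi

theorem firstRows_le (m : ℕ) (lam : YoungDiagram) : firstRows m lam ≤ lam := by
  rintro ⟨i, j⟩ h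
  exact (mem_firstRows.1 h).1

theorem le_firstRows {m : ℕ} {ν lam : YoungDiagram} (h : ν ≤ lam) (hν : ν.colLen 0 ≤ m) :
    ν ≤ firstRows m lam := by
  rintro ⟨i, j⟩ hij
  have h1 := YoungDiagram.mem_iff_lt_colLen.1 (ν.up_left_mem le_rfl (Nat.zero_le j) hij)
  exact mem_firstRows.2 ⟨h hij, h1.trans_le hν⟩

theorem card_firstRows {m : ℕ} {lam : YoungDiagram} (h : lam.colLen 0 ≤ m + 1) :
    lam.card = (firstRows m lam).card + lam.rowLen m := by
  have h1 : (firstRows m lam).colLen 0 ≤ m := by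
    rw [colLen_firstRows]
    exact min_le_right _ _
  rw [card_eq_sum_range h, card_eq_sum_range h1, Finset.sum_range_succ]
  congr 1
  exact Finset.sum_congr rfl fun i hi => (rowLen_firstRows lam (Finset.mem_range.1 hi)).symm

theorem stripCoeff_firstRows {m : ℕ} {lam : YoungDiagram} (h : lam.colLen 0 ≤ m + 1) :
    stripCoeff (lam.rowLen m) (firstRows m lam) lam = 1 := by
  have hcol : ∀ j, lam.colLen j ≤ m + 1 := fun j => (lam.colLen_anti 0 j (Nat.zero_le j)).trans h
  rw [stripCoeff, if_pos (card_firstRows h), colBranch_of_le (cols_le_iff.2 (firstRows_le m lam))]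
  · rw [branch]
    refine Finset.prod_eq_one fun j hj => ?_
    rw [mem_support_sub, cols_apply, cols_apply, colLen_firstRows] at hj
    -- every column to the left of a column which loses a box loses a box as well
    have hempty : Finset.range j \ (cols lam - cols (firstRows m lam)).support = ∅ := by
      refine Finset.sdiff_eq_empty_iff_subset.2 fun i hi => ?_
      rw [mem_support_sub, cols_apply, cols_apply, colLen_firstRows]
      have := lam.colLen_anti i j (Finset.mem_range.1 hi).le
      omega
    rw [hempty, Finset.prod_empty]
  · intro i
    rw [cols_apply, cols_apply, colLen_firstRows]
    have := hcol i
    omega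

theorem coeff_rowExp_skewPoly {m : ℕ} {lam : YoungDiagram} (h : lam.colLen 0 ≤ m) :
    (skewPoly ⊥ m lam).coeff (rowExp m lam) = 1 := by
  induction m generalizing lam with
  | zero =>
    have h2 : ⊥ = lam := eq_of_le_of_card_le bot_le (by rw [card_eq_sum_range h]; simp)
    rw [skewPoly, ← h2, stripCoeff_zero_self, Subsingleton.elim (rowExp 0 ⊥) 0,
      MvPolynomial.coeff_zero_C]
  | succ m ih =>
    have hcol : (firstRows m lam).colLen 0 ≤ m := by
      rw [colLen_firstRows]
      exact min_le_right _ _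
    rw [coeff_skewPoly_succ, Finset.sum_eq_single (firstRows m lam)]
    · have he : (rowExp (m + 1) lam).comapDomain Fin.castSucc (Fin.castSucc_injective m).injOn =
          rowExp m (firstRows m lam) := by
        ext i
        rw [Finsupp.comapDomain_apply, rowExp_apply, rowExp_apply, Fin.val_castSucc,
          rowLen_firstRows lam i.2]
      rw [he, ih hcol, rowExp_apply, Fin.val_last, stripCoeff_firstRows h, mul_one]
    · intro ν _ hne
      by_contra h0
      obtain ⟨h1, h2, _⟩ := stripCoeff_ne_zero (left_ne_zero_of_mul h0)
      have h3 := (dominance_of_coeff_ne_zero (right_ne_zero_of_mul h0)).1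
      have h4 := card_firstRows h
      rw [rowExp_apply, Fin.val_last] at h1
      exact hne (eq_of_le_of_card_le (le_firstRows h2 h3) (by omega))
    · exact fun h0 => absurd (mem_below.2 (firstRows_le m lam)) h0

theorem coeffAt_skewSym_self (lam : YoungDiagram) : coeffAt lam (skewSym ⊥ lam) = 1 :=
  coeff_rowExp_skewPoly le_rfl

theorem dominance_of_coeffAt_ne_zero {ν lam : YoungDiagram}
    (h : coeffAt ν (skewSym ⊥ lam) ≠ 0) (k : ℕ) :
    ∑ i ∈ Finset.range k, ν.rowLen i ≤ ∑ i ∈ Finset.range k, lam.rowLen i := by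
  refine le_trans (le_of_eq ?_) ((dominance_of_coeff_ne_zero
    (show (skewPoly ⊥ (ν.colLen 0) lam).coeff (rowExp (ν.colLen 0) ν) ≠ 0 from h)).2 k)
  have h1 := Finset.sum_range (n := ν.colLen 0) (fun i => if i < k then ν.rowLen i else 0)
  refine Eq.trans ?_ h1
  rw [← Finset.sum_filter]
  symm
  refine Finset.sum_subset (fun i hi => ?_) fun i hi hi' => ?_
  · exact Finset.mem_range.2 (Finset.mem_filter.1 hi).2
  · by_contra h0
    exact hi' (Finset.mem_filter.2 ⟨Finset.mem_range.2 (rowLen_ne_zero_iff.1 h0),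
      Finset.mem_range.1 hi⟩)

theorem skewSym_sub_mem_lowerSpan (lam : YoungDiagram) :
    skewSym ⊥ lam - monomialSymm lam ∈ lowerSpan lam := by
  refine mem_lowerSpan (isHomogeneous_sub (isHomogeneous_skewSym_bot lam)
    (isHomogeneous_monomialSymm lam)) fun ν h => ?_
  rw [map_sub] at h
  by_cases hν : ν = lam
  · rw [hν, coeffAt_skewSym_self, coeffAt_monomialSymm_self, sub_self] at h
    exact absurd rfl h
  · rw [coeffAt_monomialSymm_of_ne (Ne.symm hν), sub_zero] at h
    exact ⟨hν, card_of_coeffAt_ne_zero (isHomogeneous_skewSym_bot lam) h,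
      dominance_of_coeffAt_ne_zero h⟩

theorem isMacdonald_skewSym (lam : YoungDiagram) : IsMacdonald lam (skewSym ⊥ lam) :=
  ⟨stableE_iff.2 (macdonaldE_skewSym lam).symm, skewSym_sub_mem_lowerSpan lam⟩

theorem skewSym_bot_ne_zero (lam : YoungDiagram) : skewSym ⊥ lam ≠ 0 := fun h => by
  have := coeffAt_skewSym_self lam
  rw [h, map_zero] at this
  exact zero_ne_one this

theorem linearIndependent_skewSym : LinearIndependent K (skewSym ⊥) :=
  Module.End.eigenvectors_linearIndependent' macdonaldE eigenvalue eigenvalue_injective _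
    fun lam => ⟨Module.End.mem_eigenspace_iff.2 (macdonaldE_skewSym lam), skewSym_bot_ne_zero lam⟩

/-- The sum of the partial sums, a linear extension of the dominance order on partitions of the
same size. -/
def dominanceRank (μ : YoungDiagram) : ℕ :=
  ∑ k ∈ Finset.range (μ.card + 1), ∑ i ∈ Finset.range k, μ.rowLen i

theorem dominanceRank_lt {μ lam : YoungDiagram} (h : DominanceLT μ lam) :
    dominanceRank μ < dominanceRank lam := by
  obtain ⟨hne, hc, hle⟩ := h
  rw [dominanceRank, dominanceRank, hc]
  refine Finset.sum_lt_sum (fun k _ => hle k) ?_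
  by_contra! h0
  have heq : ∀ k ∈ Finset.range (lam.card + 1), ∑ i ∈ Finset.range k, μ.rowLen i =
      ∑ i ∈ Finset.range k, lam.rowLen i := fun k hk => le_antisymm (hle k) (h0 k hk)
  have hcol : ∀ ν : YoungDiagram, ν.colLen 0 ≤ ν.card := fun ν => by
    rw [card_eq_degree]
    exact Finsupp.le_degree 0 (cols ν)
  have hrow : ∀ i, μ.rowLen i = lam.rowLen i := by
    intro i
    by_cases hi : i < lam.card
    · have h1 := heq (i + 1) (Finset.mem_range.2 (by omega))
      have h2 := heq i (Finset.mem_range.2 (by omega))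
      rw [Finset.sum_range_succ, Finset.sum_range_succ, h2] at h1
      exact add_left_cancel h1
    · have h1 : ∀ ν : YoungDiagram, ν.card = lam.card → ν.rowLen i = 0 := by
        intro ν hν
        by_contra h1
        have := rowLen_ne_zero_iff.1 h1
        have := hcol ν
        omega
      rw [h1 μ hc, h1 lam rfl]
  refine hne (YoungDiagram.ext (Finset.ext fun x => ?_))
  obtain ⟨i, j⟩ := x
  rw [YoungDiagram.mem_cells, YoungDiagram.mem_cells, YoungDiagram.mem_iff_lt_rowLen,
    YoungDiagram.mem_iff_lt_rowLen, hrow]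

/-- Inversion of the triangular system `skewSym_sub_mem_lowerSpan`. -/
theorem monomialSymm_mem_span (μ : YoungDiagram) : monomialSymm μ ∈
    Submodule.span K (skewSym ⊥ '' {ν | dominanceRank ν ≤ dominanceRank μ}) := by
  induction hn : dominanceRank μ using Nat.strong_induction_on generalizing μ with
  | _ n ih =>
  have h1 : lowerSpan μ ≤ Submodule.span K (skewSym ⊥ '' {ν | dominanceRank ν ≤ n}) := by
    refine Submodule.span_le.2 ?_
    rintro _ ⟨ν, hν, rfl⟩
    have h2 : dominanceRank ν < n := hn ▸ dominanceRank_lt hν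
    exact Submodule.span_mono (Set.image_mono fun κ hκ => le_trans hκ h2.le) (ih _ h2 ν rfl)
  have h3 : monomialSymm μ = skewSym ⊥ μ - (skewSym ⊥ μ - monomialSymm μ) := by
    rw [sub_sub_cancel]
  rw [h3]
  exact Submodule.sub_mem _ (Submodule.subset_span ⟨μ, hn.le, rfl⟩)
    (h1 (skewSym_sub_mem_lowerSpan μ))

/-- The span of the `m_ν`, `ν < λ`, is contained in a sum of eigenspaces of `E` for eigenvalues other
than that of `λ`. -/
theorem eq_zero_of_mem_lowerSpan {f : SymFun} {lam : YoungDiagram} (hf : f ∈ lowerSpan lam)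
    (hE : macdonaldE f = eigenvalue lam • f) : f = 0 := by
  have h1 : lowerSpan lam ≤ ⨆ a ≠ eigenvalue lam, Module.End.eigenspace macdonaldE a := by
    refine Submodule.span_le.2 ?_
    rintro _ ⟨ν, hν, rfl⟩
    refine Submodule.span_le.2 ?_ (monomialSymm_mem_span ν)
    rintro _ ⟨κ, hκ, rfl⟩
    have hne : eigenvalue κ ≠ eigenvalue lam := fun h => by
      have h2 := dominanceRank_lt hν
      rw [eigenvalue_injective h] at hκ
      exact absurd hκ (not_le.2 h2)
    exact Submodule.mem_iSup_of_mem _ (Submodule.mem_iSup_of_mem hne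
      (Module.End.mem_eigenspace_iff.2 (macdonaldE_skewSym κ)))
  exact Submodule.disjoint_def.1
    (Module.End.eigenspaces_iSupIndep macdonaldE (eigenvalue lam)) f
    (Module.End.mem_eigenspace_iff.2 hE) (h1 hf)

theorem isMacdonald_iff {lam : YoungDiagram} {f : SymFun} :
    IsMacdonald lam f ↔ f = skewSym ⊥ lam := by
  refine ⟨fun ⟨h1, h2⟩ => ?_, fun h => h ▸ isMacdonald_skewSym lam⟩
  rw [← sub_eq_zero]
  refine eq_zero_of_mem_lowerSpan (lam := lam) ?_ ?_
  · have h3 := Submodule.sub_mem _ h2 (skewSym_sub_mem_lowerSpan lam)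
    have h4 : f - skewSym ⊥ lam =
        (f - monomialSymm lam) - (skewSym ⊥ lam - monomialSymm lam) := by abel
    rw [h4]
    exact h3
  · rw [map_sub, ← stableE_iff.1 h1, macdonaldE_skewSym, smul_sub]

theorem existsUnique_isMacdonald (lam : YoungDiagram) : ∃! f, IsMacdonald lam f :=
  ⟨_, isMacdonald_skewSym lam, fun _ h => isMacdonald_iff.1 h⟩

theorem macdonaldP_eq (lam : YoungDiagram) : macdonaldP lam = skewSym ⊥ lam :=
  isMacdonald_iff.1 (Classical.epsilon_spec (existsUnique_isMacdonald lam).exists)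

/-! ### The coefficient of the one-row monomial function -/

theorem rowLen_rowShape_zero (r : ℕ) : (rowShape r).rowLen 0 = r :=
  YoungDiagram.rowLen_ofRowLens (w := [r]) ⟨0, by simp⟩

theorem colLen_rowShape_le (r : ℕ) : (rowShape r).colLen 0 ≤ 1 := by
  by_contra! h
  have h1 := YoungDiagram.mem_iff_lt_colLen.2 h
  rw [rowShape, YoungDiagram.mem_ofRowLens] at h1
  obtain ⟨h2, _⟩ := h1
  simp at h2

theorem card_rowShape (r : ℕ) : (rowShape r).card = r := by
  rw [card_eq_sum_range (colLen_rowShape_le r), Finset.sum_range_one, rowLen_rowShape_zero]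

theorem coeffAt_rowShape (r : ℕ) (f : SymFun) : coeffAt (rowShape r) f = rowCoeff r f := by
  rw [← coeff_rowExp (colLen_rowShape_le r), restrict_one_coeff, rowExp_apply, Fin.val_zero,
    rowLen_rowShape_zero]

theorem rowCoeff_of_mem_lowerSpan {r : ℕ} {f : SymFun} (h : f ∈ lowerSpan (rowShape r)) :
    rowCoeff r f = 0 := by
  rw [← coeffAt_rowShape]
  refine (Submodule.span_le (p := LinearMap.ker (coeffAt (rowShape r)))).2 ?_ h
  rintro _ ⟨ν, hν, rfl⟩
  exact coeffAt_monomialSymm_of_ne hν.1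

theorem sub_mem_lowerSpan_rowShape {r : ℕ} {f : SymFun} (hf : IsHomogeneous f r) (c : K) :
    f - c • monomialSymm (rowShape r) ∈ lowerSpan (rowShape r) ↔ rowCoeff r f = c := by
  have h0 : rowCoeff r (monomialSymm (rowShape r)) = 1 := by
    rw [← coeffAt_rowShape, coeffAt_monomialSymm_self]
  constructor
  · intro h
    have h1 := rowCoeff_of_mem_lowerSpan h
    rw [map_sub, map_smul, h0, smul_eq_mul, mul_one] at h1
    exact sub_eq_zero.1 h1
  · intro h
    have hm := isHomogeneous_monomialSymm (rowShape r)
    rw [card_rowShape] at hm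
    have hhom : IsHomogeneous (f - c • monomialSymm (rowShape r)) r :=
      isHomogeneous_sub hf (isHomogeneous_smul hm c)
    refine mem_lowerSpan (by rwa [card_rowShape]) fun ν hν => ?_
    have hcard := card_of_coeffAt_ne_zero hhom hν
    refine ⟨?_, by rw [hcard, card_rowShape], fun k => ?_⟩
    · rintro rfl
      rw [coeffAt_rowShape, map_sub, map_smul, h0, h, smul_eq_mul, mul_one, sub_self] at hν
      exact hν rfl
    · cases k with
      | zero => simp
      | succ k =>
        have h2 : (rowShape r).colLen 0 ≤ k + 1 := (colLen_rowShape_le r).trans (by omega)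
        rw [← card_eq_sum_range h2, card_rowShape, ← hcard,
          card_eq_sum_range (le_max_left (ν.colLen 0) (k + 1))]
        exact Finset.sum_le_sum_of_subset (Finset.range_subset_range.2 (le_max_right _ _))

/-! ### The coproduct and the added variable -/

section Contraction

variable {M N : Type*} [AddCommMonoid M] [Module K M] [AddCommMonoid N] [Module K N]

/-- The contraction `a ⊗ b ↦ φ a • b` of the first tensor factor. -/
noncomputable def contract (φ : SymFun →ₗ[K] K) : SymFun ⊗[K] M →ₗ[K] M :=
  (TensorProduct.lid K M).toLinearMap.comp (φ.rTensor M)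

theorem contract_tmul (φ : SymFun →ₗ[K] K) (a : SymFun) (b : M) :
    contract φ (a ⊗ₜ[K] b) = φ a • b := by
  rw [contract, LinearMap.comp_apply, LinearMap.rTensor_tmul]
  exact TensorProduct.lid_tmul _ _

theorem contract_lTensor (φ : SymFun →ₗ[K] K) (g : M →ₗ[K] N) (z : SymFun ⊗[K] M) :
    contract φ (g.lTensor SymFun z) = g (contract φ z) := by
  induction z using TensorProduct.induction_on with
  | zero => simp only [map_zero]
  | tmul a b => rw [LinearMap.lTensor_tmul, contract_tmul, contract_tmul, map_smul]
  | add x y hx hy => simp only [map_add, hx, hy]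

theorem ext_of_contract {z w : SymFun ⊗[K] M} (h : ∀ φ, contract φ z = contract φ w) : z = w := by
  classical
  let b := Module.Basis.ofVectorSpace K SymFun
  refine (TensorProduct.equivFinsuppOfBasisLeft b).injective (Finsupp.ext fun i => ?_)
  have h1 : ∀ z : SymFun ⊗[K] M, TensorProduct.equivFinsuppOfBasisLeft b z i =
      contract (b.coord i) z := by
    intro z
    induction z using TensorProduct.induction_on with
    | zero => simp
    | tmul a c =>
      rw [contract_tmul, TensorProduct.equivFinsuppOfBasisLeft_apply_tmul_apply,
        Module.Basis.coord_apply]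
    | add x y hx hy => rw [map_add, Finsupp.add_apply, hx, hy, map_add]
  rw [h1, h1, h]

end Contraction

/-- The analogue of `ext_of_extract` in the second factor of a tensor product. -/
theorem tensor_ext_of_extract {z w : SymFun ⊗[K] SymFun}
    (h : ∀ k, (extract (k + 1)).lTensor SymFun z = (extract (k + 1)).lTensor SymFun w)
    (h0 : constTerm.toLinearMap.lTensor SymFun z = constTerm.toLinearMap.lTensor SymFun w) :
    z = w := by
  refine ext_of_contract fun φ => ext_of_extract (fun k => ?_) ?_
  · rw [← contract_lTensor, h, contract_lTensor]
  · have h1 := congrArg (contract φ) h0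
    rwa [contract_lTensor, contract_lTensor] at h1

section RightFactor

variable {R A : Type*} [CommSemiring R] [CommSemiring A] [Algebra R A] (φ : A →ₐ[R] Polynomial A)

/-- The morphism `a ⊗ b ↦ a ⊗ φ b` of algebras, with values in polynomials. -/
noncomputable def polyRight : A ⊗[R] A →ₐ[R] Polynomial (A ⊗[R] A) :=
  Algebra.TensorProduct.lift
    ((Polynomial.CAlgHom (R := R) (A := A ⊗[R] A)).comp Algebra.TensorProduct.includeLeft)
    ((Polynomial.mapAlgHom (Algebra.TensorProduct.includeRight : A →ₐ[R] A ⊗[R] A)).comp φ)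
    fun _ _ => Commute.all _ _

theorem polyRight_tmul (a b : A) : polyRight φ (a ⊗ₜ[R] b) =
    Polynomial.C (a ⊗ₜ[R] 1) *
      (φ b).map (Algebra.TensorProduct.includeRight : A →ₐ[R] A ⊗[R] A).toRingHom :=
  Algebra.TensorProduct.lift_tmul _ _ _ _ _

theorem coeff_polyRight (k : ℕ) (z : A ⊗[R] A) : (polyRight φ z).coeff k =
    (((Polynomial.lcoeff A k).restrictScalars R).comp φ.toLinearMap).lTensor A z := by
  induction z using TensorProduct.induction_on with
  | zero => rw [map_zero, map_zero, Polynomial.coeff_zero]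
  | tmul a b =>
    rw [polyRight_tmul, Polynomial.coeff_C_mul, Polynomial.coeff_map, LinearMap.lTensor_tmul]
    change a ⊗ₜ[R] 1 * 1 ⊗ₜ[R] (φ b).coeff k = _
    rw [Algebra.TensorProduct.tmul_mul_tmul, mul_one, one_mul]
    rfl
  | add x y hx hy => rw [map_add, map_add, Polynomial.coeff_add, hx, hy]

theorem polyRight_primitive {p : A} {n : ℕ}
    (h : φ p = Polynomial.C p + Polynomial.X ^ n) :
    polyRight φ (p ⊗ₜ[R] 1 + 1 ⊗ₜ[R] p) =
      Polynomial.C (p ⊗ₜ[R] 1 + 1 ⊗ₜ[R] p) + Polynomial.X ^ n := by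
  rw [map_add, polyRight_tmul, polyRight_tmul, h, map_one, Polynomial.map_one, mul_one,
    Polynomial.map_add, Polynomial.map_C, Polynomial.map_pow, Polynomial.map_X, Polynomial.C_add,
    ← Algebra.TensorProduct.one_def, Polynomial.C_1, one_mul, add_assoc]
  rfl

theorem eq_sum_of_sum_tmul_eq {M ι : Type*} [AddCommMonoid M] [Module R M] (S : Finset ι)
    {a : ι → M} {c : ι → R} {b : M} (h : ∑ i ∈ S, a i ⊗ₜ[R] c i = b ⊗ₜ[R] (1 : R)) :
    b = ∑ i ∈ S, c i • a i := by
  have h1 := congrArg (TensorProduct.rid R M) h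
  rw [map_sum, TensorProduct.rid_tmul, one_smul] at h1
  exact h1.symm

end RightFactor

theorem lTensor_extract_coproduct (k : ℕ) (f : SymFun) :
    (extract k).lTensor SymFun (coproduct f) = coproduct (extract k f) := by
  have h : (polyRight addVar).comp coproduct = (Polynomial.mapAlgHom coproduct).comp addVar := by
    refine symFun_algHom_ext (B := Polynomial (SymFun ⊗[K] SymFun)) fun s => ?_
    rw [AlgHom.comp_apply, AlgHom.comp_apply, addVar_powerSum, coproduct_powerSum,
      polyRight_primitive addVar (addVar_powerSum s), Polynomial.coe_mapAlgHom,
      Polynomial.map_add, Polynomial.map_C, Polynomial.map_pow, Polynomial.map_X]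
    change _ = Polynomial.C (coproduct (powerSum s)) + _
    rw [coproduct_powerSum]
  have h1 := congrArg (fun p => Polynomial.coeff p k) (AlgHom.congr_fun h f)
  refine (coeff_polyRight addVar k (coproduct f)).symm.trans (h1.trans ?_)
  rw [AlgHom.comp_apply, Polynomial.coe_mapAlgHom, Polynomial.coeff_map, coeff_addVar]
  rfl

theorem lTensor_constTerm_coproduct (f : SymFun) :
    constTerm.toLinearMap.lTensor SymFun (coproduct f) = f ⊗ₜ[K] (1 : K) := by
  have h : (Algebra.TensorProduct.map (AlgHom.id K SymFun) constTerm).comp coproduct =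
      (Algebra.TensorProduct.includeLeft : SymFun →ₐ[K] SymFun ⊗[K] K) := by
    refine symFun_algHom_ext fun s => ?_
    rw [AlgHom.comp_apply, coproduct_powerSum, map_add, Algebra.TensorProduct.map_tmul,
      Algebra.TensorProduct.map_tmul, constTerm_powerSum, TensorProduct.tmul_zero, add_zero,
      map_one]
    rfl
  exact AlgHom.congr_fun h f

/-- The coefficients in the added variable are the coefficients of the coproduct along the one-row
coefficients. -/
theorem lTensor_rowCoeff_coproduct (k : ℕ) (f : SymFun) :
    (rowCoeff k).lTensor SymFun (coproduct f) = extract k f ⊗ₜ[K] (1 : K) := by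
  rw [rowCoeff, LinearMap.lTensor_comp_apply, lTensor_extract_coproduct,
    lTensor_constTerm_coproduct]

theorem coproduct_skewSym (μ lam : YoungDiagram) : coproduct (skewSym μ lam) =
    ∑ ν ∈ below lam, skewSym μ ν ⊗ₜ[K] skewSym ν lam := by
  induction hn : lam.card using Nat.strong_induction_on generalizing lam with
  | _ n ih =>
  refine tensor_ext_of_extract (fun k => ?_) ?_
  · rw [lTensor_extract_coproduct, extract_skewSym, map_sum, map_sum]
    simp only [LinearMap.lTensor_tmul, extract_skewSym, TensorProduct.tmul_sum,
      TensorProduct.tmul_smul, map_smul]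
    rw [Finset.sum_comm]
    refine Finset.sum_congr rfl fun κ hκ => ?_
    rw [← Finset.smul_sum]
    by_cases h0 : stripCoeff (k + 1) κ lam = 0
    · rw [h0, zero_smul, zero_smul]
    · have hc := (stripCoeff_ne_zero h0).1
      rw [ih κ.card (by omega) κ rfl]
      congr 1
      refine Finset.sum_subset
        (fun ν hν => mem_below.2 ((mem_below.1 hν).trans (mem_below.1 hκ))) fun ν _ hν => ?_
      rw [skewSym_eq_zero fun h => hν (mem_below.2 h), TensorProduct.tmul_zero]
  · rw [lTensor_constTerm_coproduct, map_sum, Finset.sum_eq_single lam]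
    · rw [LinearMap.lTensor_tmul, AlgHom.toLinearMap_apply, constTerm_skewSym,
        stripCoeff_zero_self]
    · intro ν _ hν
      rw [LinearMap.lTensor_tmul, AlgHom.toLinearMap_apply, constTerm_skewSym,
        stripCoeff_zero_of_ne hν, TensorProduct.tmul_zero]
    · exact fun h => absurd (mem_below.2 le_rfl) h

/-! ### Skew Macdonald polynomials -/

theorem sum_Iic {M : Type*} [AddCommMonoid M] (lam : YoungDiagram) (f : YoungDiagram → M) :
    ∑ μ : Set.Iic lam, f μ = ∑ μ ∈ below lam, f μ := by
  refine (Finset.sum_subtype (below lam) (p := fun μ => μ ∈ Set.Iic lam) (fun μ => ?_) f).symm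
  rw [mem_below]
  rfl

theorem sum_Icc {M : Type*} [AddCommMonoid M] (μ lam : YoungDiagram) (f : YoungDiagram → M)
    (hf : ∀ ν, ¬ μ ≤ ν → f ν = 0) :
    ∑ ν : Set.Icc μ lam, f ν = ∑ ν ∈ below lam, f ν := by
  classical
  rw [← Finset.sum_filter_of_ne (p := fun ν => μ ≤ ν)
    (fun ν _ h => not_not.1 fun h0 => h (hf ν h0))]
  refine (Finset.sum_subtype _ (p := fun ν => ν ∈ Set.Icc μ lam) (fun ν => ?_) f).symm
  rw [Finset.mem_filter, mem_below]
  exact and_comm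

/-- The family of the functions built from the branching coefficients. -/
noncomputable def skewFamily : SkewFamily := fun μ lam _ => skewSym μ lam

theorem isSkewMacdonald_skewFamily : IsSkewMacdonald skewFamily := by
  intro lam
  simp only [macdonaldP_eq, skewFamily]
  rw [coproduct_skewSym, sum_Iic lam fun μ => skewSym ⊥ μ ⊗ₜ[K] skewSym μ lam]

theorem exists_dual (μ : YoungDiagram) : ∃ φ : SymFun →ₗ[K] K, φ (skewSym ⊥ μ) = 1 ∧
    ∀ ν, ν ≠ μ → φ (skewSym ⊥ ν) = 0 := by
  have hli := linearIndependent_skewSym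
  obtain ⟨φ, hφ⟩ := LinearMap.exists_extend ((Finsupp.lapply μ).comp hli.repr)
  have h1 : ∀ ν, φ (skewSym ⊥ ν) = Finsupp.single ν (1 : K) μ := by
    intro ν
    have h2 := LinearMap.congr_fun hφ ⟨skewSym ⊥ ν, Submodule.subset_span ⟨ν, rfl⟩⟩
    refine h2.trans ?_
    change hli.repr _ μ = _
    rw [hli.repr_eq_single ν _ rfl]
  refine ⟨φ, ?_, fun ν hν => ?_⟩
  · rw [h1, Finsupp.single_eq_same]
  · rw [h1, Finsupp.single_eq_of_ne hν.symm]

theorem isSkewMacdonald_iff {S : SkewFamily} : IsSkewMacdonald S ↔ S = skewFamily := by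
  refine ⟨fun hS => ?_, fun h => h ▸ isSkewMacdonald_skewFamily⟩
  have h2 : ∀ (S : SkewFamily), IsSkewMacdonald S → ∀ (μ lam) (h : μ ≤ lam)
      (φ : SymFun →ₗ[K] K), φ (skewSym ⊥ μ) = 1 → (∀ ν, ν ≠ μ → φ (skewSym ⊥ ν) = 0) →
      contract φ (coproduct (macdonaldP lam)) = S μ lam h := by
    intro S hS μ lam h φ h1 h0
    rw [hS lam, map_sum, Finset.sum_eq_single ⟨μ, h⟩]
    · rw [contract_tmul, macdonaldP_eq, h1, one_smul]
    · rintro ⟨ν, hν⟩ _ hne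
      rw [contract_tmul, macdonaldP_eq, h0 ν (fun h => hne (Subtype.ext h)), zero_smul]
    · exact fun h => absurd (Finset.mem_univ _) h
  funext μ lam h
  obtain ⟨φ, h1, h0⟩ := exists_dual μ
  rw [← h2 S hS μ lam h φ h1 h0, h2 _ isSkewMacdonald_skewFamily μ lam h φ h1 h0]

theorem skewMacdonaldP_eq : skewMacdonaldP = skewFamily :=
  isSkewMacdonald_iff.1 (Classical.epsilon_spec ⟨_, isSkewMacdonald_skewFamily⟩)

/-! ### The characterization -/

theorem stripCoeff_skewSize {μ lam : YoungDiagram} (h : μ ≤ lam) :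
    stripCoeff (skewSize μ lam) μ lam = colBranch (cols μ) (cols lam) := by
  have := card_mono h
  rw [stripCoeff, if_pos (by rw [skewSize]; omega)]

theorem rowCoeff_eq_zero {f : SymFun} {d k : ℕ} (hf : IsHomogeneous f d) (hk : k ≠ d) :
    rowCoeff k f = 0 := by
  rw [rowCoeff_eq_coeff]
  by_contra h
  have := degree_of_coeff_ne_zero (hf 1) h
  rw [Finsupp.degree_single] at this
  exact hk this

theorem skewFamily_spec : HomogeneousFamily skewFamily ∧ CoproductFormula skewFamily ∧
    VanishingCoefficient skewFamily ∧ StripCoefficient skewFamily := by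
  refine ⟨fun μ lam _ => isHomogeneous_skewSym μ lam, fun μ lam _ => ?_, fun μ lam h hs => ?_,
    fun μ lam h hs => ?_⟩
  · simp only [skewFamily]
    rw [coproduct_skewSym, sum_Icc μ lam fun ν => skewSym μ ν ⊗ₜ[K] skewSym ν lam]
    intro ν hν
    rw [skewSym_eq_zero hν, TensorProduct.zero_tmul]
  · have h1 := (sub_mem_lowerSpan_rowShape (isHomogeneous_skewSym μ lam) 0).2 (by
      rw [rowCoeff_skewSym]
      change stripCoeff (skewSize μ lam) μ lam = 0
      rw [stripCoeff_skewSize h]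
      exact colBranch_of_not fun h0 => hs (isHorizontalStrip_iff.2 h0))
    rwa [zero_smul, sub_zero] at h1
  · exact (sub_mem_lowerSpan_rowShape (isHomogeneous_skewSym μ lam) _).2 (by
      rw [rowCoeff_skewSym]
      change stripCoeff (skewSize μ lam) μ lam = _
      rw [stripCoeff_skewSize h, psi_eq_colBranch h hs])

theorem rowCoeff_of_spec {Q : SkewFamily} (h1 : HomogeneousFamily Q)
    (h3 : VanishingCoefficient Q) (h4 : StripCoefficient Q) {μ lam : YoungDiagram} (h : μ ≤ lam)
    (k : ℕ) : rowCoeff k (Q μ lam h) = stripCoeff k μ lam := by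
  by_cases hk : k = skewSize μ lam
  · rw [hk, stripCoeff_skewSize h]
    by_cases hs : IsHorizontalStrip μ lam
    · rw [← psi_eq_colBranch h hs]
      exact (sub_mem_lowerSpan_rowShape (h1 μ lam h) _).1 (h4 μ lam h hs)
    · rw [rowCoeff_of_mem_lowerSpan (h3 μ lam h hs)]
      exact (colBranch_of_not fun h0 => hs (isHorizontalStrip_iff.2 h0)).symm
  · rw [rowCoeff_eq_zero (h1 μ lam h) hk]
    have := card_mono h
    exact (if_neg fun h0 => hk (by rw [skewSize]; omega)).symm

/-- The last two properties give the coefficient of `m_r` in all the members of the family, hence the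
second one gives `extract k` of `Q_{λ/μ}` in terms of the `Q_{ν/μ}` with `ν` smaller than `λ`. -/
theorem eq_skewFamily_of_spec {Q : SkewFamily} (h1 : HomogeneousFamily Q)
    (h2 : CoproductFormula Q) (h3 : VanishingCoefficient Q) (h4 : StripCoefficient Q) :
    Q = skewFamily := by
  funext μ lam h
  induction hn : lam.card using Nat.strong_induction_on generalizing lam with
  | _ n ih =>
  refine ext_of_extract (fun k => ?_) ?_
  · have e : ∀ Q : SkewFamily, HomogeneousFamily Q → CoproductFormula Q →
        VanishingCoefficient Q → StripCoefficient Q → extract (k + 1) (Q μ lam h) =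
        ∑ ν : Set.Icc μ lam, stripCoeff (k + 1) ν.1 lam • Q μ ν.1 ν.2.1 := by
      intro Q h1 h2 h3 h4
      have h5 := lTensor_rowCoeff_coproduct (k + 1) (Q μ lam h)
      rw [h2 μ lam h, map_sum] at h5
      rw [eq_sum_of_sum_tmul_eq _ h5]
      exact Finset.sum_congr rfl fun ν _ => by
        rw [rowCoeff_of_spec h1 h3 h4]
        rfl
    obtain ⟨k1, k2, k3, k4⟩ := skewFamily_spec
    rw [e Q h1 h2 h3 h4, e skewFamily k1 k2 k3 k4]
    refine Finset.sum_congr rfl fun ν _ => ?_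
    by_cases h0 : stripCoeff (k + 1) ν.1 lam = 0
    · rw [h0, zero_smul, zero_smul]
    · have hc := (stripCoeff_ne_zero h0).1
      rw [ih ν.1.card (by omega) ν.1 ν.2.1 rfl]
  · have h5 := rowCoeff_of_spec h1 h3 h4 h 0
    rw [rowCoeff_apply, extract_zero] at h5
    rw [h5]
    exact (constTerm_skewSym μ lam).symm

end SkewMacdonald

theorem proposition5p1 :
    (∃! D, SkewMacdonald.IsCoproduct D) ∧
    (∀ lam : YoungDiagram, ∃! f, SkewMacdonald.IsMacdonald lam f) ∧
    (∃! S, SkewMacdonald.IsSkewMacdonald S) ∧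
    ∀ Q : SkewMacdonald.SkewFamily,
      (SkewMacdonald.HomogeneousFamily Q ∧ SkewMacdonald.CoproductFormula Q ∧
        SkewMacdonald.VanishingCoefficient Q ∧ SkewMacdonald.StripCoefficient Q) ↔
      Q = SkewMacdonald.skewMacdonaldP := by
  refine ⟨SkewMacdonald.existsUnique_isCoproduct, SkewMacdonald.existsUnique_isMacdonald,
    ⟨_, SkewMacdonald.isSkewMacdonald_skewFamily,
      fun _ h => SkewMacdonald.isSkewMacdonald_iff.1 h⟩, fun Q => ?_⟩
  rw [SkewMacdonald.skewMacdonaldP_eq]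
  constructor
  · rintro ⟨h1, h2, h3, h4⟩
    exact SkewMacdonald.eq_skewFamily_of_spec h1 h2 h3 h4
  · rintro rfl
    exact SkewMacdonald.skewFamily_spec
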